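/- A $k$-edge path in an undirected graph $G$ is a sequence $v_0v_1\cdots v_k$ of $k+1$ distinct vertices such that $v_{i-1}v_i$ is an edge of $G$ for $i=1,\dots,k$. Consider random access machines over the natural numbers with instructions for constants, copying, addition, truncated subtraction, multiplication, direct and indirect addressing, reading from a read-only input, tests for zero and loops. Time is measured with logarithmic cost: an instruction costs one unit plus the binary lengths of the numbers and computed addresses that it handles, and a multiplication costs the product of the binary lengths of its factors, each increased by one. The space of a computation is the maximum, over its course, of the total binary length of the addresses and contents of the nonzero memory cells. There are a single program for such a machine and polynomials $p,q$ with nonnegative integer coefficients such that, for all integers $n,k\ge 0$ and every graph $G$ on the vertex set $\{0,\dots,n-1\}$, the program, given as input $n$, $k$ and the adjacency matrix of $G$, halts and outputs the number of $k$-edge paths in $G$, within time $$p(n,k)\cdot\max\Big\{1,\;3^{\lfloor k/2\rfloor}\binom{n}{\lfloor k/2\rfloor}\Big\}$$ and space $q(n,k)$. (The maximum differs from $3^{\lfloor k/2\rfloor}\binom{n}{\lfloor k/2\rfloor}$ only if $\lfloor k/2\rfloor>n$, when there are no $k$-edge paths.) -/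

import Mathlib

/-! A random access machine over the natural numbers with logarithmic (bit) cost, a read-only
input, structured programs, and the number of paths with a given number of edges in a graph. -/

namespace RAM

/-- The working memory: cells with addresses in `ℕ`, all but finitely many of which hold `0`. -/
abbrev Mem : Type := ℕ →₀ ℕ

/-- The basic instructions. The operands `d`, `a`, `b` are addresses of cells, and `c` is a
numeral; all of them are fixed by the program text. -/
inductive Instr : Type
  /-- `M[d] := c` -/
  | const (d c : ℕ)
  /-- `M[d] := M[a]` -/
  | copy (d a : ℕ)
  /-- `M[d] := M[a] + M[b]` -/
  | add (d a b : ℕ)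
  /-- `M[d] := max (M[a] - M[b]) 0` -/
  | sub (d a b : ℕ)
  /-- `M[d] := M[a] * M[b]` -/
  | mul (d a b : ℕ)
  /-- `M[d] := M[M[a]]` (indirect addressing) -/
  | load (d a : ℕ)
  /-- `M[M[a]] := M[b]` (indirect addressing) -/
  | store (a b : ℕ)
  /-- `M[d] := input[M[a]]`, where positions beyond the end of the input read as `0` -/
  | read (d a : ℕ)

/-- The memory after a basic instruction has been executed on the input `w`. -/
noncomputable def Instr.run (w : List ℕ) : Instr → Mem → Mem
  | .const d c, M => M.update d c
  | .copy d a, M => M.update d (M a)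
  | .add d a b, M => M.update d (M a + M b)
  | .sub d a b, M => M.update d (M a - M b)
  | .mul d a b, M => M.update d (M a * M b)
  | .load d a, M => M.update d (M (M a))
  | .store a b, M => M.update (M a) (M b)
  | .read d a, M => M.update d (w.getD (M a) 0)

/-- The time charged for a basic instruction: one unit plus the binary lengths of the numbers it
handles, including the addresses it computes; for a multiplication, the product of the lengths.
(The binary lengths of the direct addresses are constants of the program.) -/
def Instr.cost (w : List ℕ) : Instr → Mem → ℕ
  | .const _ c, _ => 1 + c.size
  | .copy _ a, M => 1 + (M a).size
  | .add _ a b, M => 1 + (M a).size + (M b).size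
  | .sub _ a b, M => 1 + (M a).size + (M b).size
  | .mul _ a b, M => (1 + (M a).size) * (1 + (M b).size)
  | .load _ a, M => 1 + (M a).size + (M (M a)).size
  | .store a b, M => 1 + (M a).size + (M b).size
  | .read _ a, M => 1 + (M a).size + (w.getD (M a) 0).size

/-- The space occupied by a memory: the total number of bits in the binary representations of the
addresses and of the contents of its nonzero cells. -/
def space (M : Mem) : ℕ := M.sum fun i x => i.size + x.size

/-- Programs: basic instructions, sequencing, and tests of a cell for being nonzero. -/
inductive Prog : Type
  | instr (i : Instr)
  | seq (P Q : Prog)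
  /-- if `M[a] ≠ 0` then `P` else `Q` -/
  | ite (a : ℕ) (P Q : Prog)
  /-- while `M[a] ≠ 0` do `P` -/
  | while (a : ℕ) (P : Prog)

/-- `Exec w P M t s M'` says that on the input `w` the program `P`, started on the memory `M`,
halts with the memory `M'` after time exactly `t`, and that `s` is exactly the maximum of the
space occupied at any moment of this computation. -/
inductive Exec (w : List ℕ) : Prog → Mem → ℕ → ℕ → Mem → Prop
  | instr (i : Instr) (M : Mem) :
      Exec w (.instr i) M (i.cost w M) (max (space M) (space (i.run w M))) (i.run w M)
  | seq {P Q : Prog} {M M' M'' : Mem} {t t' s s' : ℕ} :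
      Exec w P M t s M' → Exec w Q M' t' s' M'' →
      Exec w (.seq P Q) M (t + t') (max s s') M''
  | ite_true {a : ℕ} {P Q : Prog} {M M' : Mem} {t s : ℕ} :
      M a ≠ 0 → Exec w P M t s M' →
      Exec w (.ite a P Q) M (1 + (M a).size + t) s M'
  | ite_false {a : ℕ} {P Q : Prog} {M M' : Mem} {t s : ℕ} :
      M a = 0 → Exec w Q M t s M' →
      Exec w (.ite a P Q) M (1 + (M a).size + t) s M'
  | while_true {a : ℕ} {P : Prog} {M M' M'' : Mem} {t t' s s' : ℕ} :
      M a ≠ 0 → Exec w P M t s M' → Exec w (.while a P) M' t' s' M'' →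
      Exec w (.while a P) M (1 + (M a).size + t + t') (max s s') M''
  | while_false {a : ℕ} {P : Prog} {M : Mem} :
      M a = 0 → Exec w (.while a P) M (1 + (M a).size) (space M) M

end RAM

/-- The number of `k`-edge paths of `G`: sequences `v 0, v 1, …, v k` of `k + 1` distinct
vertices in which consecutive vertices are adjacent. -/
noncomputable def pathCount {V : Type*} (G : SimpleGraph V) (k : ℕ) : ℕ :=
  Nat.card {v : Fin (k + 1) → V //
    Function.Injective v ∧ ∀ i : Fin k, G.Adj (v i.castSucc) (v i.succ)}

open Classical in
/-- The input word for a graph on the vertices `0, …, n - 1` and a number `k`: the numbers `n`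
and `k`, followed by the `n * n` entries of the adjacency matrix, row by row. -/
noncomputable def graphInput {n : ℕ} (G : SimpleGraph (Fin n)) (k : ℕ) : List ℕ :=
  n :: k :: List.ofFn fun p : Fin (n * n) => if G.Adj p.divNat p.modNat then 1 else 0

/-! For `k ≥ n` there are no `k`-edge paths and for `k = 0` there are `n`; let `1 ≤ k < n`. Split
the `k + 1` vertices of a path into blocks of `a ≥ b ≥ 1` vertices whose sizes differ by at most
one. A path is then a pair of adjacent vertices `u`, `v` with a path on `a` vertices starting at `u`
and a path on `b` vertices starting at `v` that are disjoint. Two inclusion-exclusions remove the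
global conditions.

Disjointness: the indicator of `S ∩ T = ∅` is the sum of `(-1)^|X|` over all `X` contained in both
`S` and `T` (`ind_disjoint`). Hence the count is the sum over `X` of `(-1)^|X| ∑ adj u v * f_a(X,u)
* f_b(X,v)`, where `f_c(X,u)` counts the paths on `c` vertices that start at `u` and cover `X`. Only
`|X| ≤ b` contributes.

Distinctness: a walk on `c` vertices with vertex set `S` is a path covering `X` iff `S = A` for some
`c`-set `A ⊇ X`. The alternating sum over `S ⊆ Y ⊆ A` detects `S = A` (`sum_interval`). Exchanging
sums, each `Y` contributes the number of walks inside `Y`, which dynamic programming finds in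
polynomial time, times the number of `c`-sets `A ⊇ X ∪ Y`, a binomial coefficient (`sum_family`,
`halfPos_sub_halfNeg`). Only `|X ∪ Y| ≤ c` contributes.

The work is therefore a polynomial times the number of pairs `(X, Y)` with `|X ∪ Y| ≤ a`. A set `U`
is the union of `3^|U|` pairs, so this number is at most the sum of `3^m * n.choose m` over `m ≤ a ≤
k / 2 + 1`, which is a polynomial times `3^(k/2) * n.choose (k/2)` (`sum_card_family_le`). The sets
are enumerated in place, in colexicographic order, by a binary counter that jumps over everything
outside the family (`remaining_next`), so no list is stored and the space is polynomial.

The machine side is a small compiler: arrays interleaved in memory, expressions evaluated on a stack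
of scratch cells, and total-correctness rules `Trip` that count instructions. All numbers have
polynomially many bits, so the number of instructions determines the logarithmic cost up to a
polynomial factor. -/

namespace RAM

/-! ### Abstract states, expressions and their compilation -/

/-- Abstract states: `32` arrays of natural numbers; a scalar is kept at index `0`. -/
abbrev State : Type := Fin 32 → ℕ → ℕ

/-- The state `σ` after the assignment `j[i] := x`. -/
def State.upd (σ : State) (j : Fin 32) (i x : ℕ) : State :=
  Function.update σ j (Function.update (σ j) i x)

theorem State.upd_same (σ : State) (j : Fin 32) (i x : ℕ) : (σ.upd j i x) j i = x := by
  simp [State.upd]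

theorem State.upd_self (σ : State) (j : Fin 32) (i x : ℕ) :
    (σ.upd j i x) j = Function.update (σ j) i x := by
  simp [State.upd]

theorem State.upd_ne (σ : State) {j j' : Fin 32} (i x : ℕ) (h : j' ≠ j) :
    (σ.upd j i x) j' = σ j' := by
  simp [State.upd, h]

/-- Arithmetic expressions over the arrays and the input. -/
inductive Expr : Type
  | num (c : ℕ)
  | arr (j : Fin 32) (e : Expr)
  | inp (e : Expr)
  | add (e f : Expr)
  | sub (e f : Expr)
  | mul (e f : Expr)

namespace Expr

/-- The scalar `j`. -/
abbrev var (j : Fin 32) : Expr := arr j (num 0)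

instance : Add Expr := ⟨add⟩
instance : Sub Expr := ⟨sub⟩
instance : Mul Expr := ⟨mul⟩

/-- The value of an expression. -/
def val (w : List ℕ) (σ : State) : Expr → ℕ
  | num c => c
  | arr j e => σ j (e.val w σ)
  | inp e => w.getD (e.val w σ) 0
  | add e f => e.val w σ + f.val w σ
  | sub e f => e.val w σ - f.val w σ
  | mul e f => e.val w σ * f.val w σ

/-- A measure of the size of an expression. -/
def size : Expr → ℕ
  | num c => c + 1
  | arr _ e => e.size + 1
  | inp e => e.size + 1
  | add e f => e.size + f.size + 1
  | sub e f => e.size + f.size + 1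
  | mul e f => e.size + f.size + 1

section simps
variable (w : List ℕ) (σ : State) (c : ℕ) (j : Fin 32) (e f : Expr)
@[simp] theorem val_num : (num c).val w σ = c := rfl
@[simp] theorem val_arr : (arr j e).val w σ = σ j (e.val w σ) := rfl
@[simp] theorem val_inp : (inp e).val w σ = w.getD (e.val w σ) 0 := rfl
@[simp] theorem val_add : (e + f).val w σ = e.val w σ + f.val w σ := rfl
@[simp] theorem val_sub : (e - f).val w σ = e.val w σ - f.val w σ := rfl
@[simp] theorem val_mul : (e * f).val w σ = e.val w σ * f.val w σ := rfl
@[simp] theorem size_num : (num c).size = c + 1 := rfl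
@[simp] theorem size_arr : (arr j e).size = e.size + 1 := rfl
@[simp] theorem size_inp : (inp e).size = e.size + 1 := rfl
@[simp] theorem size_add : (e + f).size = e.size + f.size + 1 := rfl
@[simp] theorem size_sub : (e - f).size = e.size + f.size + 1 := rfl
@[simp] theorem size_mul : (e * f).size = e.size + f.size + 1 := rfl
end simps

theorem one_le_size (e : Expr) : 1 ≤ e.size := by cases e <;> simp [size]

/-- Replaces the index in the temporary cell `32 + d` by the address of the entry of the array
`j` with this index; the cell `33 + d` is overwritten. -/
def address (j : Fin 32) (d : ℕ) : Prog :=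
  .seq (.instr (.const (33 + d) 128)) (.seq (.instr (.mul (32 + d) (32 + d) (33 + d)))
    (.seq (.instr (.const (33 + d) j)) (.instr (.add (32 + d) (32 + d) (33 + d)))))

/-- The program that evaluates an expression into the temporary cell `32 + d`. -/
def code : Expr → ℕ → Prog
  | num c, d => .instr (.const (32 + d) c)
  | arr j e, d => .seq (e.code d) (.seq (address j d) (.instr (.load (32 + d) (32 + d))))
  | inp e, d => .seq (e.code d) (.instr (.read (32 + d) (32 + d)))
  | add e f, d => .seq (e.code d) (.seq (f.code (d + 1))
      (.instr (.add (32 + d) (32 + d) (33 + d))))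
  | sub e f, d => .seq (e.code d) (.seq (f.code (d + 1))
      (.instr (.sub (32 + d) (32 + d) (33 + d))))
  | mul e f, d => .seq (e.code d) (.seq (f.code (d + 1))
      (.instr (.mul (32 + d) (32 + d) (33 + d))))

/-- Sums and products of a `p`-bit and a `q`-bit number have at most `p + q` bits when `p, q ≥ 1`,
so bit lengths add up along the expression. Array and input reads fall back to `B` bits whatever
their index. A numeral `c` needs at most `c` bits, which is why it has size `c + 1`. -/
theorem val_lt {w : List ℕ} {σ : State} {B : ℕ} (hB : 1 ≤ B) (hw : ∀ i, w.getD i 0 < 2 ^ B)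
    (hσ : ∀ j i, σ j i < 2 ^ B) (e : Expr) : e.val w σ < 2 ^ (B * e.size) := by
  have pos : ∀ e : Expr, 1 ≤ B * e.size := fun e => Nat.mul_pos hB e.one_le_size
  have base : ∀ (e : Expr) x, x < 2 ^ B → x < 2 ^ (B * (e.size + 1)) := fun e x hx =>
    hx.trans_le (Nat.pow_le_pow_right (by norm_num) (Nat.le_mul_of_pos_right _ (Nat.succ_pos _)))
  have two : ∀ {x y p q : ℕ}, x < 2 ^ p → y < 2 ^ q → 1 ≤ p → 1 ≤ q → x + y < 2 ^ (p + q) ∧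
      x * y < 2 ^ (p + q) := by
    intro x y p q hx hy hp hq
    obtain ⟨p, rfl⟩ := Nat.exists_eq_add_of_le hp
    obtain ⟨q, rfl⟩ := Nat.exists_eq_add_of_le hq
    refine ⟨?_, ?_⟩
    · have h1 : 2 ^ (1 + p + (1 + q)) = 2 ^ (1 + p) * 2 ^ (1 + q) := pow_add _ _ _
      have h2 : 2 ≤ 2 ^ (1 + p) := by
        rw [pow_add]; exact Nat.le_mul_of_pos_right _ (by positivity)
      have h3 : 2 ≤ 2 ^ (1 + q) := by
        rw [pow_add]; exact Nat.le_mul_of_pos_right _ (by positivity)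
      rw [h1]; nlinarith
    · rw [pow_add]; exact Nat.mul_lt_mul'' hx hy
  have up : ∀ (e f : Expr) x, x < 2 ^ (B * e.size + B * f.size) →
      x < 2 ^ (B * (e.size + f.size + 1)) := fun e f x hx =>
    hx.trans_le (Nat.pow_le_pow_right (by norm_num) (by rw [← mul_add]; exact Nat.mul_le_mul_left _ (Nat.le_succ _)))
  induction e with
  | num c =>
    calc c < 2 ^ c := Nat.lt_two_pow_self
      _ ≤ 2 ^ (B * (c + 1)) := Nat.pow_le_pow_right (by norm_num) (by nlinarith)
  | arr j e ih => exact base e _ (hσ _ _)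
  | inp e ih => exact base e _ (hw _)
  | add e f ihe ihf => exact up e f _ (two ihe ihf (pos e) (pos f)).1
  | sub e f ihe ihf =>
    exact up e f _ ((Nat.sub_le _ _).trans_lt
      ((Nat.le_add_right _ _).trans_lt (two ihe ihf (pos e) (pos f)).1))
  | mul e f ihe ihf => exact up e f _ (two ihe ihf (pos e) (pos f)).2

end Expr

/-! ### Memory layout and the cost of compiled expressions -/

/-- All nonzero cells have addresses below `128 * L`, and all contents are bounded. -/
def Good (L B : ℕ) (M : Mem) : Prop :=
  (∀ x, 128 * L ≤ x → M x = 0) ∧ ∀ x, M x < 2 ^ (96 * B + 8)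

/-- The memory `M` represents the abstract state `σ`. -/
def Enc (L B : ℕ) (M : Mem) (σ : State) : Prop :=
  Good L B M ∧ (∀ (j : Fin 32) i, M (128 * i + j) = σ j i) ∧ ∀ j i, σ j i < 2 ^ B

/-- Execution within a time corresponding to `N` instructions and a bounded space. -/
def Runs (w : List ℕ) (L B : ℕ) (P : Prog) (M : Mem) (N : ℕ) (M' : Mem) : Prop :=
  ∃ t s, Exec w P M t s M' ∧ t ≤ N * (96 * B + 9) ^ 2 ∧
    s ≤ 128 * L * (128 * L + (96 * B + 8))

section
variable {w : List ℕ} {L B : ℕ}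

/-- At most `128 * L` cells are nonzero. Address lengths are bounded crudely by the addresses
themselves, which is still polynomial. -/
theorem Good.space_le {M : Mem} (h : Good L B M) :
    space M ≤ 128 * L * (128 * L + (96 * B + 8)) := by
  have hs : M.support ⊆ Finset.range (128 * L) := by
    intro x hx
    by_contra hc
    exact (Finsupp.mem_support_iff.mp hx) (h.1 x (by simpa using hc))
  calc space M ≤ ∑ x ∈ M.support, (128 * L + (96 * B + 8)) := by
        refine Finset.sum_le_sum fun x hx => Nat.add_le_add ?_ (Nat.size_le.mpr (h.2 x))
        exact Nat.size_le.mpr ((Finset.mem_range.mp (hs hx)).trans Nat.lt_two_pow_self)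
    _ ≤ _ := by
        rw [Finset.sum_const, smul_eq_mul]
        exact Nat.mul_le_mul_right _ (by simpa using Finset.card_le_card hs)

/-- The numbers handled are in the memory before the instruction, except the numeral of `const` and
the entry fetched by `read`; those are in the memory afterwards. Multiplication accounts for the
square in the unit of time. -/
theorem Runs.instr {i : Instr} {M : Mem} (h : Good L B M) (h' : Good L B (i.run w M)) :
    Runs w L B (.instr i) M 1 (i.run w M) := by
  refine ⟨_, _, .instr i M, ?_, max_le h.space_le h'.space_le⟩
  have hM : ∀ x, (M x).size ≤ 96 * B + 8 := fun x => Nat.size_le.mpr (h.2 x)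
  have hM' : ∀ x, (i.run w M x).size ≤ 96 * B + 8 := fun x => Nat.size_le.mpr (h'.2 x)
  have key : 1 + (96 * B + 8) + (96 * B + 8) ≤ 1 * (96 * B + 9) ^ 2 := by nlinarith
  cases i with
  | const d c => have := hM' d; simp [Instr.run] at this; simp only [Instr.cost]; omega
  | copy d a => have := hM a; simp only [Instr.cost]; omega
  | add d a b => have := hM a; have := hM b; simp only [Instr.cost]; omega
  | sub d a b => have := hM a; have := hM b; simp only [Instr.cost]; omega
  | mul d a b =>
    simp only [Instr.cost]
    calc (1 + (M a).size) * (1 + (M b).size) ≤ (96 * B + 9) * (96 * B + 9) :=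
          Nat.mul_le_mul (by have := hM a; omega) (by have := hM b; omega)
      _ = _ := by ring
  | load d a => have := hM a; have := hM (M a); simp only [Instr.cost]; omega
  | store a b => have := hM a; have := hM b; simp only [Instr.cost]; omega
  | read d a =>
    have h1 := hM a
    have := hM' d; simp [Instr.run] at this; simp only [Instr.cost, List.getD_eq_getElem?_getD]
    omega

theorem Runs.seq {P Q : Prog} {M M' M'' : Mem} {N N' : ℕ} (h : Runs w L B P M N M')
    (h' : Runs w L B Q M' N' M'') : Runs w L B (.seq P Q) M (N + N') M'' := by
  obtain ⟨t, s, h1, h2, h3⟩ := h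
  obtain ⟨t', s', h1', h2', h3'⟩ := h'
  exact ⟨_, _, .seq h1 h1', by rw [add_mul]; omega, max_le h3 h3'⟩

theorem Runs.mono {P : Prog} {M M' : Mem} {N N' : ℕ} (h : Runs w L B P M N M')
    (hN : N ≤ N') : Runs w L B P M N' M' := by
  obtain ⟨t, s, h1, h2, h3⟩ := h
  exact ⟨t, s, h1, h2.trans (Nat.mul_le_mul_right _ hN), h3⟩

theorem Good.test_le {M : Mem} (h : Good L B M) (a : ℕ) :
    1 + (M a).size ≤ (96 * B + 9) ^ 2 := by
  have := Nat.size_le.mpr (h.2 a)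
  nlinarith

theorem Runs.ite_true {P Q : Prog} {M M' : Mem} {N a : ℕ} (hM : Good L B M) (ha : M a ≠ 0)
    (h : Runs w L B P M N M') : Runs w L B (.ite a P Q) M (N + 1) M' := by
  obtain ⟨t, s, h1, h2, h3⟩ := h
  exact ⟨_, _, .ite_true ha h1, by have := hM.test_le a; rw [add_mul]; omega, h3⟩

theorem Runs.ite_false {P Q : Prog} {M M' : Mem} {N a : ℕ} (hM : Good L B M) (ha : M a = 0)
    (h : Runs w L B Q M N M') : Runs w L B (.ite a P Q) M (N + 1) M' := by
  obtain ⟨t, s, h1, h2, h3⟩ := h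
  exact ⟨_, _, .ite_false ha h1, by have := hM.test_le a; rw [add_mul]; omega, h3⟩

theorem Runs.while_true {P : Prog} {M M' M'' : Mem} {N N' a : ℕ} (hM : Good L B M)
    (ha : M a ≠ 0) (h : Runs w L B P M N M') (h' : Runs w L B (.while a P) M' N' M'') :
    Runs w L B (.while a P) M (N + N' + 1) M'' := by
  obtain ⟨t, s, h1, h2, h3⟩ := h
  obtain ⟨t', s', h1', h2', h3'⟩ := h'
  exact ⟨_, _, .while_true ha h1 h1', by have := hM.test_le a; rw [add_mul, add_mul]; omega,
    max_le h3 h3'⟩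

theorem Runs.while_false {P : Prog} {M : Mem} {a : ℕ} (hM : Good L B M) (ha : M a = 0) :
    Runs w L B (.while a P) M 1 M :=
  ⟨_, _, .while_false ha, by have := hM.test_le a; omega, hM.space_le⟩

theorem Good.update {M : Mem} (h : Good L B M) {x y : ℕ} (hx : x < 128 * L)
    (hy : y < 2 ^ (96 * B + 8)) : Good L B (M.update x y) := by
  refine ⟨fun z hz => ?_, fun z => ?_⟩
  · rw [Finsupp.update_apply, if_neg (by omega)]; exact h.1 z hz
  · rw [Finsupp.update_apply]; split_ifs
    · exact hy
    · exact h.2 z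

/-- The effect of a program that evaluates something into the temporary cell `32 + d`. -/
def Evals (w : List ℕ) (L B : ℕ) (P : Prog) (M : Mem) (d x N : ℕ) : Prop :=
  ∃ M', Runs w L B P M N M' ∧ Good L B M' ∧ M' (32 + d) = x ∧
    ∀ z, z < 32 + d ∨ 128 ≤ z → M' z = M z

theorem evals_instr {i : Instr} {M : Mem} {d x : ℕ} (h : Good L B M) (hL : 1 ≤ L) (hd : d < 96)
    (hi : i.run w M = M.update (32 + d) x) (hx : x < 2 ^ (96 * B + 8)) :
    Evals w L B (.instr i) M d x 1 := by
  have h' : Good L B (i.run w M) := hi ▸ h.update (by omega) hx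
  refine ⟨_, .instr h h', h', by simp [hi], fun z hz => ?_⟩
  rw [hi, Finsupp.update_apply, if_neg (by omega)]

theorem Evals.seq {P Q : Prog} {M : Mem} {d x y N N' N'' : ℕ} (h : Evals w L B P M d x N)
    (h' : ∀ M', Good L B M' → M' (32 + d) = x → (∀ z, z < 32 + d ∨ 128 ≤ z → M' z = M z) →
      Evals w L B Q M' d y N') (hN : N + N' ≤ N'') : Evals w L B (.seq P Q) M d y N'' := by
  obtain ⟨M', h1, h2, h3, h4⟩ := h
  obtain ⟨M'', h1', h2', h3', h4'⟩ := h' M' h2 h3 h4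
  exact ⟨M'', (h1.seq h1').mono hN, h2', h3', fun z hz => (h4' z hz).trans (h4 z hz)⟩

theorem Evals.seq_succ {P Q : Prog} {M : Mem} {d x y N N' N'' : ℕ}
    (h : Evals w L B P M (d + 1) x N)
    (h' : ∀ M', Good L B M' → M' (32 + (d + 1)) = x →
      (∀ z, z < 32 + (d + 1) ∨ 128 ≤ z → M' z = M z) →
      Evals w L B Q M' d y N') (hN : N + N' ≤ N'') : Evals w L B (.seq P Q) M d y N'' := by
  obtain ⟨M', h1, h2, h3, h4⟩ := h
  obtain ⟨M'', h1', h2', h3', h4'⟩ := h' M' h2 h3 h4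
  exact ⟨M'', (h1.seq h1').mono hN, h2', h3', fun z hz => (h4' z hz).trans (h4 z (by omega))⟩

/-- The 8 bits beyond `96 * B` in `Good` make room for the factor `128` and the offset `j`. -/
theorem evals_address {M : Mem} {d x : ℕ} (j : Fin 32) (h : Good L B M) (hL : 1 ≤ L)
    (hd : d + 1 < 96) (hx : M (32 + d) = x) (hb : 128 * x + 128 ≤ 2 ^ (96 * B + 8)) :
    Evals w L B (Expr.address j d) M d (128 * x + j) 4 := by
  have h2 : 2 ^ 8 ≤ 2 ^ (96 * B + 8) := Nat.pow_le_pow_right (by norm_num) (by omega)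
  have hj := j.2
  refine Evals.seq_succ (x := 128) (N := 1) (N' := 3) (evals_instr h hL (by omega) ?_ (by omega)) ?_ le_rfl
  · simp [Instr.run]; congr 1; omega
  intro M1 g1 e1 f1
  refine Evals.seq (x := 128 * x) (N := 1) (N' := 2) (evals_instr g1 hL (by omega) ?_ (by omega)) ?_ le_rfl
  · have e1' : M1 (33 + d) = 128 := by rw [← e1]; congr 1; omega
    simp [Instr.run, e1', f1 (32 + d) (by omega), hx, mul_comm]
  intro M2 g2 e2 f2
  refine Evals.seq_succ (x := j) (N := 1) (N' := 1) (evals_instr g2 hL (by omega) ?_ (by omega)) ?_ le_rfl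
  · simp [Instr.run]; congr 1; omega
  intro M3 g3 e3 f3
  refine evals_instr g3 hL (by omega) ?_ (by omega)
  have e3' : M3 (33 + d) = j := by rw [← e3]; congr 1; omega
  simp [Instr.run, e3', f3 (32 + d) (by omega), e2]

/-- Arrays occupy only addresses congruent to `0, …, 31` modulo `128`, so the cells `32, …, 127` are
free scratch space. -/
theorem Enc.congr {M M' : Mem} {σ : State} (h : Enc L B M σ) (h' : Good L B M')
    (hM : ∀ z, z < 32 ∨ 128 ≤ z → M' z = M z) : Enc L B M' σ := by
  refine ⟨h', fun j i => ?_, h.2.2⟩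
  rw [hM _ (by have := j.2; omega), h.2.1]

/-- The scratch cells act as a stack: the value at depth `d` survives while the second operand is
evaluated at depth `d + 1`. The bound `96` keeps the stack below address `128`. An array access
costs five instructions on top of its index, hence the factor `6`. -/
theorem evals_code (hB : 1 ≤ B) (hL : 1 ≤ L) (hw : ∀ i, w.getD i 0 < 2 ^ B) {σ : State}
    (e : Expr) : ∀ {d : ℕ} {M : Mem}, Enc L B M σ → d + e.size < 96 →
      Evals w L B (e.code d) M d (e.val w σ) (6 * e.size) := by
  have hlt : ∀ {σ : State} {M : Mem} (e : Expr), Enc L B M σ → e.size ≤ 96 →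
      e.val w σ < 2 ^ (96 * B) := fun e h he =>
    (e.val_lt hB hw h.2.2).trans_le (Nat.pow_le_pow_right (by norm_num) (by nlinarith))
  have h8 : 2 ^ (96 * B + 8) = 256 * 2 ^ (96 * B) := by rw [pow_add]; ring
  have bin : ∀ (e f : Expr) (g : Expr) (i : Instr), g.size = e.size + f.size + 1 →
      (∀ {d : ℕ} {M : Mem}, Enc L B M σ → d + e.size < 96 →
        Evals w L B (e.code d) M d (e.val w σ) (6 * e.size)) →
      (∀ {d : ℕ} {M : Mem}, Enc L B M σ → d + f.size < 96 →
        Evals w L B (f.code d) M d (f.val w σ) (6 * f.size)) →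
      ∀ {d : ℕ} {M : Mem}, Enc L B M σ → d + g.size < 96 →
      (∀ M' : Mem, M' (32 + d) = e.val w σ → M' (33 + d) = f.val w σ →
        i.run w M' = M'.update (32 + d) (g.val w σ)) →
      Evals w L B (.seq (e.code d) (.seq (f.code (d + 1)) (.instr i))) M d (g.val w σ)
        (6 * g.size) := by
    intro e f g i hg ihe ihf d M hM hd hi
    refine Evals.seq (ihe hM (by omega)) (N' := 6 * f.size + 1) ?_ (by omega)
    intro M1 g1 e1 f1
    have E1 := hM.congr g1 (fun z hz => f1 z (by omega))
    refine Evals.seq_succ (ihf E1 (by omega)) (N' := 1) ?_ (by omega)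
    intro M2 g2 e2 f2
    refine evals_instr g2 hL (by omega) (hi M2 ?_ ?_) ?_
    · rw [f2 _ (by omega), e1]
    · rw [← e2]; congr 1; omega
    · have := hlt g hM (by omega); omega
  induction e with
  | num c =>
    intro d M hM hd
    have := hlt (.num c) hM (by omega)
    simp only [Expr.size] at hd
    exact (evals_instr hM.1 hL (by omega) rfl (by omega)).imp
      fun M' h => ⟨h.1.mono (by simp [Expr.size]; omega), h.2⟩
  | arr j e ih =>
    intro d M hM hd
    have h1 := hlt e hM (by simp [Expr.size] at hd; omega)
    have hpos := e.one_le_size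
    simp only [Expr.size] at hd
    refine Evals.seq (ih hM (by omega)) (N' := 5) ?_ (by simp [Expr.size]; omega)
    intro M1 g1 e1 f1
    have E1 := hM.congr g1 (fun z hz => f1 z (by omega))
    refine Evals.seq (evals_address j g1 hL (by omega) e1 (by omega)) (N' := 1) ?_ le_rfl
    intro M2 g2 e2 f2
    have E2 := E1.congr g2 (fun z hz => f2 z (by omega))
    refine evals_instr g2 hL (by omega) ?_ ?_
    · simp [Instr.run, e2, Expr.val, E2.2.1]
    · have := hlt (.arr j e) hM (by simp [Expr.size]; omega); omega
  | inp e ih =>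
    intro d M hM hd
    simp only [Expr.size] at hd
    refine Evals.seq (ih hM (by omega)) (N' := 1) ?_ (by rw [Expr.size]; omega)
    intro M1 g1 e1 f1
    refine evals_instr g1 hL (by omega) ?_ ?_
    · simp [Instr.run, e1, Expr.val]
    · have := hlt (.inp e) hM (by simp [Expr.size]; omega); omega
  | add e f ihe ihf =>
    intro d M hM hd
    exact bin e f (.add e f) (.add _ _ _) rfl ihe ihf hM hd
      fun M' h1 h2 => by simp [Instr.run, h1, h2, Expr.val]
  | sub e f ihe ihf =>
    intro d M hM hd
    exact bin e f (.sub e f) (.sub _ _ _) rfl ihe ihf hM hd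
      fun M' h1 h2 => by simp [Instr.run, h1, h2, Expr.val]
  | mul e f ihe ihf =>
    intro d M hM hd
    exact bin e f (.mul e f) (.mul _ _ _) rfl ihe ihf hM hd
      fun M' h1 h2 => by simp [Instr.run, h1, h2, Expr.val]

end

/-! ### Structured programs and rules for total correctness -/

/-- `j[e] := f` -/
def assign (j : Fin 32) (e f : Expr) : Prog :=
  .seq (e.code 0) (.seq (Expr.address j 0) (.seq (f.code 1) (.instr (.store 32 33))))

/-- `if e ≠ 0 then P else Q` -/
def branch (e : Expr) (P Q : Prog) : Prog := .seq (e.code 0) (.ite 32 P Q)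

/-- `while e ≠ 0 do P` -/
def loop (e : Expr) (P : Prog) : Prog :=
  .seq (e.code 0) (.while 32 (.seq P (e.code 0)))

/-- `for i := 0, …, e - 1 do P` -/
def forLoop (i : Fin 32) (e : Expr) (P : Prog) : Prog :=
  .seq (assign i (.num 0) (.num 0))
    (loop (e - .var i) (.seq P (assign i (.num 0) (.var i + .num 1))))

/-- Total correctness with a bound on the number of instructions: started in the state `σ`, the
program `P` halts after at most `N` instructions in a state satisfying `Q`. -/
def Trip (w : List ℕ) (L B : ℕ) (P : Prog) (σ : State) (N : ℕ) (Q : State → Prop) : Prop :=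
  ∀ M, Enc L B M σ → ∃ M' σ', Enc L B M' σ' ∧ Q σ' ∧ Runs w L B P M N M'

section
variable {w : List ℕ} {L B : ℕ}

theorem Trip.mono {P : Prog} {σ : State} {N N' : ℕ} {Q Q' : State → Prop}
    (h : Trip w L B P σ N Q) (hN : N ≤ N') (hQ : ∀ σ', Q σ' → Q' σ') :
    Trip w L B P σ N' Q' := by
  intro M hM
  obtain ⟨M', σ', h1, h2, h3⟩ := h M hM
  exact ⟨M', σ', h1, hQ _ h2, h3.mono hN⟩

theorem Trip.seq {P P' : Prog} {σ : State} {N N' : ℕ} {Q : State → Prop}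
    (h : Trip w L B P σ N (fun σ' => Trip w L B P' σ' N' Q)) :
    Trip w L B (.seq P P') σ (N + N') Q := by
  intro M hM
  obtain ⟨M', σ', h1, h2, h3⟩ := h M hM
  obtain ⟨M'', σ'', h1', h2', h3'⟩ := h2 M' h1
  exact ⟨M'', σ'', h1', h2', h3.seq h3'⟩

/-- The standing assumptions on the bounds. -/
def Ambient (w : List ℕ) (L B : ℕ) : Prop := 1 ≤ B ∧ 1 ≤ L ∧ ∀ i, w.getD i 0 < 2 ^ B

theorem Trip.of_assign (A : Ambient w L B) {j : Fin 32} {e f : Expr} {σ : State}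
    {Q : State → Prop} {N : ℕ} (he : e.size + f.size < 90)
    (hN : 6 * (e.size + f.size + 1) ≤ N) (hi : e.val w σ < L)
    (hx : f.val w σ < 2 ^ B) (hQ : Q (σ.upd j (e.val w σ) (f.val w σ))) :
    Trip w L B (RAM.assign j e f) σ N Q := by
  obtain ⟨hB, hL, hw⟩ := A
  intro M hM
  have h8 : 2 ^ (96 * B + 8) = 256 * 2 ^ (96 * B) := by rw [pow_add]; ring
  have hlt : e.val w σ < 2 ^ (96 * B) :=
    (e.val_lt hB hw hM.2.2).trans_le (Nat.pow_le_pow_right (by norm_num) (by nlinarith))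
  obtain ⟨M1, r1, g1, v1, f1⟩ := evals_code hB hL hw e hM (d := 0) (by omega)
  have E1 := hM.congr g1 (fun z hz => f1 z (by omega))
  obtain ⟨M2, r2, g2, v2, f2⟩ := evals_address (w := w) j g1 hL (by omega) v1 (by omega)
  have E2 := E1.congr g2 (fun z hz => f2 z (by omega))
  obtain ⟨M3, r3, g3, v3, f3⟩ := evals_code hB hL hw f E2 (d := 1) (by omega)
  have E3 := E2.congr g3 (fun z hz => f3 z (by omega))
  have v2' : M3 32 = 128 * e.val w σ + j := by rw [f3 _ (by omega)]; exact v2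
  have v3' : M3 33 = f.val w σ := v3
  have hrun : (Instr.store 32 33).run w M3 = M3.update (128 * e.val w σ + j) (f.val w σ) := by
    simp [Instr.run, v2', v3']
  have hB' : 2 ^ B ≤ 2 ^ (96 * B + 8) := Nat.pow_le_pow_right (by norm_num) (by omega)
  have hj := j.2
  have g4 := g3.update (x := 128 * e.val w σ + j) (y := f.val w σ) (by omega) (by omega)
  have r4 := Runs.instr (w := w) g3 (hrun ▸ g4)
  rw [hrun] at r4
  refine ⟨_, _, ⟨g4, fun j' i' => ?_, fun j' i' => ?_⟩, hQ,
    (r1.seq (r2.seq (r3.seq r4))).mono (by omega)⟩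
  · rw [Finsupp.update_apply]
    have hj' := j'.2
    by_cases hc : j' = j
    · subst hc
      rw [State.upd_self, Function.update_apply]
      by_cases hi' : i' = e.val w σ
      · simp [hi']
      · rw [if_neg (by omega), if_neg hi', E3.2.1]
    · rw [State.upd_ne _ _ _ hc, if_neg, E3.2.1]
      -- The remainder modulo `128` of an address recovers the array it belongs to.
      intro h; exact hc (Fin.ext (by omega))
  · by_cases hc : j' = j
    · subst hc
      rw [State.upd_self, Function.update_apply]
      split_ifs
      · exact hx
      · exact hM.2.2 _ _
    · rw [State.upd_ne _ _ _ hc]; exact hM.2.2 _ _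

theorem Trip.of_branch (A : Ambient w L B) {e : Expr} {P P' : Prog} {σ : State} {N : ℕ}
    {Q : State → Prop} (he : e.size < 90)
    (h : e.val w σ ≠ 0 → Trip w L B P σ N Q) (h' : e.val w σ = 0 → Trip w L B P' σ N Q) :
    Trip w L B (RAM.branch e P P') σ (6 * e.size + 1 + N) Q := by
  obtain ⟨hB, hL, hw⟩ := A
  intro M hM
  obtain ⟨M1, r1, g1, v1, f1⟩ := evals_code hB hL hw e hM (d := 0) (by omega)
  have E1 := hM.congr g1 (fun z hz => f1 z (by omega))
  by_cases hc : e.val w σ = 0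
  · obtain ⟨M2, σ2, E2, q2, r2⟩ := h' hc M1 E1
    exact ⟨M2, σ2, E2, q2, (r1.seq (Runs.ite_false g1 (v1.trans hc) r2)).mono (by omega)⟩
  · obtain ⟨M2, σ2, E2, q2, r2⟩ := h hc M1 E1
    exact ⟨M2, σ2, E2, q2,
      (r1.seq (Runs.ite_true g1 (fun h0 => hc (v1.symm.trans h0)) r2)).mono (by omega)⟩

/-- The rule for loops; `m` in the invariant `I m` is the remaining number of instructions. -/
theorem Trip.of_loop (A : Ambient w L B) {e : Expr} {P : Prog} {Q : State → Prop}
    (he : e.size < 90) (I : ℕ → State → Prop)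
    (hI : ∀ m σ, I m σ → (e.val w σ = 0 ∧ Q σ) ∨
      (e.val w σ ≠ 0 ∧ ∃ m₁ m₂, m₁ + m₂ + 6 * e.size + 1 ≤ m ∧ Trip w L B P σ m₁ (I m₂)))
    {m : ℕ} {σ : State} (h : I m σ) :
    Trip w L B (RAM.loop e P) σ (m + 6 * e.size + 1) Q := by
  obtain ⟨hB, hL, hw⟩ := A
  have key : ∀ m σ, I m σ → ∀ M, Enc L B M σ → M 32 = e.val w σ →
      ∃ M' σ', Enc L B M' σ' ∧ Q σ' ∧
        Runs w L B (.while 32 (.seq P (e.code 0))) M (m + 1) M' := by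
    intro m
    induction m using Nat.strong_induction_on with
    | _ m ih =>
      intro σ hσ M hM hv
      obtain ⟨h0, hQ⟩ | ⟨h0, m1, m2, hm, hP⟩ := hI m σ hσ
      · exact ⟨M, σ, hM, hQ, (Runs.while_false hM.1 (hv.trans h0)).mono (by omega)⟩
      · obtain ⟨M1, σ1, E1, I1, r1⟩ := hP M hM
        obtain ⟨M2, r2, g2, v2, f2⟩ := evals_code hB hL hw e E1 (d := 0) (by omega)
        have E2 := E1.congr g2 (fun z hz => f2 z (by omega))
        obtain ⟨M3, σ3, E3, q3, r3⟩ := ih m2 (by omega) σ1 I1 M2 E2 v2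
        exact ⟨M3, σ3, E3, q3,
          (Runs.while_true hM.1 (fun h1 => h0 (hv.symm.trans h1)) (r1.seq r2) r3).mono
            (by omega)⟩
  intro M hM
  obtain ⟨M1, r1, g1, v1, f1⟩ := evals_code hB hL hw e hM (d := 0) (by omega)
  have E1 := hM.congr g1 (fun z hz => f1 z (by omega))
  obtain ⟨M3, σ3, E3, q3, r3⟩ := key m σ h M1 E1 v1
  exact ⟨M3, σ3, E3, q3, (r1.seq r3).mono (by omega)⟩

/-- With truncated subtraction, the condition `e - i` vanishes exactly when the counter reaches `m`.
Each round pays `N` for the body, `42` for the increment and `6 * e.size + 19` for the test; `80`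
leaves slack, and the extra round in `m + 1` pays for the start and the exit. -/
theorem Trip.of_forLoop (A : Ambient w L B) {i : Fin 32} {e : Expr} {P : Prog} {σ : State}
    {Q : State → Prop} {m N : ℕ} (he : e.size < 80) (hm : m < 2 ^ B) (I : ℕ → State → Prop)
    (h0 : I 0 (σ.upd i 0 0)) (hv : ∀ l τ, I l τ → τ i 0 = l ∧ e.val w τ = m)
    (hs : ∀ l τ, l < m → I l τ →
      Trip w L B P τ N (fun τ' => τ' i 0 = l ∧ I (l + 1) (τ'.upd i 0 (l + 1))))
    (hQ : ∀ τ, I m τ → Q τ) :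
    Trip w L B (RAM.forLoop i e P) σ ((m + 1) * (N + 6 * e.size + 80)) Q := by
  have hs0 : (e - Expr.var i).size = e.size + 3 := rfl
  refine Trip.mono (Trip.seq (N := 18) (N' := m * (N + 6 * e.size + 80) + 6 * e.size + 19)
    (Trip.of_assign A (by simp) (by simp) A.2.1 (by simp) ?_)) (by linarith) (fun _ h => h)
  refine Trip.mono (Trip.of_loop A (by rw [hs0]; omega)
    (fun r τ => ∃ l, l ≤ m ∧ I l τ ∧ (m - l) * (N + 6 * e.size + 80) = r)
    ?_ ⟨0, Nat.zero_le _, h0, rfl⟩) (by simp [hs0]; omega) (fun _ h => h)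
  rintro r τ ⟨l, hl, hI, rfl⟩
  obtain ⟨h1, h2⟩ := hv l τ hI
  have hval : (e - Expr.var i).val w τ = m - l := by simp [h1, h2]
  rcases Nat.eq_or_lt_of_le hl with rfl | hlt
  · exact Or.inl ⟨by simp [hval], hQ _ hI⟩
  refine Or.inr ⟨by omega, N + 42, (m - (l + 1)) * (N + 6 * e.size + 80), ?_, ?_⟩
  · have : m - l = m - (l + 1) + 1 := by omega
    rw [hs0, this, add_mul]; omega
  · refine Trip.seq (N' := 42) ((hs l τ hlt hI).mono le_rfl fun τ' h => ?_)
    have h1 : (Expr.var i + Expr.num 1).val w τ' = l + 1 := by simp [h.1]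
    refine Trip.of_assign A (by simp) (by simp) A.2.1 (by rw [h1]; omega) ?_
    rw [h1]
    exact ⟨l + 1, hlt, h.2, rfl⟩

end

end RAM

/-! ### The inclusion-exclusion formula for the number of paths -/

section

open Finset

namespace PathSum

/-- The number of walks on `t + 1` vertices of `Y` that start at `u`. -/
def walks (n : ℕ) (adj : ℕ → ℕ → ℕ) : ℕ → Finset ℕ → ℕ → ℕ
  | 0, Y, u => if u ∈ Y then 1 else 0
  | t + 1, Y, u => (if u ∈ Y then 1 else 0) * ∑ v ∈ range n, adj u v * walks n adj t Y v

/-- The sets whose union with `base` has at most `cap` elements. -/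
def family (n cap : ℕ) (base : Finset ℕ) : Finset (Finset ℕ) :=
  (range n).powerset.filter fun Z => (base ∪ Z).card ≤ cap

def weight (n : ℕ) (adj : ℕ → ℕ → ℕ) (c : ℕ) (X Y : Finset ℕ) (u : ℕ) : ℕ :=
  (n - (X ∪ Y).card).choose (c - (X ∪ Y).card) * walks n adj (c - 1) Y u

def halfPos (n : ℕ) (adj : ℕ → ℕ → ℕ) (c : ℕ) (X : Finset ℕ) (u : ℕ) : ℕ :=
  ∑ Y ∈ family n c X, (1 - Y.card % 2) * weight n adj c X Y u

def halfNeg (n : ℕ) (adj : ℕ → ℕ → ℕ) (c : ℕ) (X : Finset ℕ) (u : ℕ) : ℕ :=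
  ∑ Y ∈ family n c X, Y.card % 2 * weight n adj c X Y u

/-- The number of paths on `c` vertices that start at `u` and cover `X`, by inclusion and
exclusion. -/
def half (n : ℕ) (adj : ℕ → ℕ → ℕ) (c : ℕ) (X : Finset ℕ) (u : ℕ) : ℕ :=
  (halfPos n adj c X u - halfNeg n adj c X u) + (halfNeg n adj c X u - halfPos n adj c X u)

def joined (n : ℕ) (adj : ℕ → ℕ → ℕ) (a b : ℕ) (X : Finset ℕ) : ℕ :=
  ∑ u ∈ range n, ∑ v ∈ range n, adj u v * half n adj a X u * half n adj b X v

def joinedPos (n : ℕ) (adj : ℕ → ℕ → ℕ) (a b : ℕ) : ℕ :=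
  ∑ X ∈ family n b ∅, (1 - X.card % 2) * joined n adj a b X

def joinedNeg (n : ℕ) (adj : ℕ → ℕ → ℕ) (a b : ℕ) : ℕ :=
  ∑ X ∈ family n b ∅, X.card % 2 * joined n adj a b X

/-- The sum of `g` over all lists of `c` numbers below `n`. -/
def seqSum (n : ℕ) : ℕ → (List ℕ → ℤ) → ℤ
  | 0, g => g []
  | c + 1, g => ∑ u ∈ range n, seqSum n c fun l => g (u :: l)

section seqSum
variable {n : ℕ}

theorem seqSum_congr {c : ℕ} : ∀ {g g' : List ℕ → ℤ},
    (∀ l : List ℕ, l.length = c → (∀ x ∈ l, x < n) → g l = g' l) → seqSum n c g = seqSum n c g' := by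
  induction c with
  | zero => intro g g' h; exact h [] rfl (by simp)
  | succ c ih =>
    intro g g' h
    refine sum_congr rfl fun u hu => ih fun l hl hx => h _ (by simp [hl]) ?_
    intro x hx'
    rcases List.mem_cons.mp hx' with rfl | h'
    · exact mem_range.mp hu
    · exact hx x h'

theorem seqSum_sum {ι : Type*} (s : Finset ι) (c : ℕ) : ∀ (g : ι → List ℕ → ℤ),
    seqSum n c (fun l => ∑ i ∈ s, g i l) = ∑ i ∈ s, seqSum n c (g i) := by
  induction c with
  | zero => intro g; rfl
  | succ c ih => intro g; simp only [seqSum, ih]; exact sum_comm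

theorem seqSum_mul (c : ℕ) (x : ℤ) : ∀ (g : List ℕ → ℤ),
    seqSum n c (fun l => x * g l) = x * seqSum n c g := by
  induction c with
  | zero => intro g; rfl
  | succ c ih => intro g; simp only [seqSum, ih, mul_sum]

theorem seqSum_zero (c : ℕ) : seqSum n c (fun _ => 0) = 0 := by
  simpa using seqSum_mul (n := n) c 0 (fun _ => 0)

theorem seqSum_nonneg {c : ℕ} : ∀ {g : List ℕ → ℤ}, (∀ l, 0 ≤ g l) → 0 ≤ seqSum n c g := by
  induction c with
  | zero => intro g h; exact h _
  | succ c ih => intro g h; exact sum_nonneg fun u _ => ih fun l => h _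

theorem seqSum_append (a b : ℕ) : ∀ (g : List ℕ → ℤ),
    seqSum n (a + b) g = seqSum n a fun l => seqSum n b fun l' => g (l ++ l') := by
  induction a with
  | zero => intro g; simp [seqSum]
  | succ a ih =>
    intro g
    rw [show a + 1 + b = (a + b) + 1 by ring]
    simp only [seqSum, ih, List.cons_append]

/-- Lets the first block of a path be read backwards, from the joining edge outwards. -/
theorem seqSum_reverse (c : ℕ) : ∀ (g : List ℕ → ℤ),
    seqSum n c (fun l => g l.reverse) = seqSum n c g := by
  induction c with
  | zero => intro g; rfl
  | succ c ih =>
    intro g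
    rw [seqSum_append c 1]
    simp only [seqSum]
    rw [seqSum_sum]
    refine sum_congr rfl fun u _ => ?_
    simpa using ih fun l => g (u :: l)

/-- Connects the iterated sums, which suit induction, with sums over functions on `Fin c`, in which
paths are defined. -/
theorem seqSum_eq_sum (c : ℕ) : ∀ (g : List ℕ → ℤ),
    seqSum n c g = ∑ f : Fin c → Fin n, g (List.ofFn fun i => (f i : ℕ)) := by
  induction c with
  | zero => intro g; simp [seqSum]
  | succ c ih =>
    intro g
    rw [← (Fin.consEquiv fun _ : Fin (c + 1) => Fin n).sum_comp, Fintype.sum_prod_type]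
    simp only [seqSum, ih]
    rw [Finset.sum_range]
    refine sum_congr rfl fun u _ => sum_congr rfl fun f _ => ?_
    simp [Fin.consEquiv, List.ofFn_succ]

end seqSum

/-- For `S ⊆ A`, write `Y = S ∪ Z` with `Z ⊆ A \ S`; the alternating sum over the subsets of `A \ S`
vanishes unless `A \ S` is empty. -/
theorem sum_interval {U A S : Finset ℕ} (hA : A ⊆ U) :
    ∑ Y ∈ U.powerset, (-1 : ℤ) ^ Y.card * (if S ⊆ Y ∧ Y ⊆ A then 1 else 0) =
      if S = A then (-1) ^ A.card else 0 := by
  by_cases hS : S ⊆ A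
  · have h1 : ∑ Y ∈ U.powerset, (-1 : ℤ) ^ Y.card * (if S ⊆ Y ∧ Y ⊆ A then 1 else 0) =
        ∑ Y ∈ Icc S A, (-1 : ℤ) ^ Y.card := by
      simp only [mul_ite, mul_one, mul_zero]
      rw [← sum_filter]
      congr 1
      ext Y
      simp only [mem_filter, mem_powerset, mem_Icc]
      exact ⟨fun h => h.2, fun h => ⟨h.2.trans hA, h⟩⟩
    have disj : ∀ Z ∈ (A \ S).powerset, Disjoint S Z := fun Z hZ =>
      disjoint_of_subset_right (mem_powerset.mp hZ) disjoint_sdiff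
    have h2 : ∑ Y ∈ Icc S A, (-1 : ℤ) ^ Y.card =
        (-1) ^ S.card * ∑ Z ∈ (A \ S).powerset, (-1 : ℤ) ^ Z.card := by
      rw [Icc_eq_image_powerset hS, sum_image, mul_sum]
      · refine sum_congr rfl fun Z hZ => ?_
        rw [card_union_of_disjoint (disj Z hZ), pow_add]
      · intro Z hZ Z' hZ' h
        have h' : S ∪ Z = S ∪ Z' := h
        rw [← union_sdiff_cancel_left (disj Z hZ), h', union_sdiff_cancel_left (disj Z' hZ')]
    rw [h1, h2, sum_powerset_neg_one_pow_card]
    by_cases h : S = A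
    · subst h; simp
    · rw [if_neg h, if_neg, mul_zero]
      rw [sdiff_eq_empty_iff_subset]
      exact fun h' => h (hS.antisymm h')
  · rw [if_neg (fun h => hS h.subset)]
    refine sum_eq_zero fun Y _ => ?_
    rw [if_neg (fun h => hS (h.1.trans h.2)), mul_zero]

/-- The binomial coefficient counts the `c`-sets `A` with `X ∪ Y ⊆ A ⊆ range n`. Exchanging the sums
over `Y` and `A` leaves an interval sum for every `A ⊇ X`, and only `A = S` survives. -/
theorem sum_family {n c : ℕ} {X S : Finset ℕ} (hX : X ⊆ range n) (hS : S ⊆ range n) :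
    ∑ Y ∈ family n c X, (-1 : ℤ) ^ Y.card *
      (((n - (X ∪ Y).card).choose (c - (X ∪ Y).card) : ℕ) * if S ⊆ Y then 1 else 0) =
      (-1) ^ c * if S.card = c ∧ X ⊆ S then 1 else 0 := by
  have h1 : ∀ Y ∈ family n c X, (((n - (X ∪ Y).card).choose (c - (X ∪ Y).card) : ℕ) : ℤ) =
      ∑ A ∈ (range n).powersetCard c, if X ∪ Y ⊆ A then 1 else 0 := by
    intro Y hY
    obtain ⟨hY, hc⟩ := mem_filter.mp hY
    have hsub : X ∪ Y ⊆ range n := union_subset hX (mem_powerset.mp hY)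
    rw [sum_boole, card_filter_powersetCard_subset _ _ _ hsub hc, card_range]
  -- Outside the family no `A` exists, whereas the binomial coefficient with truncated lower index
  -- would be `1`. So the sum is extended to all `Y` only after the coefficient has been replaced by
  -- the count of `A`.
  have h2 : ∀ Y ∈ (range n).powerset, Y ∉ family n c X →
      ∑ A ∈ (range n).powersetCard c, (if X ∪ Y ⊆ A then (1 : ℤ) else 0) = 0 := by
    intro Y hY hc
    refine sum_eq_zero fun A hA => if_neg fun h => hc (mem_filter.mpr ⟨hY, ?_⟩)
    exact (card_le_card h).trans (mem_powersetCard.mp hA).2.le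
  calc _ = ∑ Y ∈ family n c X, (-1 : ℤ) ^ Y.card *
        ((∑ A ∈ (range n).powersetCard c, if X ∪ Y ⊆ A then 1 else 0) *
          if S ⊆ Y then 1 else 0) := sum_congr rfl fun Y hY => by rw [h1 Y hY]
    _ = ∑ Y ∈ (range n).powerset, (-1 : ℤ) ^ Y.card *
        ((∑ A ∈ (range n).powersetCard c, if X ∪ Y ⊆ A then 1 else 0) *
          if S ⊆ Y then 1 else 0) :=
      sum_subset (filter_subset _ _) fun Y hY hc => by rw [h2 Y hY hc]; simp
    _ = ∑ A ∈ (range n).powersetCard c, (if X ⊆ A then 1 else 0) *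
        ∑ Y ∈ (range n).powerset, (-1 : ℤ) ^ Y.card * (if S ⊆ Y ∧ Y ⊆ A then 1 else 0) := by
      simp only [mul_sum, sum_mul]
      rw [sum_comm]
      refine sum_congr rfl fun A _ => sum_congr rfl fun Y _ => ?_
      simp only [union_subset_iff]
      by_cases h1 : X ⊆ A <;> by_cases h2 : Y ⊆ A <;> by_cases h3 : S ⊆ Y <;> simp [h1, h2, h3]
    _ = ∑ A ∈ (range n).powersetCard c, (if X ⊆ A then 1 else 0) *
        (if S = A then (-1) ^ c else 0) := by
      refine sum_congr rfl fun A hA => ?_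
      obtain ⟨hA, hc⟩ := mem_powersetCard.mp hA
      rw [sum_interval hA, hc]
    _ = _ := by
      simp only [mul_ite, mul_zero, mul_one]
      rw [sum_ite_eq (powersetCard c (range n)) S]
      by_cases h1 : S.card = c <;> by_cases h2 : X ⊆ S <;>
        simp [mem_powersetCard, h1, h2, hS]

section walks
variable {n : ℕ} {adj : ℕ → ℕ → ℕ}

open Classical in
/-- The indicator of a proposition. -/
noncomputable def ind (p : Prop) : ℤ := if p then 1 else 0

theorem ind_and (p q : Prop) : ind (p ∧ q) = ind p * ind q := by
  unfold ind; by_cases p <;> by_cases q <;> simp_all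

theorem ind_congr {p q : Prop} (h : p ↔ q) : ind p = ind q := by rw [propext h]

theorem ind_nonneg (p : Prop) : 0 ≤ ind p := by unfold ind; split_ifs <;> simp

theorem ind_true {p : Prop} (h : p) : ind p = 1 := if_pos h

theorem ind_false {p : Prop} (h : ¬p) : ind p = 0 := if_neg h

/-- Lists of vertices in which consecutive vertices are adjacent. -/
abbrev Chain (adj : ℕ → ℕ → ℕ) (l : List ℕ) : Prop := l.IsChain fun u v => adj u v = 1

theorem cast_adj (h : ∀ u v, adj u v ≤ 1) (u v : ℕ) : (adj u v : ℤ) = ind (adj u v = 1) := by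
  have := h u v
  unfold ind
  split_ifs with h'
  · simp [h']
  · have : adj u v = 0 := by omega
    simp [this]

theorem walks_eq (h : ∀ u v, adj u v ≤ 1) (Y : Finset ℕ) (t : ℕ) : ∀ u,
    (walks n adj t Y u : ℤ) =
      seqSum n t fun l => ind (Chain adj (u :: l)) * ind ((u :: l).toFinset ⊆ Y) := by
  induction t with
  | zero => intro u; simp [walks, seqSum, ind]
  | succ t ih =>
    intro u
    simp only [walks, seqSum]
    push_cast
    simp only [ih, mul_sum, cast_adj h, ← seqSum_mul]
    refine sum_congr rfl fun v _ => seqSum_congr fun l _ _ => ?_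
    have hif : (if u ∈ Y then (1 : ℤ) else 0) = ind (u ∈ Y) := by unfold ind; split_ifs <;> rfl
    rw [hif, ind_congr (p := Chain adj (u :: v :: l)) List.isChain_cons_cons, ind_and,
      ind_congr (p := (u :: v :: l).toFinset ⊆ Y) (q := u ∈ Y ∧ (v :: l).toFinset ⊆ Y) (by
        rw [List.toFinset_cons (a := u), insert_subset_iff]), ind_and]
    ring

/-- The number of paths on `c` vertices that start at `u` and cover `X`. -/
noncomputable def covering (n : ℕ) (adj : ℕ → ℕ → ℕ) (c : ℕ) (X : Finset ℕ) (u : ℕ) : ℤ :=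
  seqSum n (c - 1) fun l =>
    ind (Chain adj (u :: l)) * (ind (u :: l).Nodup * ind (X ⊆ (u :: l).toFinset))

/-- The machine has no negative numbers, so even and odd terms are accumulated separately, with the
parity as a coefficient. -/
theorem neg_one_pow_eq (m : ℕ) : (-1 : ℤ) ^ m = ((1 - m % 2 : ℕ) : ℤ) - (m % 2 : ℕ) := by
  rcases Nat.even_or_odd m with h | h
  · rw [h.neg_one_pow, Nat.even_iff.mp h]; simp
  · rw [h.neg_one_pow, Nat.odd_iff.mp h]; simp

/-- Expand the walk counts into sums over vertex sequences and exchange the sums. For a fixed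
sequence, `sum_family` applies with `S` its vertex set, and a sequence of length `c` has `c`
different entries iff it has no repetition. -/
theorem halfPos_sub_halfNeg (h : ∀ u v, adj u v ≤ 1) {c u : ℕ} {X : Finset ℕ}
    (hX : X ⊆ range n) (hc : 1 ≤ c) (hu : u < n) :
    (halfPos n adj c X u : ℤ) - halfNeg n adj c X u = (-1) ^ c * covering n adj c X u := by
  calc (halfPos n adj c X u : ℤ) - halfNeg n adj c X u
      = ∑ Y ∈ family n c X, (-1 : ℤ) ^ Y.card * weight n adj c X Y u := by
        rw [halfPos, halfNeg, Nat.cast_sum, Nat.cast_sum, ← sum_sub_distrib]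
        refine sum_congr rfl fun Y _ => ?_
        rw [neg_one_pow_eq, Nat.cast_mul, Nat.cast_mul]; ring
    _ = ∑ Y ∈ family n c X, seqSum n (c - 1) fun l => ind (Chain adj (u :: l)) *
          ((-1 : ℤ) ^ Y.card * (((n - (X ∪ Y).card).choose (c - (X ∪ Y).card) : ℕ) *
            if (u :: l).toFinset ⊆ Y then 1 else 0)) := by
        refine sum_congr rfl fun Y _ => ?_
        rw [weight, Nat.cast_mul, walks_eq h, ← seqSum_mul, ← seqSum_mul]
        refine seqSum_congr fun l _ _ => ?_
        rw [show ind ((u :: l).toFinset ⊆ Y) = if (u :: l).toFinset ⊆ Y then 1 else 0 by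
          unfold ind; split_ifs <;> rfl]
        ring
    _ = _ := by
        rw [← seqSum_sum, covering, ← seqSum_mul]
        refine seqSum_congr fun l hl hlt => ?_
        have hlen : (u :: l).length = c := by simp [hl]; omega
        rw [← mul_sum, sum_family hX, ← hlen, mul_left_comm, ← ind_and]
        · congr 2
          unfold ind
          have : (u :: l).toFinset.card = (u :: l).length ↔ (u :: l).Nodup := by
            rw [List.card_toFinset]
            constructor
            · intro h'
              exact List.dedup_eq_self.mp ((List.dedup_sublist _).eq_of_length h')
            · intro h'
              rw [List.dedup_eq_self.mpr h']
          simp only [this]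
          split_ifs <;> rfl
        · intro x hx
          rcases List.mem_cons.mp (List.mem_toFinset.mp hx) with rfl | h'
          · exact mem_range.mpr hu
          · exact mem_range.mpr (hlt x h')

theorem covering_nonneg (c : ℕ) (X : Finset ℕ) (u : ℕ) : 0 ≤ covering n adj c X u :=
  seqSum_nonneg fun _ => mul_nonneg (ind_nonneg _) (mul_nonneg (ind_nonneg _) (ind_nonneg _))

/-- The difference equals a nonnegative number up to sign, and `half` is its absolute value. -/
theorem half_eq (h : ∀ u v, adj u v ≤ 1) {c u : ℕ} {X : Finset ℕ}
    (hX : X ⊆ range n) (hc : 1 ≤ c) (hu : u < n) :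
    (half n adj c X u : ℤ) = covering n adj c X u := by
  have h1 := halfPos_sub_halfNeg h hX hc hu
  have h2 := covering_nonneg (n := n) (adj := adj) c X u
  rw [half]
  rcases neg_one_pow_eq_or ℤ c with h3 | h3 <;> rw [h3] at h1 <;> omega

theorem covering_eq_zero {c u : ℕ} {X : Finset ℕ} (hc : 1 ≤ c) (h : c < X.card) :
    covering n adj c X u = 0 := by
  rw [covering, ← seqSum_zero (n := n) (c - 1)]
  refine seqSum_congr fun l hl _ => ?_
  rw [ind_false (p := X ⊆ _), mul_zero, mul_zero]
  intro h'
  have h1 := (card_le_card h').trans (List.toFinset_card_le _)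
  simp [hl] at h1
  omega

/-- The sets `X` that contribute are the subsets of the intersection of the two vertex sets, and
their alternating sum is `1` or `0` according to whether the intersection is empty. -/
theorem ind_disjoint {l l' : List ℕ} (hl : ∀ x ∈ l, x < n) :
    ind (l.Disjoint l') = ∑ X ∈ (range n).powerset,
      (-1 : ℤ) ^ X.card * (ind (X ⊆ l.toFinset) * ind (X ⊆ l'.toFinset)) := by
  have h1 : ∑ X ∈ (range n).powerset,
      (-1 : ℤ) ^ X.card * (ind (X ⊆ l.toFinset) * ind (X ⊆ l'.toFinset)) =
      ∑ X ∈ (l.toFinset ∩ l'.toFinset).powerset, (-1 : ℤ) ^ X.card := by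
    have hsub : l.toFinset ∩ l'.toFinset ⊆ range n := fun x hx =>
      mem_range.mpr (hl x (List.mem_toFinset.mp (mem_inter.mp hx).1))
    rw [← sum_subset (powerset_mono.mpr hsub)]
    · refine sum_congr rfl fun X hX => ?_
      have := subset_inter_iff.mp (mem_powerset.mp hX)
      rw [ind_true this.1, ind_true this.2]; ring
    · intro X _ hX
      rw [← ind_and, ind_false, mul_zero]
      rwa [← subset_inter_iff, ← mem_powerset]
  rw [h1, sum_powerset_neg_one_pow_card]
  unfold ind
  congr 1
  rw [← disjoint_iff_inter_eq_empty, List.disjoint_toFinset_iff_disjoint]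

/-- Cut the sequence after its first `a` entries and reverse the first piece, which stays a chain
because `adj` is symmetric. The sequence is a path iff both pieces are paths, their heads `u`, `v`
are adjacent and they are disjoint. Expanding disjointness by `ind_disjoint` makes the sum over the
pieces factor. -/
theorem seqSum_paths (h : ∀ u v, adj u v ≤ 1) (hs : ∀ u v, adj u v = adj v u) {a b : ℕ}
    (ha : 1 ≤ a) (hb : 1 ≤ b) :
    seqSum n (a + b) (fun l => ind (Chain adj l) * ind l.Nodup) =
      ∑ X ∈ (range n).powerset, (-1 : ℤ) ^ X.card * ∑ u ∈ range n, ∑ v ∈ range n,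
        adj u v * covering n adj a X u * covering n adj b X v := by
  obtain ⟨a, rfl⟩ := Nat.exists_eq_add_of_le' ha
  obtain ⟨b, rfl⟩ := Nat.exists_eq_add_of_le' hb
  have split : ∀ u v l l', ind (Chain adj ((u :: l).reverse ++ v :: l')) *
      ind ((u :: l).reverse ++ v :: l').Nodup = ind ((u :: l).Disjoint (v :: l')) *
      (adj u v * ((ind (Chain adj (u :: l)) * ind (u :: l).Nodup) *
        (ind (Chain adj (v :: l')) * ind (v :: l').Nodup))) := by
    intro u v l l'
    have h1 : Chain adj ((u :: l).reverse ++ v :: l') ↔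
        Chain adj (u :: l) ∧ Chain adj (v :: l') ∧ adj u v = 1 := by
      rw [Chain, List.isChain_append, List.isChain_reverse, List.getLast?_reverse]
      simp only [List.head?_cons, Option.mem_some_iff, forall_eq']
      rw [show (fun a b => adj b a = 1) = fun a b => adj a b = 1 by
        funext u v; rw [hs u v]]
    have h2 : ((u :: l).reverse ++ v :: l').Nodup ↔
        (u :: l).Nodup ∧ (v :: l').Nodup ∧ (u :: l).Disjoint (v :: l') := by
      rw [List.nodup_append', List.nodup_reverse, List.disjoint_reverse_left]
    rw [ind_congr h1, ind_congr h2]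
    simp only [ind_and, cast_adj h]
    ring
  rw [seqSum_append, ← seqSum_reverse]
  simp only [seqSum, split, covering, Nat.add_sub_cancel]
  have hexp : ∀ X : Finset ℕ, ∀ u v : ℕ, (-1 : ℤ) ^ X.card * ((adj u v : ℤ) *
      (seqSum n a fun l => ind (Chain adj (u :: l)) *
        (ind (u :: l).Nodup * ind (X ⊆ (u :: l).toFinset))) *
      (seqSum n b fun l => ind (Chain adj (v :: l)) *
        (ind (v :: l).Nodup * ind (X ⊆ (v :: l).toFinset)))) =
      seqSum n a fun l => seqSum n b fun l' => (-1 : ℤ) ^ X.card *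
        (ind (X ⊆ (u :: l).toFinset) * ind (X ⊆ (v :: l').toFinset)) *
        (adj u v * ((ind (Chain adj (u :: l)) * ind (u :: l).Nodup) *
        (ind (Chain adj (v :: l')) * ind (v :: l').Nodup))) := by
    intro X u v
    rw [mul_comm (adj u v : ℤ), mul_assoc, mul_comm (seqSum n a _), ← mul_assoc, ← seqSum_mul]
    refine seqSum_congr fun l _ _ => ?_
    rw [mul_comm, ← mul_assoc, ← mul_assoc, ← seqSum_mul]
    refine seqSum_congr fun l' _ _ => ?_
    ring
  simp only [mul_sum, hexp]
  rw [sum_comm]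
  refine sum_congr rfl fun u hu => ?_
  rw [seqSum_sum, sum_comm]
  refine sum_congr rfl fun v hv => ?_
  rw [← seqSum_sum]
  refine seqSum_congr fun l hl hlt => ?_
  rw [← seqSum_sum]
  refine seqSum_congr fun l' hl' hlt' => ?_
  rw [ind_disjoint (n := n), sum_mul]
  intro x hx
  rcases List.mem_cons.mp hx with rfl | h'
  · exact mem_range.mp hu
  · exact hlt x h'

theorem joinedPos_sub_joinedNeg (h : ∀ u v, adj u v ≤ 1) (hs : ∀ u v, adj u v = adj v u)
    {a b : ℕ} (ha : 1 ≤ a) (hb : 1 ≤ b) :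
    (joinedPos n adj a b : ℤ) - joinedNeg n adj a b =
      seqSum n (a + b) fun l => ind (Chain adj l) * ind l.Nodup := by
  rw [seqSum_paths h hs ha hb, joinedPos, joinedNeg, Nat.cast_sum, Nat.cast_sum,
    ← sum_sub_distrib]
  rw [← sum_subset (filter_subset (fun Z => (∅ ∪ Z).card ≤ b) (range n).powerset)]
  · refine sum_congr rfl fun X hX => ?_
    have hX' := mem_powerset.mp (mem_filter.mp hX).1
    rw [neg_one_pow_eq, Nat.cast_mul, Nat.cast_mul, ← sub_mul, joined]
    push_cast
    congr 1
    refine sum_congr rfl fun u hu => sum_congr rfl fun v hv => ?_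
    rw [half_eq h hX' ha (mem_range.mp hu), half_eq h hX' hb (mem_range.mp hv)]
  -- A path on `b` vertices cannot cover a larger set, so these terms vanish.
  · intro X hX hc
    have hc' : b < X.card := by
      by_contra h'
      exact hc (mem_filter.mpr ⟨hX, by simpa using h'⟩)
    simp [covering_eq_zero hb hc']

end walks

open Classical in
/-- The adjacency matrix of a graph, extended by zeros. -/
noncomputable def adjOf {n : ℕ} (G : SimpleGraph (Fin n)) (u v : ℕ) : ℕ :=
  if ∃ (hu : u < n) (hv : v < n), G.Adj ⟨u, hu⟩ ⟨v, hv⟩ then 1 else 0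

theorem adjOf_le {n : ℕ} (G : SimpleGraph (Fin n)) (u v : ℕ) : adjOf G u v ≤ 1 := by
  unfold adjOf; split_ifs <;> simp

theorem adjOf_comm {n : ℕ} (G : SimpleGraph (Fin n)) (u v : ℕ) : adjOf G u v = adjOf G v u := by
  unfold adjOf
  congr 1
  exact propext ⟨fun ⟨a, b, c⟩ => ⟨b, a, c.symm⟩, fun ⟨a, b, c⟩ => ⟨b, a, c.symm⟩⟩

theorem pathCount_eq_seqSum {n : ℕ} (G : SimpleGraph (Fin n)) (k : ℕ) :
    (pathCount G k : ℤ) =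
      seqSum n (k + 1) fun l => ind (Chain (adjOf G) l) * ind l.Nodup := by
  classical
  rw [seqSum_eq_sum, pathCount, Nat.card_eq_fintype_card, Fintype.card_subtype,
    Finset.card_filter, Nat.cast_sum]
  refine sum_congr rfl fun f _ => ?_
  rw [← ind_and, Nat.cast_ite, ind]
  congr 1
  · apply propext
    rw [and_comm]
    refine and_congr ?_ ?_
    · rw [Chain, List.isChain_ofFn]
      constructor
      · intro h i hi
        exact if_pos ⟨(f _).2, (f _).2, h ⟨i, by omega⟩⟩
      · intro h i
        have := h i (by omega)
        unfold adjOf at this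
        split_ifs at this with h'
        · obtain ⟨_, _, h'⟩ := h'
          exact h'
    · rw [List.nodup_ofFn]
      exact ⟨fun h i j hij => h (Fin.ext hij), fun h i j hij => h (congrArg Fin.val hij)⟩

/-- The truncated subtraction is exact because the integer difference is a cardinality. -/
theorem pathCount_eq {n : ℕ} (G : SimpleGraph (Fin n)) {k a b : ℕ} (hab : a + b = k + 1)
    (ha : 1 ≤ a) (hb : 1 ≤ b) :
    pathCount G k = joinedPos n (adjOf G) a b - joinedNeg n (adjOf G) a b := by
  have h1 := pathCount_eq_seqSum G k
  rw [← hab, ← joinedPos_sub_joinedNeg (adjOf_le G) (adjOf_comm G) ha hb] at h1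
  omega

/-! ### Successors in the colexicographic order -/

section enumeration

/-- The members of a family of sets from `c` on, in the colexicographic order. -/
def remaining (n cap : ℕ) (base c : Finset ℕ) : Finset (Finset ℕ) :=
  (family n cap base).filter fun x => toColex c ≤ toColex x

/-- The elements of `c` from `i` on. -/
def tail (c : Finset ℕ) (i : ℕ) : Finset ℕ := c.filter fun x => i ≤ x

variable {n cap : ℕ} {base c : Finset ℕ}

theorem mem_family {Z : Finset ℕ} :
    Z ∈ family n cap base ↔ Z ⊆ range n ∧ (base ∪ Z).card ≤ cap := by
  simp [family]

theorem remaining_empty : remaining n cap base ∅ = family n cap base := by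
  simp [remaining]

theorem tail_zero : tail c 0 = c := by simp [tail]

theorem tail_succ_of_mem {i : ℕ} : tail c (i + 1) = (tail c i).erase i := by
  ext x; simp only [tail, mem_filter, mem_erase]; constructor
  · rintro ⟨h1, h2⟩; exact ⟨by omega, h1, by omega⟩
  · rintro ⟨h1, h2, h3⟩; exact ⟨h2, by omega⟩

theorem tail_succ_of_notMem {i : ℕ} (h : i ∉ c) : tail c (i + 1) = tail c i := by
  rw [tail_succ_of_mem, erase_eq_of_notMem]
  simp [tail, h]

theorem mem_tail_self {i : ℕ} : i ∈ tail c i ↔ i ∈ c := by simp [tail]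

/-- Let `i` be the largest element in which `c` and `x` differ; it lies in `x`. Above `i` the sets
agree, so `insert i (tail c i) ⊆ x`, and the family is closed under subsets. -/
theorem exists_of_colex_lt {x : Finset ℕ} (h : toColex c < toColex x)
    (hx : x ∈ family n cap base) :
    ∃ i < n, i ∉ c ∧ i ∈ x ∧ insert i (tail c i) ⊆ x ∧
      insert i (tail c i) ∈ family n cap base := by
  obtain ⟨i, hi, he⟩ := Colex.lt_iff_exists_filter_lt.mp h
  obtain ⟨hix, hic⟩ := mem_sdiff.mp hi
  obtain ⟨hxn, hxc⟩ := mem_family.mp hx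
  have hsub : insert i (tail c i) ⊆ x := by
    intro y hy
    rcases mem_insert.mp hy with rfl | hy
    · exact hix
    · obtain ⟨h1, h2⟩ := mem_filter.mp hy
      have h3 : i < y := lt_of_le_of_ne h2 (by rintro rfl; exact hic h1)
      have : y ∈ x.filter (i < ·) := he ▸ mem_filter.mpr ⟨h1, h3⟩
      exact (mem_filter.mp this).1
  exact ⟨i, mem_range.mp (hxn hix), hic, hix, hsub, mem_family.mpr ⟨hsub.trans hxn,
    (card_le_card (union_subset_union_right hsub)).trans hxc⟩⟩

theorem remaining_last (hc : c ∈ family n cap base)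
    (h : ∀ i < n, i ∉ c → insert i (tail c i) ∉ family n cap base) :
    remaining n cap base c = {c} := by
  ext x
  simp only [remaining, mem_filter, mem_singleton]
  constructor
  · rintro ⟨hx, hle⟩
    rcases hle.lt_or_eq with hlt | heq
    · obtain ⟨i, hi, hic, _, _, hf⟩ := exists_of_colex_lt hlt hx
      exact absurd hf (h i hi hic)
    · exact (toColex_inj.mp heq).symm
  · rintro rfl
    exact ⟨hc, le_rfl⟩

theorem colex_lt_insert_tail {i : ℕ} (hi : i ∉ c) :
    toColex c < toColex (insert i (tail c i)) := by
  rw [Colex.toColex_lt_toColex_iff_exists_forall_lt]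
  refine ⟨i, mem_insert_self _ _, hi, fun y hy hy' => ?_⟩
  by_contra hlt
  exact hy' (mem_insert_of_mem (mem_filter.mpr ⟨hy, by omega⟩))

/-- The successor arises from the least admissible `i` by adding `i` and deleting everything below.
A later member `x` first differs from `c`, from the top, at some `j ≥ i` by minimality. If `j = i`,
then `x` contains the candidate; if `j > i`, then `x` beats it at `j`. -/
theorem remaining_next (hc : c ∈ family n cap base) {i : ℕ} (hi : i ∉ c)
    (h : ∀ j < i, j ∉ c → insert j (tail c j) ∉ family n cap base) :
    remaining n cap base c = insert c (remaining n cap base (insert i (tail c i))) := by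
  ext x
  simp only [remaining, mem_filter, mem_insert]
  constructor
  · rintro ⟨hx, hle⟩
    rcases hle.lt_or_eq with hlt | heq
    · refine Or.inr ⟨hx, ?_⟩
      obtain ⟨j, hj, hjc, hjx, hsub, hf⟩ := exists_of_colex_lt hlt hx
      have hij : i ≤ j := by
        by_contra hlt'
        exact h j (by omega) hjc hf
      rcases hij.eq_or_lt with rfl | hij
      · exact Colex.toColex_le_toColex_of_subset hsub
      · refine le_of_lt (Colex.toColex_lt_toColex_iff_exists_forall_lt.mpr
          ⟨j, hjx, ?_, fun y hy hyx => ?_⟩)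
        · simp [tail, hjc]; omega
        · by_contra hjy
          refine hyx (hsub (mem_insert_of_mem (mem_filter.mpr ⟨?_, by omega⟩)))
          rcases mem_insert.mp hy with rfl | hy
          · omega
          · exact (mem_filter.mp hy).1
    · exact Or.inl (toColex_inj.mp heq).symm
  · rintro (rfl | ⟨hx, hle⟩)
    · exact ⟨hc, le_rfl⟩
    · exact ⟨hx, (colex_lt_insert_tail hi).le.trans hle⟩

theorem notMem_remaining_next {i : ℕ} (hi : i ∉ c) :
    c ∉ remaining n cap base (insert i (tail c i)) := fun h =>
  absurd (mem_filter.mp h).2 (not_le.mpr (colex_lt_insert_tail hi))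

end enumeration

/-! ### The number of pairs of sets -/

section counting

theorem card_family_le {n cap : ℕ} {base : Finset ℕ} : (family n cap base).card ≤ 2 ^ n := by
  calc _ ≤ (range n).powerset.card := card_le_card (filter_subset _ _)
    _ = 2 ^ n := by simp

/-- Each element of `U` lies in the first set only, in the second only, or in both. The pair is
determined by `X ⊆ U` and `X ∩ Y ⊆ X`, and the sum of `2^|X|` over `X ⊆ U` is `3^|U|`. -/
theorem card_union_eq_le (U : Finset ℕ) (P : Finset (Finset ℕ)) :
    ((P ×ˢ P).filter fun p => p.1 ∪ p.2 = U).card ≤ 3 ^ U.card := by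
  calc _ ≤ (U.powerset.sigma fun X => X.powerset).card := by
        refine card_le_card_of_injOn (fun p => ⟨p.1, p.1 ∩ p.2⟩) ?_ ?_
        · intro p hp
          have := (mem_filter.mp hp).2
          refine mem_sigma.mpr ⟨mem_powerset.mpr ?_, mem_powerset.mpr inter_subset_left⟩
          rw [← this]; exact subset_union_left
        · rintro ⟨X, Y⟩ hp ⟨X', Y'⟩ hp' h
          have h1 : X ∪ Y = U := (mem_filter.mp hp).2
          have h2 : X' ∪ Y' = U := (mem_filter.mp hp').2
          simp only [Sigma.mk.injEq, heq_eq_eq] at h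
          obtain ⟨rfl, h3⟩ := h
          have : ∀ {Y : Finset ℕ}, X ∪ Y = U → Y = (U \ X) ∪ (X ∩ Y) := by
            rintro Y rfl; ext x; simp; tauto
          rw [Prod.mk.injEq]
          exact ⟨rfl, by rw [this h1, this h2, h3]⟩
    _ = 3 ^ U.card := by
        rw [card_sigma]
        have := sum_pow_mul_eq_add_pow 2 1 U
        simpa using this

theorem choose_le_choose_of_le_half {n m s : ℕ} (hms : m ≤ s) (hs : s ≤ n / 2) :
    n.choose m ≤ n.choose s := by
  induction s, hms using Nat.le_induction with
  | base => exact le_rfl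
  | succ s _ ih => exact (ih (by omega)).trans (Nat.choose_le_succ_of_lt_half_left (by omega))

/-- Group the pairs `(X, Y)` by their union `U` and then by `m = |U|`, dropping the bound on `|X|`.
Each of the `n + 1` values of `m` contributes at most `3 * n` times the target. -/
theorem sum_card_family_le {n k a b : ℕ} (hk : k < n) (ha : a ≤ k / 2 + 1) :
    ∑ X ∈ family n b ∅, (family n a X).card ≤
      3 * n * (n + 1) * (3 ^ (k / 2) * n.choose (k / 2)) := by
  set s := k / 2 with hs
  have hterm : ∀ m, n.choose m * (if m ≤ a then 3 ^ m else 0) ≤ 3 * n * (3 ^ s * n.choose s) := by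
    intro m
    split_ifs with hm
    · rcases Nat.lt_or_ge s m with h | h
      · have hm' : m = s + 1 := by omega
        subst hm'
        have h1 := Nat.choose_succ_right_eq n s
        have h2 : n.choose (s + 1) ≤ n.choose s * n := calc
          n.choose (s + 1) ≤ n.choose (s + 1) * (s + 1) := Nat.le_mul_of_pos_right _ (by omega)
          _ = n.choose s * (n - s) := h1
          _ ≤ n.choose s * n := Nat.mul_le_mul_left _ (Nat.sub_le _ _)
        calc n.choose (s + 1) * 3 ^ (s + 1) ≤ n.choose s * n * 3 ^ (s + 1) :=
              Nat.mul_le_mul_right _ h2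
          _ = _ := by ring
      · calc n.choose m * 3 ^ m ≤ n.choose s * 3 ^ s := Nat.mul_le_mul
              (choose_le_choose_of_le_half h (by omega))
              (Nat.pow_le_pow_right (by norm_num) h)
          _ = 3 ^ s * n.choose s := mul_comm _ _
          _ ≤ _ := Nat.le_mul_of_pos_left _ (by omega)
    · simp
  set P := (range n).powerset
  calc ∑ X ∈ family n b ∅, (family n a X).card
      ≤ ∑ X ∈ P, (family n a X).card := sum_le_sum_of_subset (filter_subset _ _)
    _ = ((P ×ˢ P).filter fun p => (p.1 ∪ p.2).card ≤ a).card := by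
        rw [card_filter, sum_product]
        exact sum_congr rfl fun X _ => card_filter _ _
    _ = ∑ U ∈ P.filter (fun U => U.card ≤ a),
          (((P ×ˢ P).filter fun p => (p.1 ∪ p.2).card ≤ a).filter
            fun p => p.1 ∪ p.2 = U).card := by
        refine card_eq_sum_card_fiberwise fun p hp => ?_
        obtain ⟨h1, h2⟩ := mem_filter.mp hp
        obtain ⟨h3, h4⟩ := mem_product.mp h1
        exact mem_filter.mpr ⟨mem_powerset.mpr
          (union_subset (mem_powerset.mp h3) (mem_powerset.mp h4)), h2⟩
    _ ≤ ∑ U ∈ P.filter (fun U => U.card ≤ a), 3 ^ U.card := by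
        refine sum_le_sum fun U _ => (card_le_card ?_).trans (card_union_eq_le U P)
        exact filter_subset_filter _ (filter_subset _ _)
    _ = ∑ U ∈ P, if U.card ≤ a then 3 ^ U.card else 0 := sum_filter _ _
    _ = ∑ m ∈ range (n + 1), n.choose m * (if m ≤ a then 3 ^ m else 0) := by
        have := sum_powerset_apply_card (x := range n) (fun m => if m ≤ a then 3 ^ m else 0)
        simpa using this
    _ ≤ ∑ m ∈ range (n + 1), 3 * n * (3 ^ s * n.choose s) := sum_le_sum fun m _ => hterm m
    _ = _ := by rw [sum_const, card_range, smul_eq_mul]; ring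

end counting

/-! ### Bit lengths of all intermediate numbers -/

section bounds
variable {n : ℕ} {adj : ℕ → ℕ → ℕ}

/-- Bounds are kept as powers of two and the number of terms is charged as `n` further bits: only
polynomial length matters. -/
theorem sum_range_le_pow {f : ℕ → ℕ} {m p : ℕ} (hm : m ≤ n) (h : ∀ v < m, f v ≤ 2 ^ p) :
    ∑ v ∈ range m, f v ≤ 2 ^ (p + n) := by
  calc ∑ v ∈ range m, f v ≤ ∑ v ∈ range m, 2 ^ p :=
        sum_le_sum fun v hv => h v (mem_range.mp hv)
    _ = m * 2 ^ p := by simp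
    _ ≤ 2 ^ n * 2 ^ p := Nat.mul_le_mul_right _ (hm.trans Nat.lt_two_pow_self.le)
    _ = _ := by rw [pow_add, mul_comm]

theorem walks_le (h : ∀ u v, adj u v ≤ 1) (Y : Finset ℕ) (t : ℕ) : ∀ u,
    walks n adj t Y u ≤ 2 ^ (t * n) := by
  induction t with
  | zero => intro u; simp only [walks]; split_ifs <;> simp
  | succ t ih =>
    intro u
    have h1 : ∑ v ∈ range n, adj u v * walks n adj t Y v ≤ 2 ^ (t * n + n) :=
      sum_range_le_pow le_rfl fun v _ => by
        simpa using Nat.mul_le_mul (h u v) (ih v)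
    rw [add_mul, one_mul]
    simp only [walks]
    split_ifs
    · simpa using h1
    · simp

theorem weight_le (h : ∀ u v, adj u v ≤ 1) {c u : ℕ} {X Y : Finset ℕ} (hc : c ≤ n) :
    weight n adj c X Y u ≤ 2 ^ (n * n + n) := by
  calc weight n adj c X Y u ≤ 2 ^ n * 2 ^ ((c - 1) * n) :=
        Nat.mul_le_mul ((Nat.choose_le_two_pow _ _).trans
          (Nat.pow_le_pow_right (by norm_num) (Nat.sub_le _ _))) (walks_le h Y _ u)
    _ = 2 ^ (n + (c - 1) * n) := (pow_add _ _ _).symm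
    _ ≤ _ := Nat.pow_le_pow_right (by norm_num) (by
        have := Nat.mul_le_mul_right n (show c - 1 ≤ n by omega); omega)

theorem sum_family_le {cap p : ℕ} {base : Finset ℕ} {f : Finset ℕ → ℕ} (h : ∀ Z, f Z ≤ 2 ^ p) :
    ∑ Z ∈ family n cap base, f Z ≤ 2 ^ (p + n) := by
  calc ∑ Z ∈ family n cap base, f Z ≤ ∑ Z ∈ family n cap base, 2 ^ p :=
        sum_le_sum fun Z _ => h Z
    _ = (family n cap base).card * 2 ^ p := by simp
    _ ≤ 2 ^ n * 2 ^ p := Nat.mul_le_mul_right _ card_family_le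
    _ = _ := by rw [pow_add, mul_comm]

theorem mul_le_of_le_one {x y z : ℕ} (hx : x ≤ 1) (hy : y ≤ z) : x * y ≤ z := by
  simpa using Nat.mul_le_mul hx hy

theorem halfPos_le (h : ∀ u v, adj u v ≤ 1) {c u : ℕ} {X : Finset ℕ} (hc : c ≤ n) :
    halfPos n adj c X u ≤ 2 ^ (n * n + n + n) :=
  sum_family_le fun _ => mul_le_of_le_one (Nat.sub_le _ _) (weight_le h hc)

theorem halfNeg_le (h : ∀ u v, adj u v ≤ 1) {c u : ℕ} {X : Finset ℕ} (hc : c ≤ n) :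
    halfNeg n adj c X u ≤ 2 ^ (n * n + n + n) :=
  sum_family_le fun _ => mul_le_of_le_one (by omega) (weight_le h hc)

theorem half_le (h : ∀ u v, adj u v ≤ 1) {c u : ℕ} {X : Finset ℕ} (hc : c ≤ n) :
    half n adj c X u ≤ 2 ^ (n * n + n + n) := by
  have h1 := halfPos_le (u := u) (X := X) h hc
  have h2 := halfNeg_le (u := u) (X := X) h hc
  unfold half
  omega

theorem joined_term_le (h : ∀ u v, adj u v ≤ 1) {a b u v : ℕ} {X : Finset ℕ} (ha : a ≤ n)
    (hb : b ≤ n) : adj u v * half n adj a X u * half n adj b X v ≤ 2 ^ (2 * (n * n + n + n)) := by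
  rw [mul_assoc, two_mul, pow_add]
  exact mul_le_of_le_one (h u v) (Nat.mul_le_mul (half_le h ha) (half_le h hb))

theorem joined_le (h : ∀ u v, adj u v ≤ 1) {a b : ℕ} {X : Finset ℕ} (ha : a ≤ n)
    (hb : b ≤ n) : joined n adj a b X ≤ 2 ^ (2 * (n * n + n + n) + n + n) :=
  sum_range_le_pow le_rfl fun _ _ => sum_range_le_pow le_rfl fun _ _ => joined_term_le h ha hb

theorem joinedPos_le (h : ∀ u v, adj u v ≤ 1) {a b : ℕ} (ha : a ≤ n) (hb : b ≤ n) :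
    joinedPos n adj a b ≤ 2 ^ (2 * (n * n + n + n) + n + n + n) :=
  sum_family_le fun _ => mul_le_of_le_one (Nat.sub_le _ _) (joined_le h ha hb)

theorem joinedNeg_le (h : ∀ u v, adj u v ≤ 1) {a b : ℕ} (ha : a ≤ n) (hb : b ≤ n) :
    joinedNeg n adj a b ≤ 2 ^ (2 * (n * n + n + n) + n + n + n) :=
  sum_family_le fun _ => mul_le_of_le_one (by omega) (joined_le h ha hb)

end bounds

end PathSum

/-! ### Rules for symbolic execution and frames -/

namespace RAM

variable {w : List ℕ} {L B : ℕ}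

/-- `j := f` -/
abbrev assignVar (j : Fin 32) (f : Expr) : Prog := assign j (.num 0) f

/-- Index and value enter through equations, so that the resulting state mentions their simplified
forms. -/
theorem Trip.last (A : Ambient w L B) {j : Fin 32} {e f : Expr} {σ : State} {N : ℕ}
    {Q : State → Prop} {i x : ℕ} (hi : e.val w σ = i) (hx : f.val w σ = x) (hiL : i < L)
    (hxB : x < 2 ^ B) (hs : e.size + f.size < 90) (hN : 6 * (e.size + f.size + 1) ≤ N)
    (h : Q (σ.upd j i x)) : Trip w L B (assign j e f) σ N Q := by
  subst hi hx
  exact Trip.of_assign A hs hN hiL hxB h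

theorem Trip.step (A : Ambient w L B) {j : Fin 32} {e f : Expr} {σ : State} {N N' : ℕ}
    {P : Prog} {Q : State → Prop} {i x : ℕ} (hi : e.val w σ = i) (hx : f.val w σ = x)
    (hiL : i < L) (hxB : x < 2 ^ B) (hs : e.size + f.size < 90)
    (hN : 6 * (e.size + f.size + 1) + N' ≤ N) (h : Trip w L B P (σ.upd j i x) N' Q) :
    Trip w L B (.seq (assign j e f) P) σ N Q :=
  (Trip.seq (Trip.last A hi hx hiL hxB hs le_rfl h)).mono hN fun _ h => h

theorem Trip.lastVar (A : Ambient w L B) {j : Fin 32} {f : Expr} {σ : State} {N : ℕ}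
    {Q : State → Prop} {x : ℕ} (hx : f.val w σ = x)
    (hxB : x < 2 ^ B) (hs : f.size < 80) (hN : 6 * (f.size + 2) ≤ N)
    (h : Q (σ.upd j 0 x)) : Trip w L B (assignVar j f) σ N Q :=
  Trip.last A (i := 0) rfl hx A.2.1 hxB (by simp; omega) (by simp; omega) h

theorem Trip.stepVar (A : Ambient w L B) {j : Fin 32} {f : Expr} {σ : State} {N N' : ℕ}
    {P : Prog} {Q : State → Prop} {x : ℕ} (hx : f.val w σ = x)
    (hxB : x < 2 ^ B) (hs : f.size < 80)
    (hN : 6 * (f.size + 2) + N' ≤ N) (h : Trip w L B P (σ.upd j 0 x) N' Q) :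
    Trip w L B (.seq (assignVar j f) P) σ N Q :=
  Trip.step A (i := 0) rfl hx A.2.1 hxB (by simp; omega) (by simp; omega) h

/-- `τ` differs from `σ` at most in the arrays of the list `S`. -/
def Frame (S : List (Fin 32)) (σ τ : State) : Prop := ∀ j, j ∉ S → τ j = σ j

theorem Frame.refl (S : List (Fin 32)) (σ : State) : Frame S σ σ := fun _ _ => rfl

theorem Frame.trans {S S' : List (Fin 32)} {σ τ υ : State} (h : Frame S σ τ)
    (h' : Frame S' τ υ) (hS : ∀ j ∈ S', j ∈ S) : Frame S σ υ := fun j hj =>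
  (h' j fun hj' => hj (hS j hj')).trans (h j hj)

theorem Frame.weaken {S S' : List (Fin 32)} {σ τ : State} (h : Frame S σ τ)
    (hS : ∀ j ∈ S, j ∈ S') : Frame S' σ τ := fun j hj => h j fun hj' => hj (hS j hj')

theorem Frame.upd {S : List (Fin 32)} {σ τ : State} (h : Frame S σ τ) {j : Fin 32} {i x : ℕ}
    (hj : j ∈ S) : Frame S σ (τ.upd j i x) := fun j' hj' => by
  rw [State.upd_ne _ _ _ (by rintro rfl; exact hj' hj)]
  exact h j' hj'

end RAM

/-! ### Registers and the successor procedure -/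

namespace PathSum

open RAM Expr

section registers

/-- Array `0` at index `0` is the memory cell `0`, where the output is expected. -/
abbrev vOut : Fin 32 := 0
abbrev vN : Fin 32 := 1
abbrev vK : Fin 32 := 2
abbrev vA : Fin 32 := 3
abbrev vB : Fin 32 := 4
abbrev vX : Fin 32 := 5
abbrev vY : Fin 32 := 6
abbrev vW : Fin 32 := 7
abbrev vT : Fin 32 := 8
abbrev vPos : Fin 32 := 9
abbrev vNeg : Fin 32 := 10
abbrev vF : Fin 32 := 11
abbrev vG : Fin 32 := 12
-- Never written; its zeros represent the empty set, which is the base of the outer family.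
abbrev vEmpty : Fin 32 := 13
abbrev vCntX : Fin 32 := 14
abbrev vParX : Fin 32 := 15
abbrev vFlagX : Fin 32 := 16
abbrev vCntY : Fin 32 := 17
abbrev vParY : Fin 32 := 18
abbrev vFlagY : Fin 32 := 19
abbrev vI : Fin 32 := 20
abbrev vJ : Fin 32 := 21
abbrev vS : Fin 32 := 22
abbrev vAcc : Fin 32 := 23
abbrev vCarry : Fin 32 := 24
abbrev vBin : Fin 32 := 25
abbrev vTotPos : Fin 32 := 26
abbrev vTotNeg : Fin 32 := 27

end registers

/-- The assumptions on the input and on the bounds for a graph with `n` vertices. -/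
structure Setup (w : List ℕ) (L B n : ℕ) (adj : ℕ → ℕ → ℕ) : Prop where
  amb : Ambient w L B
  inp : ∀ u < n, ∀ v < n, w.getD (2 + u * n + v) 0 = adj u v
  adj_le : ∀ u v, adj u v ≤ 1
  le_L : (n + 2) * (n + 2) ≤ L
  L_le : L ≤ 2 ^ B
  le_B : 9 * ((n + 2) * (n + 2)) ≤ B

section setup
variable {w : List ℕ} {L B n : ℕ} {adj : ℕ → ℕ → ℕ}

theorem Setup.lt_pow (H : Setup w L B n adj) {x : ℕ} (hx : x < (n + 2) * (n + 2)) : x < 2 ^ B :=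
  hx.trans_le (H.le_L.trans H.L_le)

theorem Setup.small (H : Setup w L B n adj) {x : ℕ} (hx : x ≤ n + 2) : x < 2 ^ B :=
  H.lt_pow (by nlinarith)

theorem Setup.small_L (H : Setup w L B n adj) {x : ℕ} (hx : x ≤ n + 2) : x < L :=
  lt_of_lt_of_le (by nlinarith) H.le_L

theorem Setup.lt_of_le_pow (H : Setup w L B n adj) {x p : ℕ} (hx : x ≤ 2 ^ p)
    (hp : p < 9 * ((n + 2) * (n + 2))) : x < 2 ^ B :=
  hx.trans_lt (Nat.pow_lt_pow_right (by norm_num) (hp.trans_le H.le_B))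

end setup

/-- `τ` holds the subset `Z` of `range n` in the array `arr`, the size of `base ∪ Z` in `cnt`
and the parity of `Z` in `par`. -/
structure Holds (n : ℕ) (base Z : Finset ℕ) (arr cnt par : Fin 32) (τ : State) : Prop where
  arr : ∀ j < n, τ arr j = if j ∈ Z then 1 else 0
  cnt : τ cnt 0 = (base ∪ Z).card
  par : τ par 0 = Z.card % 2

/-- The body of the loop in `next`. -/
def nextBody (arr base cnt par cap : Fin 32) : Prog :=
  .seq (branch (.arr arr (.var vI))
    (.seq (assign arr (.var vI) (.num 0))
      (.seq (assignVar cnt (.var cnt - (.num 1 - .arr base (.var vI))))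
        (assignVar par (.num 1 - .var par))))
    (branch (.var cap + .num 1 - (.var cnt + (.num 1 - .arr base (.var vI))))
      (.seq (assign arr (.var vI) (.num 1))
        (.seq (assignVar cnt (.var cnt + (.num 1 - .arr base (.var vI))))
          (.seq (assignVar par (.num 1 - .var par)) (assignVar vCarry (.num 0)))))
      (assignVar vCarry (.num 1))))
    (assignVar vI (.var vI + .num 1))

/-- Replaces the set in the array `arr` by the next member of its family; `flag` is set to `0`
if there is none. -/
def next (arr base cnt par cap flag : Fin 32) : Prog :=
  .seq (assignVar vCarry (.num 1)) (.seq (assignVar vI (.num 0))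
    (.seq (loop (.var vCarry * (.var vN - .var vI)) (nextBody arr base cnt par cap))
      (assignVar flag (.num 1 - .var vCarry))))

theorem card_union_insert {base Z : Finset ℕ} {i : ℕ} (hi : i ∉ Z) :
    (base ∪ insert i Z).card = (base ∪ Z).card + (1 - if i ∈ base then 1 else 0) := by
  rw [union_insert]
  split_ifs with h
  · rw [insert_eq_of_mem (mem_union_left _ h), Nat.sub_self, Nat.add_zero]
  · rw [card_insert_of_notMem (by simp [h, hi])]

section next
variable {w : List ℕ} {L B n : ℕ} {adj : ℕ → ℕ → ℕ}

/-- The situation before the `i`-th round of the loop in `next`. -/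
structure Carrying (n cap : ℕ) (base c : Finset ℕ) (arr cnt par : Fin 32) (i : ℕ) (τ : State) :
    Prop where
  holds : Holds n base (tail c i) arr cnt par τ
  skipped : ∀ j < i, j ∉ c → insert j (tail c j) ∉ family n cap base

/-- The situation after the next member has been found. -/
def Found (n cap : ℕ) (base c : Finset ℕ) (arr cnt par : Fin 32) (τ : State) : Prop :=
  ∃ i, i ∉ c ∧ (∀ j < i, j ∉ c → insert j (tail c j) ∉ family n cap base) ∧
    insert i (tail c i) ∈ family n cap base ∧
    Holds n base (insert i (tail c i)) arr cnt par τ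

theorem Holds.congr {base Z : Finset ℕ} {arr cnt par : Fin 32} {σ τ : State}
    (h : Holds n base Z arr cnt par σ) (h1 : τ arr = σ arr) (h2 : τ cnt = σ cnt)
    (h3 : τ par = σ par) : Holds n base Z arr cnt par τ :=
  ⟨fun j hj => by rw [h1, h.arr j hj], by rw [h2, h.cnt], by rw [h3, h.par]⟩

/-- Positions below `i` have been cleared, so the array holds `tail c i`. If `i ∈ c`, it is cleared
too and the carry goes on. If `i ∉ c`, it is inserted and the carry stops when the result is in the
family; otherwise `i` is skipped. Distinctness of the registers excludes aliasing. -/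
theorem trip_nextBody (H : Setup w L B n adj) {arr base cnt par cap : Fin 32}
    (hd : [arr, base, cnt, par, cap, vI, vCarry, vN].Nodup)
    {b : ℕ} {Bs c : Finset ℕ} {i : ℕ} {σ : State} (hn : σ vN 0 = n) (hcap : σ cap 0 = b)
    (hbn : b ≤ n) (hcarry : σ vCarry 0 = 1) (hi : σ vI 0 = i) (hin : i < n)
    (hbase : ∀ j < n, σ base j = if j ∈ Bs then 1 else 0) (hc : c ∈ family n b Bs)
    (hC : Carrying n b Bs c arr cnt par i σ) :
    Trip w L B (nextBody arr base cnt par cap) σ 900 (fun τ => τ vI 0 = i + 1 ∧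
      Frame [arr, cnt, par, vI, vCarry] σ τ ∧
      ((τ vCarry 0 = 1 ∧ Carrying n b Bs c arr cnt par (i + 1) τ) ∨
        (τ vCarry 0 = 0 ∧ Found n b Bs c arr cnt par τ))) := by
  have A := H.amb
  obtain ⟨hcn, hcb⟩ := PathSum.mem_family.mp hc
  have htail : (Bs ∪ tail c i).card ≤ b :=
    (card_le_card (union_subset_union_right (filter_subset _ _))).trans hcb
  obtain ⟨⟨harr, hcnt, hpar⟩, hsk⟩ := hC
  simp only [List.nodup_cons, List.mem_cons, List.not_mem_nil, or_false, not_or] at hd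
  obtain ⟨⟨d1, d2, d3, d4, d5, d6, d7⟩, ⟨e1, e2, e3, e4, e5, e6⟩, ⟨f1, f2, f3, f4, f5⟩,
    ⟨g1, g2, g3, g4⟩, ⟨h1, h2, h3⟩, -⟩ := hd
  have s1 := Ne.symm d1
  have s2 := Ne.symm d2
  have s3 := Ne.symm d3
  have s5 := Ne.symm d5
  have s6 := Ne.symm d6
  have s14 := Ne.symm f1
  have s16 := Ne.symm f3
  have s17 := Ne.symm f4
  have s20 := Ne.symm g2
  have s21 := Ne.symm g3
  have hti : i ∈ tail c i ↔ i ∈ c := mem_tail_self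
  -- The contribution of `i` to the size of the union with the base: none if the base already
  -- contains `i`.
  set β : ℕ := 1 - if i ∈ Bs then 1 else 0 with hβ
  refine Trip.mono (Trip.seq (N := 700) (N' := 100) (Trip.mono (N := 700)
    (Q := fun τ => τ vI 0 = i ∧ Frame [arr, cnt, par, vI, vCarry] σ τ ∧
      ((τ vCarry 0 = 1 ∧ Carrying n b Bs c arr cnt par (i + 1) τ) ∨
        (τ vCarry 0 = 0 ∧ Found n b Bs c arr cnt par τ))) ?_ le_rfl ?_)) (by norm_num) fun _ h => h
  · refine Trip.mono (Trip.of_branch A (N := 600) (by simp) (fun hne => ?_) fun h0 => ?_)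
      (by simp) fun _ h => h
    · have hic : i ∈ c := by
        by_contra hic
        simp [hi, harr i hin, hti, hic] at hne
      have hcard := card_union_insert (base := Bs) (notMem_erase i (tail c i))
      rw [insert_erase (hti.mpr hic), ← hβ, ← tail_succ_of_mem] at hcard
      have hcard' := card_erase_of_mem (hti.mpr hic)
      have hpos := card_pos.mpr ⟨i, hti.mpr hic⟩
      rw [← tail_succ_of_mem] at hcard'
      refine Trip.step A (i := i) (x := 0) (N' := 400) (by simp [hi]) (by simp)
        (H.small_L (by omega)) (H.small (by omega)) (by simp) (by simp) ?_
      refine Trip.stepVar A (x := (Bs ∪ tail c (i + 1)).card) (N' := 200) ?_ (H.small (by omega))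
        (by simp) (by simp) ?_
      · simp only [val_sub, val_arr, val_num, State.upd_ne _ _ _ s2, State.upd_ne _ _ _ s1,
          State.upd_ne _ _ _ s5, hi, hcnt, hbase i hin, ← hβ]
        omega
      refine Trip.lastVar A (x := (tail c (i + 1)).card % 2) ?_ (H.small (by omega)) (by simp)
        (by simp) ?_
      · simp only [val_sub, val_arr, val_num, State.upd_ne _ _ _ s3, State.upd_ne _ _ _ s14, hpar]
        omega
      refine ⟨?_, ?_, Or.inl ⟨?_, ⟨?_, ?_, ?_⟩, ?_⟩⟩
      · simp [State.upd_ne, s5, s16, s20, hi]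
      · exact (((Frame.refl _ σ).upd (by simp)).upd (by simp)).upd (by simp)
      · simp [State.upd_ne, s6, s17, s21, hcarry]
      · intro j hj
        rw [State.upd_ne _ _ _ d3, State.upd_ne _ _ _ d2, State.upd_self, Function.update_apply,
          tail_succ_of_mem]
        by_cases hji : j = i
        · simp [hji]
        · simp [hji, harr j hj]
      · rw [State.upd_ne _ _ _ f1, State.upd_same]
      · rw [State.upd_same]
      · intro j hj hjc
        rcases Nat.lt_succ_iff_lt_or_eq.mp hj with h | rfl
        · exact hsk j h hjc
        · exact absurd hic hjc
    · have hic : i ∉ c := by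
        intro hic
        simp [hi, harr i hin, hti, hic] at h0
      have hit : i ∉ tail c i := fun h => hic (hti.mp h)
      have hcard := card_union_insert (base := Bs) hit
      rw [← hβ] at hcard
      have hmem : insert i (tail c i) ∈ family n b Bs ↔ (Bs ∪ tail c i).card + β ≤ b := by
        rw [PathSum.mem_family, hcard]
        refine and_iff_right ?_
        intro x hx
        rcases mem_insert.mp hx with rfl | hx
        · exact mem_range.mpr hin
        · exact hcn (mem_filter.mp hx).1
      have hcard' := card_insert_of_notMem hit
      -- By truncation this is nonzero exactly when the enlarged union has at most `b` elements.
      have hval : (Expr.var cap + .num 1 - (.var cnt + (.num 1 - .arr base (.var vI)))).val w σ =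
          b + 1 - ((Bs ∪ tail c i).card + β) := by
        simp only [val_sub, val_add, val_arr, val_num, hcap, hcnt, hi, hbase i hin, ← hβ]
      refine Trip.mono (Trip.of_branch A (N := 400) (by simp) (fun hne => ?_) fun h0 => ?_)
        (by simp) fun _ h => h
      · rw [hval] at hne
        refine Trip.step A (i := i) (x := 1) (N' := 300) (by simp [hi]) (by simp)
          (H.small_L (by omega)) (H.small (by omega)) (by simp) (by simp) ?_
        refine Trip.stepVar A (x := (Bs ∪ insert i (tail c i)).card) (N' := 150) ?_
          (H.small (by omega)) (by simp) (by simp) ?_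
        · simp only [val_sub, val_add, val_arr, val_num, State.upd_ne _ _ _ s2,
            State.upd_ne _ _ _ s1, State.upd_ne _ _ _ s5, hi, hcnt, hbase i hin, ← hβ, hcard]
        refine Trip.stepVar A (x := (insert i (tail c i)).card % 2) (N' := 50) ?_
          (H.small (by omega)) (by simp) (by simp) ?_
        · simp only [val_sub, val_arr, val_num, State.upd_ne _ _ _ s3, State.upd_ne _ _ _ s14,
            hpar]
          omega
        refine Trip.lastVar A (x := 0) (by simp) (H.small (by omega)) (by simp) (by simp) ?_
        refine ⟨?_, ?_, Or.inr ⟨State.upd_same _ _ _ _, i, hic, hsk, hmem.mpr (by omega),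
          ⟨?_, ?_, ?_⟩⟩⟩
        · simp [State.upd_ne, s5, s16, s20, hi, show vI ≠ vCarry by decide]
        · exact ((((Frame.refl _ σ).upd (by simp)).upd (by simp)).upd (by simp)).upd (by simp)
        · intro j hj
          rw [State.upd_ne _ _ _ d6, State.upd_ne _ _ _ d3, State.upd_ne _ _ _ d2,
            State.upd_self, Function.update_apply]
          by_cases hji : j = i
          · simp [hji]
          · simp [hji, harr j hj]
        · rw [State.upd_ne _ _ _ f4, State.upd_ne _ _ _ f1, State.upd_same]
        · rw [State.upd_ne _ _ _ g3, State.upd_same]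
      · rw [hval] at h0
        refine Trip.lastVar A (x := 1) (by simp) (H.small (by omega)) (by simp) (by simp) ?_
        refine ⟨?_, (Frame.refl _ σ).upd (by simp), Or.inl ⟨State.upd_same _ _ _ _, ?_, ?_⟩⟩
        · simp [State.upd_ne, hi, show vI ≠ vCarry by decide]
        · rw [tail_succ_of_notMem hic]
          exact Holds.congr ⟨harr, hcnt, hpar⟩ (State.upd_ne _ _ _ d6) (State.upd_ne _ _ _ f4)
            (State.upd_ne _ _ _ g3)
        · intro j hj hjc
          rcases Nat.lt_succ_iff_lt_or_eq.mp hj with h | rfl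
          · exact hsk j h hjc
          · rw [hmem]; omega
  · rintro τ ⟨hτ, hF, hτ'⟩
    refine Trip.lastVar A (x := i + 1) (by simp [hτ]) (H.small (by omega)) (by simp) (by simp) ?_
    have hH : ∀ Z, Holds n Bs Z arr cnt par τ → Holds n Bs Z arr cnt par (τ.upd vI 0 (i + 1)) :=
      fun Z h => h.congr (State.upd_ne _ _ _ d5) (State.upd_ne _ _ _ f3) (State.upd_ne _ _ _ g2)
    refine ⟨State.upd_same _ _ _ _, hF.upd (by simp), ?_⟩
    rw [State.upd_ne _ _ _ (by decide : vCarry ≠ vI)]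
    rcases hτ' with ⟨h1, h2⟩ | ⟨h1, j, h2, h3, h4, h5⟩
    · exact Or.inl ⟨h1, hH _ h2.holds, h2.skipped⟩
    · exact Or.inr ⟨h1, j, h2, h3, h4, hH _ h5⟩

/-- Each position is charged `1000`: at most `900` for the body and `49` for the test. The product
in the condition stops the loop when the carry is absorbed or the positions are exhausted. -/
theorem trip_nextLoop (H : Setup w L B n adj) {arr base cnt par cap : Fin 32}
    (hd : [arr, base, cnt, par, cap, vI, vCarry, vN].Nodup)
    {b : ℕ} {Bs c : Finset ℕ} {σ : State} (hn : σ vN 0 = n) (hcap : σ cap 0 = b)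
    (hbn : b ≤ n) (hbase : ∀ j < n, σ base j = if j ∈ Bs then 1 else 0)
    (hc : c ∈ family n b Bs) (hH : Holds n Bs c arr cnt par σ) (hcarry : σ vCarry 0 = 1)
    (hi : σ vI 0 = 0) :
    Trip w L B (loop (.var vCarry * (.var vN - .var vI)) (nextBody arr base cnt par cap)) σ
      (1000 * n + 6 * (var vCarry * (var vN - var vI)).size + 1) (fun τ => Frame [arr, cnt, par, vI, vCarry] σ τ ∧
        ((τ vCarry 0 = 1 ∧ Carrying n b Bs c arr cnt par n τ) ∨
        (τ vCarry 0 = 0 ∧ Found n b Bs c arr cnt par τ))) := by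
  have A := H.amb
  have hd' := hd
  simp only [List.nodup_cons, List.mem_cons, List.not_mem_nil, or_false, not_or] at hd'
  obtain ⟨⟨d1, d2, d3, d4, d5, d6, d7⟩, ⟨e1, e2, e3, e4, e5, e6⟩, ⟨f1, f2, f3, f4, f5⟩,
    ⟨g1, g2, g3, g4⟩, ⟨h1, h2, h3⟩, -⟩ := hd'
  have hF : ∀ {τ : State}, Frame [arr, cnt, par, vI, vCarry] σ τ → τ vN 0 = n ∧ τ cap 0 = b ∧
      ∀ j < n, τ base j = if j ∈ Bs then 1 else 0 := by
    intro τ h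
    refine ⟨?_, ?_, fun j hj => ?_⟩
    · rw [h vN (by simp [Ne.symm d7, Ne.symm f5, Ne.symm g4, show vN ≠ vI by decide, show vN ≠ vCarry by decide]), hn]
    · rw [h cap (by simp [Ne.symm d4, Ne.symm f2, Ne.symm g1, h1, h2]), hcap]
    · rw [h base (by simp [Ne.symm d1, e1, e2, e4, e5]), hbase j hj]
  refine Trip.of_loop H.amb (by simp) (fun m τ => Frame [arr, cnt, par, vI, vCarry] σ τ ∧
      ((τ vCarry 0 = 1 ∧ ∃ i ≤ n, τ vI 0 = i ∧ m = 1000 * (n - i) ∧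
        Carrying n b Bs c arr cnt par i τ) ∨
        (τ vCarry 0 = 0 ∧ Found n b Bs c arr cnt par τ))) ?_ ⟨Frame.refl _ σ, Or.inl ⟨hcarry, 0,
          Nat.zero_le _, hi, rfl, by rwa [tail_zero], by simp⟩⟩
  rintro m τ ⟨hfr, ⟨hcar, i, hin, hi, rfl, hC⟩ | hfound⟩
  · obtain ⟨t1, t2, t3⟩ := hF hfr
    rcases hin.eq_or_lt with rfl | hlt
    · exact Or.inl ⟨by simp [t1, hi], hfr, Or.inl ⟨hcar, hC⟩⟩
    · refine Or.inr ⟨by simp [t1, hi, hcar]; omega, 900, 1000 * (n - (i + 1)),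
        by simp; omega, ?_⟩
      refine (trip_nextBody H hd t1 t2 hbn hcar hi hlt t3 hc hC).mono le_rfl ?_
      rintro υ ⟨u1, u2, u3⟩
      refine ⟨hfr.trans u2 fun _ h => h, ?_⟩
      rcases u3 with ⟨u3, u4⟩ | u3
      · exact Or.inl ⟨u3, i + 1, hlt, u1, rfl, u4⟩
      · exact Or.inr u3
  · exact Or.inl ⟨by simp [hfound.1], hfr, Or.inr hfound⟩

/-- The effect of `next`. -/
theorem trip_next (H : Setup w L B n adj) {arr base cnt par cap flag : Fin 32}
    (hd : [arr, base, cnt, par, cap, vI, vCarry, vN].Nodup)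
    {b : ℕ} {Bs c : Finset ℕ} {σ : State} (hn : σ vN 0 = n) (hcap : σ cap 0 = b)
    (hbn : b ≤ n) (hbase : ∀ j < n, σ base j = if j ∈ Bs then 1 else 0)
    (hc : c ∈ family n b Bs) (hH : Holds n Bs c arr cnt par σ)
    (hflag : flag ∉ [arr, cnt, par]) :
    Trip w L B (next arr base cnt par cap flag) σ (1000 * (n + 1)) (fun τ =>
      Frame [arr, cnt, par, flag, vI, vCarry] σ τ ∧
      ((τ flag 0 = 0 ∧ remaining n b Bs c = {c}) ∨
        (τ flag 0 = 1 ∧ ∃ c' ∈ family n b Bs, Holds n Bs c' arr cnt par τ ∧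
          c ∉ remaining n b Bs c' ∧ remaining n b Bs c = insert c (remaining n b Bs c')))) := by
  have A := H.amb
  have hd' := hd
  simp only [List.nodup_cons, List.mem_cons, List.not_mem_nil, or_false, not_or] at hd' hflag
  obtain ⟨⟨d1, d2, d3, d4, d5, d6, d7⟩, ⟨e1, e2, e3, e4, e5, e6⟩, ⟨f1, f2, f3, f4, f5⟩,
    ⟨g1, g2, g3, g4⟩, ⟨h1, h2, h3⟩, -⟩ := hd'
  refine Trip.stepVar A (x := 1) (N' := 1000 * n + 900) (by simp) (H.small (by omega)) (by simp)
    (by simp; omega) ?_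
  refine Trip.stepVar A (x := 0) (N' := 1000 * n + 800) (by simp) (H.small (by omega)) (by simp)
    (by simp; omega) ?_
  have hfr0 : Frame [arr, cnt, par, vI, vCarry] σ ((σ.upd vCarry 0 1).upd vI 0 0) :=
    ((Frame.refl _ σ).upd (by simp)).upd (by simp)
  have hfr1 : ∀ j, j ≠ vI → j ≠ vCarry → ((σ.upd vCarry 0 1).upd vI 0 0) j = σ j :=
    fun j h1 h2 => by rw [State.upd_ne _ _ _ h1, State.upd_ne _ _ _ h2]
  have hcar' : ((σ.upd vCarry 0 1).upd vI 0 0) vCarry 0 = 1 := by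
    rw [State.upd_ne _ _ _ (by decide), State.upd_same]
  have hi' : ((σ.upd vCarry 0 1).upd vI 0 0) vI 0 = 0 := State.upd_same _ _ _ _
  generalize (σ.upd vCarry 0 1).upd vI 0 0 = σ' at *
  have hH' : Holds n Bs c arr cnt par σ' := by
    refine hH.congr (hfr1 _ ?_ ?_) (hfr1 _ ?_ ?_) (hfr1 _ ?_ ?_) <;> assumption
  have hn' : σ' vN 0 = n := by rw [hfr1 vN (by decide) (by decide), hn]
  have hcap' : σ' cap 0 = b := by rw [hfr1 cap h1 h2, hcap]
  have hbase' : ∀ j < n, σ' base j = if j ∈ Bs then 1 else 0 := fun j hj => by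
    rw [hfr1 base e4 e5, hbase j hj]
  have hend : ∀ τ, Frame [arr, cnt, par, vI, vCarry] σ' τ ∧
        ((τ vCarry 0 = 1 ∧ Carrying n b Bs c arr cnt par n τ) ∨
        (τ vCarry 0 = 0 ∧ Found n b Bs c arr cnt par τ)) →
      Trip w L B (assignVar flag (.num 1 - .var vCarry)) τ 100 (fun τ =>
      Frame [arr, cnt, par, flag, vI, vCarry] σ τ ∧
      ((τ flag 0 = 0 ∧ remaining n b Bs c = {c}) ∨
        (τ flag 0 = 1 ∧ ∃ c' ∈ family n b Bs, Holds n Bs c' arr cnt par τ ∧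
          c ∉ remaining n b Bs c' ∧ remaining n b Bs c = insert c (remaining n b Bs c')))) := by
    rintro τ ⟨hfr, hτ⟩
    have hfr' : ∀ x, Frame [arr, cnt, par, flag, vI, vCarry] σ (τ.upd flag 0 x) := fun x =>
      Frame.upd ((hfr0.trans hfr fun _ h => h).weaken (by simp +contextual)) (by simp)
    rcases hτ with ⟨h1, h2⟩ | ⟨h1, i, h2, h3, h4, h5⟩
    -- The carry survived all positions, so no candidate was admissible and `c` is the last member.
    · refine Trip.lastVar A (x := 0) (by simp [h1]) (H.small (by omega)) (by simp) (by simp) ?_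
      exact ⟨hfr' _, Or.inl ⟨State.upd_same _ _ _ _, remaining_last hc h2.skipped⟩⟩
    · refine Trip.lastVar A (x := 1) (by simp [h1]) (H.small (by omega)) (by simp) (by simp) ?_
      refine ⟨hfr' _, Or.inr ⟨State.upd_same _ _ _ _, _, h4, h5.congr ?_ ?_ ?_,
        notMem_remaining_next h2, remaining_next hc h2 h3⟩⟩
      · exact State.upd_ne _ _ _ (Ne.symm hflag.1)
      · exact State.upd_ne _ _ _ (Ne.symm hflag.2.1)
      · exact State.upd_ne _ _ _ (Ne.symm hflag.2.2)


  exact (Trip.seq ((trip_nextLoop H hd hn' hcap' hbn hbase' hc hH' hcar' hi').mono le_rfl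
    hend)).mono (by simp) fun _ h => h


end next

end PathSum

namespace RAM

variable {w : List ℕ} {L B : ℕ}

/-- The rule for `for` loops with an invariant that does not mention the counter. -/
theorem Trip.forFrame (A : Ambient w L B) {i : Fin 32} {e : Expr} {P : Prog} {σ : State}
    {Q : State → Prop} {m N N' : ℕ} (S : List (Fin 32)) (F : ℕ → State → Prop) (hiS : i ∈ S)
    (he : e.size < 80) (hm : m < 2 ^ B) (hev : ∀ τ, Frame S σ τ → e.val w τ = m)
    (hF : ∀ l τ x, F l τ → F l (τ.upd i 0 x)) (h0 : F 0 σ)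
    (hs : ∀ l τ, l < m → τ i 0 = l → Frame S σ τ → F l τ →
      Trip w L B P τ N (fun τ' => τ' i 0 = l ∧ Frame S σ τ' ∧ F (l + 1) τ'))
    (hN : (m + 1) * (N + 6 * e.size + 80) ≤ N')
    (hQ : ∀ τ, Frame S σ τ → F m τ → Q τ) : Trip w L B (forLoop i e P) σ N' Q := by
  refine (Trip.of_forLoop A he hm (fun l τ => τ i 0 = l ∧ Frame S σ τ ∧ F l τ)
    ⟨State.upd_same _ _ _ _, (Frame.refl _ _).upd hiS, hF _ _ _ h0⟩
    (fun l τ h => ⟨h.1, hev τ h.2.1⟩) (N := N) ?_ (fun τ h => hQ τ h.2.1 h.2.2)).mono hN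
    fun _ h => h
  rintro l τ hl ⟨h1, h2, h3⟩
  refine (hs l τ hl h1 h2 h3).mono le_rfl ?_
  rintro τ' ⟨g1, g2, g3⟩
  exact ⟨g1, State.upd_same _ _ _ _, g2.upd hiS, hF _ _ _ g3⟩

theorem Trip.seq_of {P P' : Prog} {σ : State} {N₁ N₂ N : ℕ} {Q R : State → Prop}
    (h : Trip w L B P σ N₁ R) (h' : ∀ τ, R τ → Trip w L B P' τ N₂ Q) (hN : N₁ + N₂ ≤ N) :
    Trip w L B (.seq P P') σ N Q :=
  (Trip.seq (h.mono le_rfl h')).mono hN fun _ h => h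

end RAM

namespace PathSum

open RAM Expr

variable {w : List ℕ} {L B n : ℕ} {adj : ℕ → ℕ → ℕ}

/-! ### Counting walks inside a set by dynamic programming -/

section walks

/-- Computes the next row of the table of walks. -/
def walkRow : Prog :=
  forLoop vI (.var vN) (.seq (assignVar vAcc (.num 0))
    (.seq (forLoop vJ (.var vN) (assignVar vAcc (.var vAcc +
        .inp (.num 2 + .var vI * .var vN + .var vJ) * .arr vW (.var vS * .var vN + .var vJ))))
      (assign vW ((.var vS + .num 1) * .var vN + .var vI) (.arr vY (.var vI) * .var vAcc))))

/-- Computes the numbers of walks inside the set in the array `vY`. -/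
def walkTable (cap : Fin 32) : Prog :=
  .seq (forLoop vI (.var vN) (assign vW (.var vI) (.arr vY (.var vI))))
    (forLoop vS (.var cap - .num 1) walkRow)

theorem Setup.index (H : Setup w L B n adj) {t u : ℕ} (ht : t ≤ n) (hu : u < n) :
    t * n + u < L :=
  lt_of_lt_of_le (by nlinarith) H.le_L

/-- Row `t` of the table occupies the indices `t * n + u` with `u < n`, so writing row `t + 1` does
not disturb the row being read. -/
theorem trip_walkRow (H : Setup w L B n adj) {σ : State} {Y : Finset ℕ} {t : ℕ}
    (hn : σ vN 0 = n) (ht : σ vS 0 = t) (htn : t < n)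
    (hY : ∀ j < n, σ vY j = if j ∈ Y then 1 else 0)
    (hW : ∀ u < n, σ vW (t * n + u) = walks n adj t Y u) :
    Trip w L B walkRow σ (700 * (n + 1) ^ 2) (fun τ => Frame [vI, vJ, vAcc, vW] σ τ ∧
      ∀ u < n, τ vW ((t + 1) * n + u) = walks n adj (t + 1) Y u) := by
  have A := H.amb
  have hpow : t * n + n < 9 * ((n + 2) * (n + 2)) := by nlinarith
  refine Trip.forFrame A [vI, vJ, vAcc, vW] (fun l τ =>
      (∀ u < n, τ vW (t * n + u) = walks n adj t Y u) ∧
      ∀ u < l, τ vW ((t + 1) * n + u) = walks n adj (t + 1) Y u) (by decide) (by simp)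
    (H.small (by omega)) (fun τ h => by simp [h vN (by decide), hn]) (N := 600 * (n + 1))
    ?_ ⟨hW, by simp⟩ ?_ (by simp; nlinarith) (fun τ h1 h2 => ⟨h1, h2.2⟩)
  · intro l τ x h
    simpa (disch := decide) only [State.upd_ne] using h
  rintro i τ hi hτi hfr ⟨h1, h2⟩
  refine Trip.stepVar A (x := 0) (N' := 600 * (n + 1) - 20) (by simp) (H.small (by omega))
    (by simp) (by simp; omega) ?_
  refine Trip.seq_of (N₁ := 300 * (n + 1)) (N₂ := 200)
    (R := fun υ => Frame [vJ, vAcc] (τ.upd vAcc 0 0) υ ∧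
      υ vAcc 0 = ∑ v ∈ range n, adj i v * walks n adj t Y v) ?_ ?_ (by omega)
  · refine Trip.forFrame A [vJ, vAcc] (fun l υ =>
        υ vAcc 0 = ∑ v ∈ range l, adj i v * walks n adj t Y v) (by decide) (by simp)
      (m := n) (H.small (by omega)) ?_ (N := 180) ?_ ?_ ?_ (by simp; omega)
      (fun υ h1 h2 => ⟨h1, h2⟩)
    · intro υ h
      simp (disch := decide) [h vN (by decide), State.upd_ne, hfr vN (by decide), hn]
    · intro l υ x h
      simpa (disch := decide) only [State.upd_ne] using h
    · simp [State.upd_same]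
    · intro j υ hj hυj hfr' hacc
      have e1 : υ vI 0 = i := by rw [hfr' vI (by decide), State.upd_ne _ _ _ (by decide), hτi]
      have e2 : υ vN 0 = n := by
        rw [hfr' vN (by decide), State.upd_ne _ _ _ (by decide), hfr vN (by decide), hn]
      have e3 : υ vS 0 = t := by
        rw [hfr' vS (by decide), State.upd_ne _ _ _ (by decide), hfr vS (by decide), ht]
      have e4 : υ vW (t * n + j) = walks n adj t Y j := by
        rw [hfr' vW (by decide), State.upd_ne _ _ _ (by decide), h1 j hj]
      refine Trip.lastVar A (x := ∑ v ∈ range (j + 1), adj i v * walks n adj t Y v) ?_ ?_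
        (by simp) (by simp) ?_
      · simp only [val_add, val_mul, val_inp, val_arr, val_num, e1, e2, e3, hυj, e4, hacc,
          H.inp i hi j hj, sum_range_succ]
      · exact H.lt_of_le_pow (sum_range_le_pow (p := t * n) (n := n) hj fun v _ =>
          mul_le_of_le_one (H.adj_le _ _) (walks_le H.adj_le Y t v)) hpow
      · refine ⟨?_, hfr'.upd (by decide), State.upd_same _ _ _ _⟩
        rw [State.upd_ne _ _ _ (by decide), hυj]
  · rintro υ ⟨hfr', hacc⟩
    have e0 : ∀ j, j ≠ vJ → j ≠ vAcc → υ j = τ j := fun j h1 h2 => by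
      rw [hfr' j (by simp [h1, h2]), State.upd_ne _ _ _ h2]
    have e1 : υ vI 0 = i := by rw [e0 vI (by decide) (by decide), hτi]
    have e2 : υ vN 0 = n := by rw [e0 vN (by decide) (by decide), hfr vN (by decide), hn]
    have e3 : υ vS 0 = t := by rw [e0 vS (by decide) (by decide), hfr vS (by decide), ht]
    have e4 : υ vY i = if i ∈ Y then 1 else 0 := by
      rw [e0 vY (by decide) (by decide), hfr vY (by decide), hY i hi]
    have e5 : υ vW = τ vW := e0 vW (by decide) (by decide)
    refine Trip.last A (i := (t + 1) * n + i) (x := walks n adj (t + 1) Y i) ?_ ?_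
      (H.index (by omega) hi) (H.lt_of_le_pow (walks_le H.adj_le Y _ i) (by linarith))
      (by simp) (by simp) ?_
    · simp [e1, e2, e3]
    · simp only [val_mul, val_arr, val_num, e1, e4, hacc, walks]
    · refine ⟨?_, ?_, ?_, ?_⟩
      · rw [State.upd_ne _ _ _ (by decide), e1]
      · refine (hfr.trans (S' := [vJ, vAcc]) ?_ (by decide)).upd (by decide)
        intro j hj
        simp only [List.mem_cons, List.not_mem_nil, or_false, not_or] at hj
        exact e0 j hj.1 hj.2
      · intro u hu
        rw [State.upd_self, Function.update_of_ne (by nlinarith), e5, h1 u hu]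
      · intro u hu
        rw [State.upd_self, Function.update_apply, e5]
        split_ifs with hc
        · have : u = i := by omega
          rw [this]
        · exact h2 u (by rcases Nat.lt_succ_iff_lt_or_eq.mp hu with h | rfl
                         · exact h
                         · exact absurd rfl hc)

theorem trip_walkTable (H : Setup w L B n adj) {σ : State} {Y : Finset ℕ} {cap : Fin 32} {c : ℕ}
    (hcap : cap ∉ [vI, vJ, vS, vAcc, vW]) (hn : σ vN 0 = n) (hc : σ cap 0 = c) (hcn : c ≤ n)
    (hY : ∀ j < n, σ vY j = if j ∈ Y then 1 else 0) :
    Trip w L B (walkTable cap) σ (1100 * (n + 1) ^ 3) (fun τ =>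
      Frame [vI, vJ, vS, vAcc, vW] σ τ ∧
      ∀ u < n, τ vW ((c - 1) * n + u) = walks n adj (c - 1) Y u) := by
  have A := H.amb
  have hS : ∀ {τ : State}, Frame [vI, vJ, vS, vAcc, vW] σ τ → τ vN 0 = n ∧ τ cap 0 = c ∧
      ∀ j < n, τ vY j = if j ∈ Y then 1 else 0 := fun {τ} h =>
    ⟨by rw [h vN (by decide), hn], by rw [h cap hcap, hc],
      fun j hj => by rw [h vY (by decide), hY j hj]⟩
  refine Trip.seq_of (N₁ := 160 * (n + 1)) (N₂ := 940 * (n + 1) ^ 3)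
    (R := fun τ => Frame [vI, vJ, vS, vAcc, vW] σ τ ∧ ∀ u < n, τ vW u = walks n adj 0 Y u)
    ?_ ?_ ?_
  · refine Trip.forFrame A [vI, vJ, vS, vAcc, vW] (fun l τ => ∀ u < l, τ vW u = walks n adj 0 Y u)
      (by decide) (by simp) (m := n) (H.small (by omega)) (fun τ h => by simp [(hS h).1])
      (N := 60) ?_ (by simp) ?_ (by simp; omega) (fun τ h1 h2 => ⟨h1, h2⟩)
    · intro l τ x h
      simpa (disch := decide) only [State.upd_ne] using h
    · intro i τ hi hτi hfr h
      refine Trip.last A (i := i) (x := walks n adj 0 Y i) (by simp [hτi]) ?_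
        (H.small_L (by omega)) (H.small ?_) (by simp) (by simp) ⟨?_, hfr.upd (by decide), ?_⟩
      · simp [hτi, (hS hfr).2.2 i hi, walks]
      · simp only [walks]; split_ifs <;> omega
      · rw [State.upd_ne _ _ _ (by decide), hτi]
      · intro u hu
        rw [State.upd_self, Function.update_apply]
        split_ifs with hc
        · rw [hc]
        · exact h u (by omega)
  · rintro σ' ⟨hfr0, hW⟩
    refine Trip.forFrame A [vI, vJ, vS, vAcc, vW] (fun l τ =>
        ∀ u < n, τ vW (l * n + u) = walks n adj l Y u)
      (by decide) (by simp) (m := c - 1) (H.small (by omega))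
      (fun τ h => by simp [(hS (hfr0.trans h fun _ h => h)).2.1])
      (N := 700 * (n + 1) ^ 2) ?_ (by simpa using hW) ?_ ?_
      (fun τ h1 h2 => ⟨hfr0.trans h1 fun _ h => h, h2⟩)
    · intro l τ x h
      simpa (disch := decide) only [State.upd_ne] using h
    · intro t τ ht hτt hfr h
      obtain ⟨g1, g2, g3⟩ := hS (hfr0.trans hfr fun _ h => h)
      refine (trip_walkRow H g1 hτt (by omega) g3 h).mono le_rfl ?_
      rintro υ ⟨h1, h2⟩
      exact ⟨by rw [h1 vS (by decide), hτt], hfr.trans h1 (by decide), h2⟩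
    · have h1 : c - 1 + 1 ≤ n + 1 := by omega
      calc (c - 1 + 1) * (700 * (n + 1) ^ 2 + 6 * (Expr.var cap - Expr.num 1).size + 80)
          ≤ (n + 1) * (940 * (n + 1) ^ 2) := Nat.mul_le_mul h1 (by simp; nlinarith)
        _ = _ := by ring
  · have : n + 1 ≤ (n + 1) ^ 3 := Nat.le_self_pow (by norm_num) _
    omega

end walks

/-! ### The inner sum, over the sets `Y` -/

section half

/-- Adds the contribution of the current set to the entries of `vPos` and `vNeg`. -/
def accumulate (cap : Fin 32) : Prog :=
  forLoop vI (.var vN)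
    (.seq (assign vPos (.var vI) (.arr vPos (.var vI) + (.num 1 - .var vParY) *
        (.var vBin * .arr vW ((.var cap - .num 1) * .var vN + .var vI))))
      (assign vNeg (.var vI) (.arr vNeg (.var vI) + .var vParY *
        (.var vBin * .arr vW ((.var cap - .num 1) * .var vN + .var vI)))))

/-- Processes one set `Y`. -/
def halfStep (cap : Fin 32) : Prog :=
  .seq (walkTable cap)
    (.seq (assignVar vBin (.arr vT ((.var vN - .var vCntY) * (.var vN + .num 2) +
        (.var cap - .var vCntY + .num 1))))
      (.seq (accumulate cap) (next vY vX vCntY vParY cap vFlagY)))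

def halfInit : Prog :=
  .seq (forLoop vI (.var vN) (.seq (assign vPos (.var vI) (.num 0))
      (.seq (assign vNeg (.var vI) (.num 0)) (assign vY (.var vI) (.num 0)))))
    (.seq (assignVar vCntY (.var vCntX))
      (.seq (assignVar vParY (.num 0)) (assignVar vFlagY (.num 1))))

def halfFinal (out : Fin 32) : Prog :=
  forLoop vI (.var vN) (assign out (.var vI)
    ((.arr vPos (.var vI) - .arr vNeg (.var vI)) + (.arr vNeg (.var vI) - .arr vPos (.var vI))))

/-- Computes the numbers of paths on `cap` vertices that cover the set in the array `vX`. -/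
def halfTable (cap out : Fin 32) : Prog :=
  .seq halfInit (.seq (loop (.var vFlagY) (halfStep cap)) (halfFinal out))

theorem trip_accumulate (H : Setup w L B n adj) {σ : State} {cap : Fin 32} {c p : ℕ}
    {wt : ℕ → ℕ} (hcap : cap ∉ [vI, vPos, vNeg]) (hn : σ vN 0 = n) (hc : σ cap 0 = c)
    (hp : σ vParY 0 = p) (hwt : ∀ u < n, σ vBin 0 * σ vW ((c - 1) * n + u) = wt u)
    (hpos : ∀ u < n, σ vPos u + (1 - p) * wt u < 2 ^ B)
    (hneg : ∀ u < n, σ vNeg u + p * wt u < 2 ^ B) :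
    Trip w L B (accumulate cap) σ (600 * (n + 1)) (fun τ => Frame [vI, vPos, vNeg] σ τ ∧
      ∀ u < n, τ vPos u = σ vPos u + (1 - p) * wt u ∧ τ vNeg u = σ vNeg u + p * wt u) := by
  have A := H.amb
  -- The conditional in the invariant records that entries from `l` on are still the original ones.
  refine Trip.forFrame A [vI, vPos, vNeg] (fun l τ => ∀ u < n,
      τ vPos u = σ vPos u + (if u < l then (1 - p) * wt u else 0) ∧
      τ vNeg u = σ vNeg u + (if u < l then p * wt u else 0)) (by decide) (by simp) (m := n)
    (H.small (by omega)) (fun τ h => by simp [h vN (by decide), hn]) (N := 500) ?_ (by simp) ?_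
    (by simp; omega) (fun τ h1 h2 => ⟨h1, fun u hu => ?_⟩)
  · intro l τ x h
    simpa (disch := decide) only [State.upd_ne] using h
  · intro i τ hi hτi hfr h
    have e1 : τ vN 0 = n := by rw [hfr vN (by decide), hn]
    have e2 : τ cap 0 = c := by rw [hfr cap hcap, hc]
    have e3 : τ vParY 0 = p := by rw [hfr vParY (by decide), hp]
    have e4 : τ vBin = σ vBin := hfr vBin (by decide)
    have e5 : τ vW = σ vW := hfr vW (by decide)
    obtain ⟨h1, h2⟩ := h i hi
    rw [if_neg (lt_irrefl i), Nat.add_zero] at h1 h2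
    simp only [List.mem_cons, List.not_mem_nil, or_false, not_or] at hcap
    refine Trip.step A (i := i) (x := σ vPos i + (1 - p) * wt i) (N' := 250) (by simp [hτi]) ?_
      (H.small_L (by omega)) (hpos i hi) (by simp) (by simp) ?_
    · simp only [val_add, val_sub, val_mul, val_arr, val_num, hτi, e1, e2, e3, e4, e5, h1,
        hwt i hi]
    refine Trip.last A (i := i) (x := σ vNeg i + p * wt i) ?_ ?_
      (H.small_L (by omega)) (hneg i hi) (by simp) (by simp) ?_
    · simp (disch := decide) [State.upd_ne, hτi]
    · simp (disch := decide) only [val_add, val_sub, val_mul, val_arr, val_num, State.upd_ne,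
        hτi, e1, e3, e4, e5, h2]
      rw [State.upd_ne _ _ _ hcap.2.1, e2, hwt i hi]
    · refine ⟨?_, (hfr.upd (by decide)).upd (by decide), fun u hu => ⟨?_, ?_⟩⟩
      · simp (disch := decide) only [State.upd_ne, hτi]
      · rw [State.upd_ne _ _ _ (by decide), State.upd_self, Function.update_apply]
        split_ifs with g1 g2 g2
        · rw [g1]
        · omega
        · rw [(h u hu).1, if_pos (by omega)]
        · rw [(h u hu).1, if_neg (by omega)]
      · rw [State.upd_self, Function.update_apply, State.upd_ne _ _ _ (by decide)]
        split_ifs with g1 g2 g2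
        · rw [g1]
        · omega
        · rw [(h u hu).2, if_pos (by omega)]
        · rw [(h u hu).2, if_neg (by omega)]
  · simpa [hu] using h2 u hu

/-- The data on which the computation of `half` depends. -/
structure HalfData (n : ℕ) (X : Finset ℕ) (cap : Fin 32) (c : ℕ) (σ : State) : Prop where
  num : σ vN 0 = n
  cap : σ cap 0 = c
  set : ∀ j < n, σ vX j = if j ∈ X then 1 else 0
  table : ∀ m ≤ n, ∀ r ≤ n, σ vT (m * (n + 2) + (r + 1)) = m.choose r

theorem HalfData.frame {X : Finset ℕ} {cap : Fin 32} {c : ℕ} {σ τ : State} {S : List (Fin 32)}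
    (h : HalfData n X cap c σ) (hf : Frame S σ τ) (hS : ∀ j ∈ [vN, cap, vX, vT], j ∉ S) :
    HalfData n X cap c τ := by
  simp only [List.forall_mem_cons] at hS
  obtain ⟨h1, h2, h3, h4, -⟩ := hS
  exact ⟨by rw [hf _ h1, h.num], by rw [hf _ h2, h.cap], fun j hj => by rw [hf _ h3, h.set j hj],
    fun m hm r hr => by rw [hf _ h4, h.table m hm r hr]⟩

/-- The invariant of the loop over the sets `Y`. -/
structure HalfInv (n : ℕ) (adj : ℕ → ℕ → ℕ) (c : ℕ) (X Y : Finset ℕ) (σ : State) : Prop where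
  holds : Holds n X Y vY vCntY vParY σ
  mem : Y ∈ family n c X
  pos : ∀ u < n, σ vPos u +
    ∑ Z ∈ remaining n c X Y, (1 - Z.card % 2) * weight n adj c X Z u = halfPos n adj c X u
  neg : ∀ u < n, σ vNeg u +
    ∑ Z ∈ remaining n c X Y, Z.card % 2 * weight n adj c X Z u = halfNeg n adj c X u

theorem Setup.halfPos_lt (H : Setup w L B n adj) {c u : ℕ} {X : Finset ℕ} (hc : c ≤ n) :
    halfPos n adj c X u < 2 ^ B :=
  H.lt_of_le_pow (halfPos_le H.adj_le hc) (by nlinarith)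

theorem Setup.halfNeg_lt (H : Setup w L B n adj) {c u : ℕ} {X : Finset ℕ} (hc : c ≤ n) :
    halfNeg n adj c X u < 2 ^ B :=
  H.lt_of_le_pow (halfNeg_le H.adj_le hc) (by nlinarith)

theorem mem_remaining_self {cap : ℕ} {base c : Finset ℕ} (h : c ∈ family n cap base) :
    c ∈ remaining n cap base c := mem_filter.mpr ⟨h, le_rfl⟩

/-- The registers that `halfTable` may change, apart from the output. -/
abbrev halfRegs : List (Fin 32) :=
  [vI, vJ, vS, vAcc, vW, vBin, vPos, vNeg, vY, vCntY, vParY, vFlagY, vCarry]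

/-- In `HalfInv`, the stored sums plus the terms still to come equal the final totals; the present
term is among those to come. This gives correctness at the end and also bounds every partial sum by
a total below `2 ^ B`. -/
theorem trip_halfStep (H : Setup w L B n adj) {σ : State} {cap : Fin 32} {c : ℕ}
    {X Y : Finset ℕ} (hcap : cap = vA ∨ cap = vB) (hcn : c ≤ n)
    (D : HalfData n X cap c σ) (I : HalfInv n adj c X Y σ) :
    Trip w L B (halfStep cap) σ (3100 * (n + 1) ^ 3) (fun τ => Frame halfRegs σ τ ∧
      ((τ vFlagY 0 = 0 ∧ (remaining n c X Y).card = 1 ∧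
        ∀ u < n, τ vPos u = halfPos n adj c X u ∧ τ vNeg u = halfNeg n adj c X u) ∨
      (τ vFlagY 0 = 1 ∧ ∃ Y', HalfInv n adj c X Y' τ ∧
        (remaining n c X Y).card = (remaining n c X Y').card + 1))) := by
  have A := H.amb
  have hcap' : ∀ S : List (Fin 32), vA ∉ S → vB ∉ S → cap ∉ S := by
    rintro S h1 h2; rcases hcap with rfl | rfl <;> assumption
  have hall : ∀ S : List (Fin 32), vA ∉ S → vB ∉ S → vN ∉ S → vX ∉ S → vT ∉ S →
      ∀ j ∈ [vN, cap, vX, vT], j ∉ S := by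
    intro S h1 h2 h3 h4 h5
    simp only [List.forall_mem_cons, List.not_mem_nil, false_imp_iff, implies_true, and_true]
    exact ⟨h3, hcap' S h1 h2, h4, h5⟩
  obtain ⟨hYn, hYc⟩ := PathSum.mem_family.mp I.mem
  have hself := mem_remaining_self I.mem
  have hpow : n + 1 ≤ (n + 1) ^ 3 := Nat.le_self_pow (by norm_num) _
  refine Trip.seq_of (N₂ := 2000 * (n + 1) ^ 3) (trip_walkTable H
    (hcap' _ (by decide) (by decide)) D.num D.cap hcn I.holds.arr) ?_ (by omega)
  rintro τ ⟨hτ, hW⟩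
  have Dτ := D.frame hτ (hall _ (by decide) (by decide) (by decide) (by decide) (by decide))
  have hcnt : τ vCntY 0 = (X ∪ Y).card := by rw [hτ vCntY (by decide), I.holds.cnt]
  set β := (n - (X ∪ Y).card).choose (c - (X ∪ Y).card) with hβ
  refine Trip.stepVar A (x := β) (N' := 1700 * (n + 1) ^ 3) ?_ ?_ (by simp) (by simp; omega) ?_
  · simp only [val_add, val_sub, val_mul, val_arr, val_num, Dτ.num, Dτ.cap, hcnt]
    -- The `+ 1` in the column index is the shift of the binomial table by its leading zero column.
    rw [Dτ.table _ (Nat.sub_le _ _) _ (by omega)]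
  · exact H.lt_of_le_pow ((Nat.choose_le_two_pow _ _).trans
      (Nat.pow_le_pow_right (by norm_num) (Nat.sub_le n _))) (by nlinarith)
  have hpos1 : ∀ u < n, (1 - Y.card % 2) * weight n adj c X Y u ≤
      ∑ Z ∈ remaining n c X Y, (1 - Z.card % 2) * weight n adj c X Z u := fun u _ =>
    single_le_sum (f := fun Z => (1 - Z.card % 2) * weight n adj c X Z u)
      (fun _ _ => Nat.zero_le _) hself
  have hneg1 : ∀ u < n, Y.card % 2 * weight n adj c X Y u ≤
      ∑ Z ∈ remaining n c X Y, Z.card % 2 * weight n adj c X Z u := fun u _ =>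
    single_le_sum (f := fun Z => Z.card % 2 * weight n adj c X Z u)
      (fun _ _ => Nat.zero_le _) hself
  have hτP : τ vPos = σ vPos := hτ _ (by decide)
  have hτN : τ vNeg = σ vNeg := hτ _ (by decide)
  refine Trip.seq_of (N₂ := 1000 * (n + 1)) (trip_accumulate H (wt := weight n adj c X Y)
    (p := Y.card % 2) (c := c) (hcap' _ (by decide) (by decide)) ?_ ?_ ?_ ?_ ?_ ?_) ?_ (by omega)
  · rw [State.upd_ne _ _ _ (by decide), Dτ.num]
  · rw [State.upd_ne _ _ _ (by rcases hcap with rfl | rfl <;> decide), Dτ.cap]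
  · rw [State.upd_ne _ _ _ (by decide), hτ _ (by decide), I.holds.par]
  · intro u hu
    rw [State.upd_same, State.upd_ne _ _ _ (by decide), hW u hu, weight]
  · intro u hu
    rw [State.upd_ne _ _ _ (by decide), hτP]
    have := I.pos u hu
    have := hpos1 u hu
    have := H.halfPos_lt (u := u) (X := X) hcn
    omega
  · intro u hu
    rw [State.upd_ne _ _ _ (by decide), hτN]
    have := I.neg u hu
    have := hneg1 u hu
    have := H.halfNeg_lt (u := u) (X := X) hcn
    omega
  rintro υ ⟨hυ, hacc⟩
  have hυ' : Frame [vI, vJ, vS, vAcc, vW, vBin, vPos, vNeg] σ υ :=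
    ((hτ.weaken (by decide)).upd (by decide)).trans hυ (by decide)
  have Dυ := D.frame hυ' (hall _ (by decide) (by decide) (by decide) (by decide) (by decide))
  have hHυ : Holds n X Y vY vCntY vParY υ :=
    I.holds.congr (hυ' _ (by decide)) (hυ' _ (by decide)) (hυ' _ (by decide))
  have hPυ : ∀ u < n, υ vPos u = σ vPos u + (1 - Y.card % 2) * weight n adj c X Y u ∧
      υ vNeg u = σ vNeg u + Y.card % 2 * weight n adj c X Y u := by
    intro u hu
    obtain ⟨h1, h2⟩ := hacc u hu
    rw [h1, h2, State.upd_ne _ _ _ (by decide), State.upd_ne _ _ _ (by decide), hτP, hτN]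
    exact ⟨rfl, rfl⟩
  refine (trip_next H (by rcases hcap with rfl | rfl <;> decide) Dυ.num Dυ.cap hcn Dυ.set I.mem
    hHυ (by decide)).mono le_rfl ?_
  rintro φ ⟨hφ, h⟩
  have e1 : φ vPos = υ vPos := hφ _ (by decide)
  have e2 : φ vNeg = υ vNeg := hφ _ (by decide)
  refine ⟨(hυ'.weaken (by decide)).trans hφ (by decide), ?_⟩
  rcases h with ⟨h0, hrem⟩ | ⟨h1, Y', hY', hH', hnot, hrem⟩
  · refine Or.inl ⟨h0, by rw [hrem, card_singleton], fun u hu => ?_⟩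
    have h1 := I.pos u hu
    have h2 := I.neg u hu
    rw [hrem, sum_singleton] at h1 h2
    rw [e1, e2, (hPυ u hu).1, (hPυ u hu).2]
    exact ⟨h1, h2⟩
  · refine Or.inr ⟨h1, Y', ⟨hH', hY', fun u hu => ?_, fun u hu => ?_⟩, ?_⟩
    · have h1 := I.pos u hu
      rw [hrem, sum_insert hnot] at h1
      rw [e1, (hPυ u hu).1, add_assoc, h1]
    · have h1 := I.neg u hu
      rw [hrem, sum_insert hnot] at h1
      rw [e2, (hPυ u hu).2, add_assoc, h1]
    · rw [hrem, card_insert_of_notMem hnot]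

theorem trip_halfInit (H : Setup w L B n adj) {σ : State} {c : ℕ} {X : Finset ℕ}
    (hn : σ vN 0 = n) (hcnt : σ vCntX 0 = X.card) (hXc : X.card ≤ c) (hcn : c ≤ n) :
    Trip w L B halfInit σ (500 * (n + 1)) (fun τ => Frame halfRegs σ τ ∧ τ vFlagY 0 = 1 ∧
      HalfInv n adj c X ∅ τ) := by
  have A := H.amb
  refine Trip.seq_of (N₁ := 300 * (n + 1)) (N₂ := 200) (R := fun τ =>
    Frame [vI, vPos, vNeg, vY] σ τ ∧ ∀ u < n, τ vPos u = 0 ∧ τ vNeg u = 0 ∧ τ vY u = 0)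
    ?_ ?_ (by omega)
  · refine Trip.forFrame A [vI, vPos, vNeg, vY]
      (fun l τ => ∀ u < l, τ vPos u = 0 ∧ τ vNeg u = 0 ∧ τ vY u = 0) (by decide) (by simp)
      (m := n) (H.small (by omega)) (fun τ h => by simp [h vN (by decide), hn]) (N := 200) ?_
      (by simp) ?_ (by simp; omega) (fun τ h1 h2 => ⟨h1, h2⟩)
    · intro l τ x h
      simpa (disch := decide) only [State.upd_ne] using h
    · intro i τ hi hτi hfr h
      refine Trip.step A (i := i) (x := 0) (N' := 120) (by simp [hτi]) (by simp)
        (H.small_L (by omega)) (H.small (by omega)) (by simp) (by simp) ?_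
      refine Trip.step A (i := i) (x := 0) (N' := 60)
        (by simp (disch := decide) [State.upd_ne, hτi]) (by simp)
        (H.small_L (by omega)) (H.small (by omega)) (by simp) (by simp) ?_
      refine Trip.last A (i := i) (x := 0) (by simp (disch := decide) [State.upd_ne, hτi])
        (by simp) (H.small_L (by omega)) (H.small (by omega)) (by simp) (by simp) ?_
      refine ⟨?_, ((hfr.upd (by decide)).upd (by decide)).upd (by decide), fun u hu => ?_⟩
      · simp (disch := decide) only [State.upd_ne, hτi]
      · simp (disch := decide) only [State.upd_ne, State.upd_self, Function.update_apply]
        by_cases hui : u = i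
        · simp [hui]
        · simpa [hui] using h u (by omega)
  · rintro τ ⟨hfr, hz⟩
    refine Trip.stepVar A (x := X.card) (N' := 130) ?_ (H.small (by omega)) (by simp) (by simp) ?_
    · simp only [val_arr, val_num]
      rw [hfr vCntX (by decide), hcnt]
    refine Trip.stepVar A (x := 0) (N' := 60) (by simp) (H.small (by omega)) (by simp) (by simp)
      ?_
    refine Trip.lastVar A (x := 1) (by simp) (H.small (by omega)) (by simp) (by simp) ?_
    refine ⟨(((hfr.weaken (by decide)).upd (by decide)).upd (by decide)).upd (by decide),
      State.upd_same _ _ _ _, ⟨fun j hj => ?_, ?_, ?_⟩, ?_, fun u hu => ?_, fun u hu => ?_⟩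
    · simp (disch := decide) [State.upd_ne, (hz j hj).2.2]
    · simp (disch := decide) [State.upd_ne, State.upd_same]
    · simp (disch := decide) [State.upd_ne, State.upd_same]
    · simpa [PathSum.mem_family] using hXc
    · rw [remaining_empty]
      simp (disch := decide) [State.upd_ne, (hz u hu).1, halfPos]
    · rw [remaining_empty]
      simp (disch := decide) [State.upd_ne, (hz u hu).2.1, halfNeg]

theorem trip_halfFinal (H : Setup w L B n adj) {σ : State} {c : ℕ} {X : Finset ℕ}
    {out : Fin 32} (hout : out = vF ∨ out = vG) (hn : σ vN 0 = n) (hcn : c ≤ n)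
    (h : ∀ u < n, σ vPos u = halfPos n adj c X u ∧ σ vNeg u = halfNeg n adj c X u) :
    Trip w L B (halfFinal out) σ (300 * (n + 1)) (fun τ => Frame [out, vI] σ τ ∧
      ∀ u < n, τ out u = half n adj c X u) := by
  have A := H.amb
  have hI : out ≠ vI := by rcases hout with rfl | rfl <;> decide
  have h' : ∀ j ∈ [vN, vPos, vNeg], j ∉ [out, vI] := by rcases hout with rfl | rfl <;> decide
  refine Trip.forFrame A [out, vI] (fun l τ => ∀ u < l, τ out u = half n adj c X u)
    (by simp) (by simp) (m := n) (H.small (by omega))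
    (fun τ hf => by simp [hf vN (h' _ (by decide)), hn]) (N := 180) ?_ (by simp) ?_
    (by simp; omega) (fun τ h1 h2 => ⟨h1, h2⟩)
  · intro l τ x h
    simpa only [State.upd_ne _ _ _ hI] using h
  · intro i τ hi hτi hfr hτ
    refine Trip.last A (i := i) (x := half n adj c X i) (by simp [hτi]) ?_ (H.small_L (by omega))
      (H.lt_of_le_pow (half_le H.adj_le hcn) (by nlinarith)) (by simp) (by simp)
      ⟨?_, hfr.upd (by simp), fun u hu => ?_⟩
    · simp only [val_add, val_sub, val_arr, val_num, hτi, hfr vPos (h' _ (by decide)),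
        hfr vNeg (h' _ (by decide)), (h i hi).1, (h i hi).2, half]
    · rw [State.upd_ne _ _ _ (Ne.symm hI), hτi]
    · rw [State.upd_self, Function.update_apply]
      split_ifs with hc
      · rw [hc]
      · exact hτ u (by omega)

/-- One round per member of the family, counted by the cardinality of `remaining`; the enumeration
starts at `∅`, the least set. As the family is nonempty, its cardinality also absorbs the cost of
initialization and output. -/
theorem trip_halfTable (H : Setup w L B n adj) {σ : State} {cap out : Fin 32} {c : ℕ}
    {X : Finset ℕ} (hcap : cap = vA ∨ cap = vB) (hout : out = vF ∨ out = vG)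
    (hcn : c ≤ n) (D : HalfData n X cap c σ) (hcnt : σ vCntX 0 = X.card) (hXc : X.card ≤ c) :
    Trip w L B (halfTable cap out) σ (4000 * (n + 1) ^ 3 * (family n c X).card)
      (fun τ => Frame (out :: halfRegs) σ τ ∧ ∀ u < n, τ out u = half n adj c X u) := by
  have A := H.amb
  have hpow : n + 1 ≤ (n + 1) ^ 3 := Nat.le_self_pow (by norm_num) _
  have hall : ∀ j ∈ [vN, cap, vX, vT], j ∉ halfRegs := by
    rcases hcap with rfl | rfl <;> decide
  have hfam : 1 ≤ (family n c X).card :=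
    card_pos.mpr ⟨∅, PathSum.mem_family.mpr ⟨empty_subset _, by simpa using hXc⟩⟩
  have hexp : (n + 1) ^ 3 ≤ (n + 1) ^ 3 * (family n c X).card := Nat.le_mul_of_pos_right _ hfam
  refine Trip.seq_of (N₂ := 3500 * (n + 1) ^ 3 * (family n c X).card)
    (trip_halfInit H D.num hcnt hXc hcn) ?_ (by nlinarith)
  rintro σ₀ ⟨h0, hflag, hI⟩
  refine Trip.seq_of (N₂ := 300 * (n + 1)) (R := fun τ => Frame halfRegs σ τ ∧
      ∀ u < n, τ vPos u = halfPos n adj c X u ∧ τ vNeg u = halfNeg n adj c X u)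
    (Trip.of_loop A (by simp) (fun m τ => Frame halfRegs σ τ ∧
      ((τ vFlagY 0 = 0 ∧
        ∀ u < n, τ vPos u = halfPos n adj c X u ∧ τ vNeg u = halfNeg n adj c X u) ∨
      (τ vFlagY 0 = 1 ∧ ∃ Y, HalfInv n adj c X Y τ ∧
        m = 3125 * (n + 1) ^ 3 * (remaining n c X Y).card)))
      (m := 3125 * (n + 1) ^ 3 * (family n c X).card) ?_
      ⟨h0, Or.inr ⟨hflag, ∅, hI, by rw [remaining_empty]⟩⟩) ?_ ?_
  · rintro m τ ⟨hτ, ⟨hf, hP⟩ | ⟨hf, Y, hY, rfl⟩⟩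
    · exact Or.inl ⟨by simp [hf], hτ, hP⟩
    · have hrem : 1 ≤ (remaining n c X Y).card := card_pos.mpr ⟨Y, mem_remaining_self hY.mem⟩
      refine Or.inr ⟨by simp [hf], 3100 * (n + 1) ^ 3,
        3125 * (n + 1) ^ 3 * ((remaining n c X Y).card - 1), ?_, ?_⟩
      · obtain ⟨r, hr⟩ := Nat.exists_eq_add_of_le' hrem
        rw [hr, Nat.add_sub_cancel, mul_add]
        simp
        omega
      · refine (trip_halfStep H hcap hcn (D.frame hτ hall) hY).mono le_rfl ?_
        rintro υ ⟨h1, h2⟩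
        refine ⟨hτ.trans h1 fun _ h => h, ?_⟩
        rcases h2 with ⟨h2, _, h3⟩ | ⟨h2, Y', h3, h4⟩
        · exact Or.inl ⟨h2, h3⟩
        · exact Or.inr ⟨h2, Y', h3, by rw [h4, Nat.add_sub_cancel]⟩
  · rintro τ ⟨hτ, hP⟩
    refine (trip_halfFinal H hout (D.frame hτ hall).num hcn hP).mono le_rfl ?_
    rintro υ ⟨h1, h2⟩
    refine ⟨(hτ.weaken fun j hj => List.mem_cons_of_mem _ hj).trans h1 ?_, h2⟩
    simp
  · simp; nlinarith

end half

/-! ### The outer sum, over the sets `X` -/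

section main

/-- Computes the table of the binomial coefficients. -/
def pascal : Prog :=
  .seq (assign vT (.num 1) (.num 1)) (forLoop vI (.var vN) (forLoop vJ (.var vN + .num 1)
    (assign vT ((.var vI + .num 1) * (.var vN + .num 2) + (.var vJ + .num 1))
      (.arr vT (.var vI * (.var vN + .num 2) + .var vJ) +
        .arr vT (.var vI * (.var vN + .num 2) + (.var vJ + .num 1))))))

/-- Computes the sizes of the two halves of a path. -/
def halves : Prog :=
  .seq (forLoop vI (.var vK) (assignVar vB (.var vI + .num 1 - .var vB)))
    (assignVar vA (.var vK + .num 1 - .var vB))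

/-- Joins the two halves. -/
def join : Prog :=
  .seq (assignVar vAcc (.num 0)) (forLoop vI (.var vN) (forLoop vJ (.var vN)
    (assignVar vAcc (.var vAcc + .inp (.num 2 + .var vI * .var vN + .var vJ) *
      .arr vF (.var vI) * .arr vG (.var vJ)))))

/-- Processes one set `X`. -/
def mainStep : Prog :=
  .seq (halfTable vA vF) (.seq (halfTable vB vG) (.seq join
    (.seq (assignVar vTotPos (.var vTotPos + (.num 1 - .var vParX) * .var vAcc))
      (.seq (assignVar vTotNeg (.var vTotNeg + .var vParX * .var vAcc))
        (next vX vEmpty vCntX vParX vB vFlagX)))))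

def mainLoop : Prog :=
  .seq (assignVar vFlagX (.num 1)) (.seq (loop (.var vFlagX) mainStep)
    (assignVar vOut (.var vTotPos - .var vTotNeg)))

/-- The program that counts paths. -/
def program : Prog :=
  .seq (assignVar vN (.inp (.num 0))) (.seq (assignVar vK (.inp (.num 1)))
    (branch (.var vK)
      (branch (.var vN - .var vK) (.seq halves (.seq pascal mainLoop)) (assignVar vOut (.num 0)))
      (assignVar vOut (.var vN))))

/-- The coefficient `m.choose r` is stored in column `r + 1` of a table of width `n + 2`. The zero
column `0` makes the recursion uniform, including `r = 0`. -/
theorem trip_pascal (H : Setup w L B n adj) {σ : State} (hn : σ vN 0 = n)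
    (hT : ∀ x, σ vT x = 0) :
    Trip w L B pascal σ (2000 * (n + 1) ^ 2) (fun τ => Frame [vI, vJ, vT] σ τ ∧
      ∀ m ≤ n, ∀ r ≤ n, τ vT (m * (n + 2) + (r + 1)) = m.choose r) := by
  have A := H.amb
  refine Trip.step A (i := 1) (x := 1) (N' := 2000 * (n + 1) ^ 2 - 30) (by simp) (by simp)
    (H.small_L (by omega)) (H.small (by omega)) (by simp)
    (by simp; have : 1 ≤ (n + 1) ^ 2 := Nat.one_le_pow _ _ (by omega); omega) ?_
  refine Trip.forFrame A [vI, vJ, vT] (fun l τ =>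
      (∀ m ≤ l, τ vT (m * (n + 2)) = 0 ∧
        ∀ r ≤ n, τ vT (m * (n + 2) + (r + 1)) = m.choose r) ∧
      ∀ x, (l + 1) * (n + 2) ≤ x → τ vT x = 0) (by decide) (by simp) (m := n)
    (H.small (by omega)) (fun τ h => ?_) (N := 1100 * (n + 1)) ?_ ?_ ?_ ?_
    (fun τ h1 h2 => ⟨?_, fun m hm r hr => (h2.1 m hm).2 r hr⟩)
  · simp only [val_arr, val_num]
    rw [h vN (by decide), State.upd_ne _ _ _ (by decide), hn]
  · intro l τ x h
    simpa (disch := decide) only [State.upd_ne] using h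
  · rw [State.upd_self]
    refine ⟨fun m hm => ?_, fun x hx => ?_⟩
    · obtain rfl : m = 0 := by omega
      refine ⟨by simp [hT], fun r _ => ?_⟩
      rw [Function.update_apply]
      rcases r with _ | r
      · simp
      · simp [hT]
    · rw [Function.update_of_ne (by omega), hT]
  · rintro i τ hi hτi hfr ⟨h1, h2⟩
    refine Trip.forFrame A [vJ, vT] (fun l υ =>
        (∀ m ≤ i, υ vT (m * (n + 2)) = 0 ∧
          ∀ r ≤ n, υ vT (m * (n + 2) + (r + 1)) = m.choose r) ∧
        υ vT ((i + 1) * (n + 2)) = 0 ∧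
        (∀ r < l, υ vT ((i + 1) * (n + 2) + (r + 1)) = (i + 1).choose r) ∧
        ∀ x, (i + 2) * (n + 2) ≤ x → υ vT x = 0) (by decide) (by simp) (m := n + 1)
      (H.small (by omega)) (fun υ h => ?_) (N := 400) ?_ ⟨h1, h2 _ (by omega), by simp,
        fun x hx => h2 x (by nlinarith)⟩ ?_ (by simp; nlinarith) ?_
    · simp only [val_add, val_arr, val_num]
      rw [h vN (by decide), hfr vN (by decide), State.upd_ne _ _ _ (by decide), hn]
    · intro l υ x h
      simpa (disch := decide) only [State.upd_ne] using h
    · rintro j υ hj hυj hfr' ⟨g1, g2, g3, g4⟩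
      have e1 : υ vI 0 = i := by rw [hfr' vI (by decide), hτi]
      have e2 : υ vN 0 = n := by
        rw [hfr' vN (by decide), hfr vN (by decide), State.upd_ne _ _ _ (by decide), hn]
      have hch : (i + 1).choose j < 2 ^ B :=
        H.lt_of_le_pow (Nat.choose_le_two_pow _ _) (by nlinarith)
      refine Trip.last A (i := (i + 1) * (n + 2) + (j + 1)) (x := (i + 1).choose j) ?_ ?_ ?_ hch
        (by simp) (by simp) ⟨?_, hfr'.upd (by decide), ?_⟩
      · simp [e1, e2, hυj]
      · simp only [val_add, val_mul, val_arr, val_num, e1, e2, hυj]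
        obtain ⟨k1, k2⟩ := g1 i le_rfl
        rw [k2 j (by omega)]
        rcases j with _ | j
        -- The left neighbour lies in the zero column, and both `(i + 1).choose 0` and `i.choose 0`
        -- are `1`.
        · simp [k1]
        · rw [k2 j (by omega), Nat.choose_succ_succ]
      · exact lt_of_lt_of_le (by nlinarith) H.le_L
      · rw [State.upd_ne _ _ _ (by decide), hυj]
      · rw [State.upd_self]
        refine ⟨fun m hm => ⟨?_, fun r hr => ?_⟩, ?_, fun r hr => ?_, fun x hx => ?_⟩
        · rw [Function.update_of_ne (by nlinarith), (g1 m hm).1]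
        · rw [Function.update_of_ne (by nlinarith), (g1 m hm).2 r hr]
        · rw [Function.update_of_ne (by omega), g2]
        · rw [Function.update_apply]
          split_ifs with hc
          · have : r = j := by omega
            rw [this]
          · exact g3 r (by
              rcases Nat.lt_succ_iff_lt_or_eq.mp hr with h | rfl
              · exact h
              · exact absurd rfl hc)
        · rw [Function.update_of_ne (by nlinarith), g4 x hx]
    · rintro υ h3 ⟨g1, g2, g3, g4⟩
      refine ⟨by rw [h3 vI (by decide), hτi], hfr.trans h3 (by decide), fun m hm => ?_, g4⟩
      rcases Nat.le_succ_iff.mp hm with hm | rfl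
      · exact g1 m hm
      · exact ⟨g2, fun r hr => g3 r (by omega)⟩
  · have : 30 ≤ 2000 * (n + 1) ^ 2 := by
      have : 1 ≤ (n + 1) ^ 2 := Nat.one_le_pow _ _ (by omega)
      omega
    simp
    zify [this]
    nlinarith
  · exact ((Frame.refl _ σ).upd (by decide)).trans h1 fun _ h => h

/-- There is no division: the recursion `b ↦ l + 1 - b`, started at `0`, produces `(l + 1) / 2`
after `l` rounds. -/
theorem trip_halves (A : Ambient w L B) {σ : State} {k : ℕ} (hk : σ vK 0 = k) (hkB : k + 1 < 2 ^ B)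
    (hb : σ vB 0 = 0) :
    Trip w L B halves σ (400 * (k + 1)) (fun τ => Frame [vI, vA, vB] σ τ ∧
      τ vB 0 = (k + 1) / 2 ∧ τ vA 0 = k + 1 - (k + 1) / 2) := by
  refine Trip.seq_of (N₁ := 200 * (k + 1)) (N₂ := 100) (R := fun τ => Frame [vI, vB] σ τ ∧
    τ vB 0 = (k + 1) / 2) ?_ ?_ (by omega)
  · refine Trip.forFrame A [vI, vB] (fun l τ => τ vB 0 = (l + 1) / 2) (by decide) (by simp)
      (m := k) (by omega) (fun τ h => by simp [h vK (by decide), hk]) (N := 100) ?_ (by simp [hb])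
      ?_ (by simp; omega) (fun τ h1 h2 => ⟨h1, h2⟩)
    · intro l τ x h
      simpa (disch := decide) only [State.upd_ne] using h
    · intro l τ hl hτl hfr h
      refine Trip.lastVar A (x := (l + 1 + 1) / 2) ?_ (by omega) (by simp) (by simp)
        ⟨?_, hfr.upd (by decide), State.upd_same _ _ _ _⟩
      · simp only [val_sub, val_add, val_arr, val_num, hτl, h]
        omega
      · rw [State.upd_ne _ _ _ (by decide), hτl]
  · rintro τ ⟨hfr, h⟩
    refine Trip.lastVar A (x := k + 1 - (k + 1) / 2) ?_ (by omega) (by simp) (by simp)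
      ⟨(hfr.weaken (by decide)).upd (by decide), ?_, State.upd_same _ _ _ _⟩
    · simp only [val_sub, val_add, val_arr, val_num, h, hfr vK (by decide), hk]
    · rw [State.upd_ne _ _ _ (by decide), h]

theorem Setup.joined_lt (H : Setup w L B n adj) {a b : ℕ} {X : Finset ℕ} (ha : a ≤ n)
    (hb : b ≤ n) : joined n adj a b X < 2 ^ B :=
  H.lt_of_le_pow (joined_le H.adj_le ha hb) (by nlinarith)

theorem trip_join (H : Setup w L B n adj) {σ : State} {a b : ℕ} {X : Finset ℕ} (ha : a ≤ n)
    (hb : b ≤ n) (hn : σ vN 0 = n) (hF : ∀ u < n, σ vF u = half n adj a X u)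
    (hG : ∀ u < n, σ vG u = half n adj b X u) :
    Trip w L B join σ (600 * (n + 1) ^ 2) (fun τ => Frame [vI, vJ, vAcc] σ τ ∧
      τ vAcc 0 = joined n adj a b X) := by
  have A := H.amb
  set f : ℕ → ℕ → ℕ := fun u v => adj u v * half n adj a X u * half n adj b X v with hf
  have hsq : n + 1 ≤ (n + 1) ^ 2 := Nat.le_self_pow (by norm_num) _
  refine Trip.stepVar A (x := 0) (N' := 600 * (n + 1) ^ 2 - 50) (by simp) (H.small (by omega))
    (by simp) (by simp; omega) ?_
  have h0 : Frame [vI, vJ, vAcc] σ (σ.upd vAcc 0 0) := (Frame.refl _ σ).upd (by decide)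
  have hacc0 : (σ.upd vAcc 0 0) vAcc 0 = 0 := State.upd_same _ _ _ _
  generalize σ.upd vAcc 0 0 = σ₀ at h0 hacc0
  refine Trip.forFrame A [vI, vJ, vAcc] (fun l τ =>
      τ vAcc 0 = ∑ u ∈ range l, ∑ v ∈ range n, f u v) (by decide) (by simp)
    (m := n) (H.small (by omega)) (fun τ h => ?_) (N := 400 * (n + 1)) ?_ (by simp [hacc0])
    ?_ ?_ (fun τ h1 h2 => ⟨h0.trans h1 fun _ h => h, h2⟩)
  · simp only [val_arr, val_num]
    rw [h vN (by decide), h0 vN (by decide), hn]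
  · intro l τ x h
    simpa (disch := decide) only [State.upd_ne] using h
  · intro i τ hi hτi hfr hacc
    refine Trip.forFrame A [vJ, vAcc] (fun l υ =>
        υ vAcc 0 = ∑ u ∈ range i, ∑ v ∈ range n, f u v + ∑ v ∈ range l, f i v)
      (by decide) (by simp) (m := n) (H.small (by omega)) (fun υ h => ?_) (N := 300) ?_
      (by simp [hacc]) ?_ (by simp; omega) (fun υ h1 h2 => ⟨?_, hfr.trans h1 (by decide), ?_⟩)
    · simp only [val_arr, val_num]
      rw [h vN (by decide), hfr vN (by decide), h0 vN (by decide), hn]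
    · intro l τ x h
      simpa (disch := decide) only [State.upd_ne] using h
    · intro j υ hj hυj hfr' hacc'
      have hσ : ∀ x, x ∉ [vI, vJ, vAcc] → υ x = σ x := fun x hx => by
        rw [hfr' x (by intro h; exact hx (by revert h; simp; tauto)), hfr x hx, h0 x hx]
      have e1 : υ vI 0 = i := by rw [hfr' vI (by decide), hτi]
      -- Partial sums of nonnegative terms stay below the final value, which fits in `B` bits.
      have hx : ∑ u ∈ range i, ∑ v ∈ range n, f u v + ∑ v ∈ range (j + 1), f i v ≤
          joined n adj a b X := by
        calc _ ≤ ∑ u ∈ range i, ∑ v ∈ range n, f u v + ∑ v ∈ range n, f i v :=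
              Nat.add_le_add_left (sum_le_sum_of_subset (range_mono hj)) _
          _ = ∑ u ∈ range (i + 1), ∑ v ∈ range n, f u v := (sum_range_succ _ _).symm
          _ ≤ _ := sum_le_sum_of_subset (range_mono hi)
      refine Trip.lastVar A
        (x := ∑ u ∈ range i, ∑ v ∈ range n, f u v + ∑ v ∈ range (j + 1), f i v) ?_
        (hx.trans_lt (H.joined_lt ha hb)) (by simp) (by simp)
        ⟨?_, hfr'.upd (by decide), State.upd_same _ _ _ _⟩
      · simp only [val_add, val_mul, val_inp, val_arr, val_num, e1, hυj, hacc',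
          hσ vN (by decide), hσ vF (by decide), hσ vG (by decide), hn, hF i hi, hG j hj,
          H.inp i hi j hj]
        rw [sum_range_succ (f i), add_assoc]
      · rw [State.upd_ne _ _ _ (by decide), hυj]
    · rw [h1 vI (by decide), hτi]
    · rw [h2, sum_range_succ]
  · simp
    have : 50 ≤ 600 * (n + 1) ^ 2 := by omega
    zify [this]
    nlinarith

/-- The invariant of the loop over the sets `X`. -/
structure MainInv (n : ℕ) (adj : ℕ → ℕ → ℕ) (a b : ℕ) (X : Finset ℕ) (σ : State) : Prop where
  first : HalfData n X vA a σ
  second : HalfData n X vB b σ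
  holds : Holds n ∅ X vX vCntX vParX σ
  empty : ∀ j < n, σ vEmpty j = 0
  mem : X ∈ family n b ∅
  pos : σ vTotPos 0 + ∑ Z ∈ remaining n b ∅ X, (1 - Z.card % 2) * joined n adj a b Z =
    joinedPos n adj a b
  neg : σ vTotNeg 0 + ∑ Z ∈ remaining n b ∅ X, Z.card % 2 * joined n adj a b Z =
    joinedNeg n adj a b

theorem family_mono {a b : ℕ} (h : b ≤ a) (X : Finset ℕ) : family n b X ⊆ family n a X :=
  fun Y hY => by
    rw [PathSum.mem_family] at hY ⊢
    exact ⟨hY.1, hY.2.trans h⟩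

/-- Since `b ≤ a`, the family for the `b`-block is contained in that for the `a`-block, so the size
of the latter alone governs the cost of a round. -/
theorem trip_mainStep (H : Setup w L B n adj) {σ : State} {a b : ℕ} {X : Finset ℕ} (hba : b ≤ a)
    (han : a ≤ n) (I : MainInv n adj a b X σ) :
    Trip w L B mainStep σ (12000 * (n + 1) ^ 3 * (family n a X).card) (fun τ =>
      (τ vFlagX 0 = 0 ∧ remaining n b ∅ X = {X} ∧
        τ vTotPos 0 = joinedPos n adj a b ∧ τ vTotNeg 0 = joinedNeg n adj a b) ∨
      (τ vFlagX 0 = 1 ∧ ∃ X', MainInv n adj a b X' τ ∧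
        X ∉ remaining n b ∅ X' ∧ remaining n b ∅ X = insert X (remaining n b ∅ X'))) := by
  have A := H.amb
  have hXb : X.card ≤ b := by simpa using (PathSum.mem_family.mp I.mem).2
  have hcnt : σ vCntX 0 = X.card := by simpa using I.holds.cnt
  have hself := mem_remaining_self I.mem
  have hfam : 1 ≤ (family n a X).card := card_pos.mpr
    ⟨∅, PathSum.mem_family.mpr ⟨empty_subset _, by simpa using hXb.trans hba⟩⟩
  have hexp : (n + 1) ^ 3 ≤ (n + 1) ^ 3 * (family n a X).card := Nat.le_mul_of_pos_right _ hfam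
  have hpow1 : n + 1 ≤ (n + 1) ^ 3 := Nat.le_self_pow (by norm_num) _
  have hpow2 : (n + 1) ^ 2 ≤ (n + 1) ^ 3 := Nat.pow_le_pow_right (by omega) (by norm_num)
  have hcard : (n + 1) ^ 3 * (family n b X).card ≤ (n + 1) ^ 3 * (family n a X).card :=
    Nat.mul_le_mul_left _ (card_le_card (family_mono hba X))
  refine Trip.seq_of (N₂ := 8000 * (n + 1) ^ 3 * (family n a X).card)
    (trip_halfTable H (Or.inl rfl) (Or.inl rfl) han I.first hcnt (hXb.trans hba)) ?_
    (by nlinarith)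
  rintro σ₁ ⟨f1, hF⟩
  refine Trip.seq_of (N₂ := 4000 * (n + 1) ^ 3)
    (trip_halfTable H (Or.inr rfl) (Or.inr rfl) (hba.trans han) (I.second.frame f1 (by decide))
      (by rw [f1 vCntX (by decide), hcnt]) hXb) ?_ (by nlinarith)
  rintro σ₂ ⟨f2, hG⟩
  have f2' : Frame (vF :: vG :: halfRegs) σ σ₂ :=
    (f1.weaken (by decide)).trans f2 (by decide)
  refine Trip.seq_of (N₂ := 3000 * (n + 1) ^ 3)
    (trip_join H (X := X) han (hba.trans han) (by rw [f2' vN (by decide), I.first.num])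
      (fun u hu => by rw [f2 vF (by decide), hF u hu]) hG) ?_ (by nlinarith)
  rintro σ₃ ⟨f3, hJ⟩
  have f3' : Frame (vF :: vG :: halfRegs) σ σ₃ := f2'.trans f3 (by decide)
  have hPos : (1 - X.card % 2) * joined n adj a b X ≤
      ∑ Z ∈ remaining n b ∅ X, (1 - Z.card % 2) * joined n adj a b Z :=
    single_le_sum (f := fun Z => (1 - Z.card % 2) * joined n adj a b Z)
      (fun _ _ => Nat.zero_le _) hself
  have hNeg : X.card % 2 * joined n adj a b X ≤
      ∑ Z ∈ remaining n b ∅ X, Z.card % 2 * joined n adj a b Z :=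
    single_le_sum (f := fun Z => Z.card % 2 * joined n adj a b Z)
      (fun _ _ => Nat.zero_le _) hself
  have hPB : joinedPos n adj a b < 2 ^ B :=
    H.lt_of_le_pow (joinedPos_le H.adj_le han (hba.trans han)) (by nlinarith)
  have hNB : joinedNeg n adj a b < 2 ^ B :=
    H.lt_of_le_pow (joinedNeg_le H.adj_le han (hba.trans han)) (by nlinarith)
  have hP := I.pos
  have hN := I.neg
  refine Trip.stepVar A (x := σ vTotPos 0 + (1 - X.card % 2) * joined n adj a b X)
    (N' := 2000 * (n + 1) ^ 3) ?_ (by omega) (by simp) (by simp; omega) ?_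
  · simp only [val_add, val_sub, val_mul, val_arr, val_num]
    rw [f3' vTotPos (by decide), f3' vParX (by decide), I.holds.par, hJ]
  refine Trip.stepVar A (x := σ vTotNeg 0 + X.card % 2 * joined n adj a b X)
    (N' := 1000 * (n + 1)) ?_ (by omega) (by simp) (by simp; omega) ?_
  · simp (disch := decide) only [val_add, val_mul, val_arr, val_num, State.upd_ne]
    rw [f3' vTotNeg (by decide), f3' vParX (by decide), I.holds.par, hJ]
  have f4 : Frame (vTotPos :: vTotNeg :: vF :: vG :: halfRegs) σ
      ((σ₃.upd vTotPos 0 (σ vTotPos 0 + (1 - X.card % 2) * joined n adj a b X)).upd vTotNeg 0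
        (σ vTotNeg 0 + X.card % 2 * joined n adj a b X)) :=
    ((f3'.weaken (by decide)).upd (by decide)).upd (by decide)
  have e4 : ((σ₃.upd vTotPos 0 (σ vTotPos 0 + (1 - X.card % 2) * joined n adj a b X)).upd
      vTotNeg 0 (σ vTotNeg 0 + X.card % 2 * joined n adj a b X)) vTotPos 0 =
      σ vTotPos 0 + (1 - X.card % 2) * joined n adj a b X := by
    rw [State.upd_ne _ _ _ (by decide), State.upd_same]
  have e5 : ((σ₃.upd vTotPos 0 (σ vTotPos 0 + (1 - X.card % 2) * joined n adj a b X)).upd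
      vTotNeg 0 (σ vTotNeg 0 + X.card % 2 * joined n adj a b X)) vTotNeg 0 =
      σ vTotNeg 0 + X.card % 2 * joined n adj a b X := State.upd_same _ _ _ _
  generalize (σ₃.upd vTotPos 0 (σ vTotPos 0 + (1 - X.card % 2) * joined n adj a b X)).upd
      vTotNeg 0 (σ vTotNeg 0 + X.card % 2 * joined n adj a b X) = σ₄ at f4 e4 e5 ⊢
  have I1 := I.first.frame f4 (by decide)
  have I2 := I.second.frame f4 (by decide)
  have hempty : ∀ j < n, σ₄ vEmpty j = 0 := fun j hj => by
    rw [f4 vEmpty (by decide), I.empty j hj]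
  refine (trip_next H (by decide) I2.num I2.cap (hba.trans han) (Bs := ∅)
    (fun j hj => by simpa using hempty j hj) I.mem
    (I.holds.congr (f4 _ (by decide)) (f4 _ (by decide)) (f4 _ (by decide)))
    (by decide)).mono le_rfl ?_
  rintro τ ⟨f5, h⟩
  rw [← f5 vTotPos (by decide)] at e4
  rw [← f5 vTotNeg (by decide)] at e5
  rcases h with ⟨h0, hrem⟩ | ⟨h1, X', hX', hH', hnot, hrem⟩
  · rw [hrem, sum_singleton] at hP hN
    exact Or.inl ⟨h0, hrem, by rw [e4, hP], by rw [e5, hN]⟩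
  · rw [hrem, sum_insert hnot] at hP hN
    refine Or.inr ⟨h1, X', ⟨⟨?_, ?_, hH'.arr, ?_⟩, ⟨?_, ?_, hH'.arr, ?_⟩, hH',
      fun j hj => ?_, hX', ?_, ?_⟩, hnot, hrem⟩
    · rw [f5 vN (by decide), I1.num]
    · rw [f5 vA (by decide), I1.cap]
    · rw [f5 vT (by decide)]; exact I1.table
    · rw [f5 vN (by decide), I2.num]
    · rw [f5 vB (by decide), I2.cap]
    · rw [f5 vT (by decide)]; exact I2.table
    · rw [f5 vEmpty (by decide), hempty j hj]
    · rw [e4, add_assoc, hP]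
    · rw [e5, add_assoc, hN]

/-- Rounds have unequal costs, so the remaining time is measured by the sum of `(family n a Z).card`
over the sets `Z` still to come. For all sets together this is the number of pairs bounded in
`sum_card_family_le`. -/
theorem trip_mainLoop (H : Setup w L B n adj) {σ : State} {a b : ℕ} (hba : b ≤ a)
    (han : a ≤ n) (I : MainInv n adj a b ∅ σ) :
    Trip w L B mainLoop σ (12100 * (n + 1) ^ 3 * ∑ X ∈ family n b ∅, (family n a X).card + 200)
      (fun τ => τ vOut 0 = joinedPos n adj a b - joinedNeg n adj a b) := by
  have A := H.amb
  refine Trip.stepVar A (x := 1)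
    (N' := 12100 * (n + 1) ^ 3 * ∑ X ∈ family n b ∅, (family n a X).card + 150) (by simp)
    (H.small (by omega)) (by simp) (by simp; omega) ?_
  have hfr : Frame [vFlagX] σ (σ.upd vFlagX 0 1) := (Frame.refl _ σ).upd (by decide)
  have I' : MainInv n adj a b ∅ (σ.upd vFlagX 0 1) :=
    ⟨I.first.frame hfr (by decide), I.second.frame hfr (by decide),
      I.holds.congr (hfr _ (by decide)) (hfr _ (by decide)) (hfr _ (by decide)),
      by rw [hfr vEmpty (by decide)]; exact I.empty, I.mem,
      by rw [hfr vTotPos (by decide)]; exact I.pos,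
      by rw [hfr vTotNeg (by decide)]; exact I.neg⟩
  have hflag : (σ.upd vFlagX 0 1) vFlagX 0 = 1 := State.upd_same _ _ _ _
  generalize σ.upd vFlagX 0 1 = σ' at I' hflag
  refine Trip.seq_of (N₂ := 60) (R := fun τ => τ vTotPos 0 = joinedPos n adj a b ∧
      τ vTotNeg 0 = joinedNeg n adj a b)
    (Trip.of_loop A (by simp) (fun m τ =>
      (τ vFlagX 0 = 0 ∧ τ vTotPos 0 = joinedPos n adj a b ∧
        τ vTotNeg 0 = joinedNeg n adj a b) ∨
      (τ vFlagX 0 = 1 ∧ ∃ X, MainInv n adj a b X τ ∧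
        m = 12100 * (n + 1) ^ 3 * ∑ Z ∈ remaining n b ∅ X, (family n a Z).card))
      (m := 12100 * (n + 1) ^ 3 * ∑ X ∈ family n b ∅, (family n a X).card) ?_
      (Or.inr ⟨hflag, ∅, I', by rw [remaining_empty]⟩)) ?_ (by simp)
  · rintro m τ (⟨hf, hP⟩ | ⟨hf, X, hX, rfl⟩)
    · exact Or.inl ⟨by simp [hf], hP⟩
    · have hXb : X.card ≤ b := by simpa using (PathSum.mem_family.mp hX.mem).2
      have hfam : 1 ≤ (family n a X).card := card_pos.mpr
        ⟨∅, PathSum.mem_family.mpr ⟨empty_subset _, by simpa using hXb.trans hba⟩⟩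
      have hexp : 1 ≤ (n + 1) ^ 3 * (family n a X).card :=
        Nat.mul_pos (Nat.pow_pos (by omega)) hfam
      have hle : (family n a X).card ≤ ∑ Z ∈ remaining n b ∅ X, (family n a Z).card :=
        single_le_sum (f := fun Z => (family n a Z).card) (fun _ _ => Nat.zero_le _)
          (mem_remaining_self hX.mem)
      refine Or.inr ⟨by simp [hf], 12000 * (n + 1) ^ 3 * (family n a X).card,
        12100 * (n + 1) ^ 3 *
          (∑ Z ∈ remaining n b ∅ X, (family n a Z).card - (family n a X).card), ?_, ?_⟩
      · obtain ⟨r, hr⟩ := Nat.exists_eq_add_of_le hle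
        rw [hr, Nat.add_sub_cancel_left, mul_add]
        simp
        nlinarith
      · refine (trip_mainStep H hba han hX).mono le_rfl ?_
        rintro υ (⟨h2, _, h3⟩ | ⟨h2, X', h3, hnot, hrem⟩)
        · exact Or.inl ⟨h2, h3⟩
        · exact Or.inr ⟨h2, X', h3, by rw [hrem, sum_insert hnot, Nat.add_sub_cancel_left]⟩
  · rintro τ ⟨h1, h2⟩
    have hPB : joinedPos n adj a b < 2 ^ B :=
      H.lt_of_le_pow (joinedPos_le H.adj_le han (hba.trans han)) (by nlinarith)
    exact Trip.lastVar A (x := joinedPos n adj a b - joinedNeg n adj a b) (by simp [h1, h2])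
      (by omega) (by simp) (by simp) (State.upd_same _ _ _ _)

end main

/-! ### The input word, special cases and the total cost -/

section graph

theorem getD_graphInput {n : ℕ} (G : SimpleGraph (Fin n)) (k : ℕ) {u v : ℕ} (hu : u < n)
    (hv : v < n) : (graphInput G k).getD (2 + u * n + v) 0 = adjOf G u v := by
  classical
  have hlt : u * n + v < n * n := by nlinarith
  have hdiv : (u * n + v) / n = u := by
    rw [mul_comm, Nat.mul_add_div (by omega), Nat.div_eq_of_lt hv, add_zero]
  have hmod : (u * n + v) % n = v := by
    rw [mul_comm, Nat.mul_add_mod, Nat.mod_eq_of_lt hv]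
  rw [show 2 + u * n + v = (u * n + v) + 1 + 1 by ring, graphInput, List.getD_cons_succ,
    List.getD_cons_succ, List.getD_eq_getElem _ _ (by simpa using hlt), List.getElem_ofFn, adjOf]
  have h1 : (⟨u * n + v, hlt⟩ : Fin (n * n)).divNat = ⟨u, hu⟩ := Fin.ext hdiv
  have h2 : (⟨u * n + v, hlt⟩ : Fin (n * n)).modNat = ⟨v, hv⟩ := Fin.ext hmod
  rw [h1, h2]
  congr 1
  exact propext ⟨fun h => ⟨hu, hv, h⟩, fun ⟨_, _, h⟩ => h⟩

theorem getD_graphInput_le {n : ℕ} (G : SimpleGraph (Fin n)) (k i : ℕ) :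
    (graphInput G k).getD i 0 ≤ n + k + 1 := by
  classical
  rcases i with _ | _ | i
  · simp [graphInput]; omega
  · simp [graphInput]; omega
  · rw [graphInput, List.getD_cons_succ, List.getD_cons_succ]
    by_cases hi : i < n * n
    · rw [List.getD_eq_getElem _ _ (by simpa using hi), List.getElem_ofFn]
      split_ifs <;> omega
    · rw [List.getD_eq_default _ _ (by simpa using hi)]
      omega

theorem pathCount_zero {n : ℕ} (G : SimpleGraph (Fin n)) : pathCount G 0 = n := by
  rw [pathCount]
  have e : {v : Fin (0 + 1) → Fin n //
      Function.Injective v ∧ ∀ i : Fin 0, G.Adj (v i.castSucc) (v i.succ)} ≃ Fin n :=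
    (Equiv.subtypeUnivEquiv fun v =>
      ⟨fun i j _ => Subsingleton.elim (α := Fin 1) i j, fun i => i.elim0⟩).trans
      (Equiv.funUnique (Fin 1) (Fin n))
  rw [Nat.card_congr e, Nat.card_fin]

theorem pathCount_of_le {n k : ℕ} (G : SimpleGraph (Fin n)) (h : n ≤ k) : pathCount G k = 0 := by
  rw [pathCount, Nat.card_eq_zero]
  left
  refine ⟨fun v => ?_⟩
  have := Fintype.card_le_of_injective v.1 v.2.1
  simp at this
  omega

/-- The arrays need `(n + 2)^2` entries for the binomial table, and the largest totals have `O(n^2)`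
bits; `k` is included in both bounds so that the numbers `n` and `k` of the input fit as well. -/
theorem setup_graphInput {n k : ℕ} (G : SimpleGraph (Fin n)) :
    Setup (graphInput G k) ((n + k + 2) ^ 2) (9 * (n + k + 2) ^ 2) n (adjOf G) := by
  have hsq : n + k + 2 ≤ (n + k + 2) ^ 2 := Nat.le_self_pow (by norm_num) _
  have hle : (n + 2) * (n + 2) ≤ (n + k + 2) ^ 2 := by
    rw [pow_two]; exact Nat.mul_le_mul (by omega) (by omega)
  refine ⟨⟨by omega, by omega, fun i => ?_⟩, fun u hu v hv => getD_graphInput G k hu hv,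
    adjOf_le G, hle, ?_, by omega⟩
  · calc _ ≤ n + k + 1 := getD_graphInput_le G k i
      _ < 9 * (n + k + 2) ^ 2 := by omega
      _ < 2 ^ (9 * (n + k + 2) ^ 2) := Nat.lt_two_pow_self
  · exact le_trans (by omega) (Nat.lt_two_pow_self (n := 9 * (n + k + 2) ^ 2)).le

theorem total_le {z μ S : ℕ} (hz : n + 1 ≤ z) (hμ : 1 ≤ μ) (hS : S ≤ 3 * n * (n + 1) * μ) :
    12100 * (n + 1) ^ 3 * S + 200 ≤ 37000 * (z ^ 5 * μ) := by
  have h1 : (n + 1) ^ 3 * S ≤ z ^ 3 * (3 * z * z * μ) :=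
    Nat.mul_le_mul (Nat.pow_le_pow_left hz 3) (hS.trans (Nat.mul_le_mul_right μ
      (Nat.mul_le_mul (Nat.mul_le_mul_left 3 (by omega)) hz)))
  have h2 : z ^ 3 * (3 * z * z * μ) = 3 * (z ^ 5 * μ) := by ring
  have h3 : 1 ≤ z ^ 5 * μ := Nat.mul_pos (Nat.pow_pos (by omega)) hμ
  rw [mul_assoc]
  omega

/-- The case `k = 0` is separate because the second block would be empty, and `k ≥ n` because the
estimate of the binomial coefficients needs `k < n`. -/
theorem trip_program {n : ℕ} (G : SimpleGraph (Fin n)) (k : ℕ) :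
    Trip (graphInput G k) ((n + k + 2) ^ 2) (9 * (n + k + 2) ^ 2) program (fun _ _ => 0)
      (40000 * (n + k + 2) ^ 5 * max 1 (3 ^ (k / 2) * n.choose (k / 2)))
      (fun τ => τ vOut 0 = pathCount G k) := by
  have H := setup_graphInput (k := k) G
  have A := H.amb
  set B := 9 * (n + k + 2) ^ 2 with hB
  set z := n + k + 2 with hz
  set μ := max 1 (3 ^ (k / 2) * n.choose (k / 2)) with hμ
  have hμ1 : 1 ≤ μ := le_max_left _ _
  have hkB : k + 1 < 2 ^ B := by
    have hsq : z ≤ z ^ 2 := Nat.le_self_pow (by norm_num) _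
    exact lt_of_lt_of_le (by omega) (Nat.lt_two_pow_self (n := B)).le
  have hz5 : z ≤ z ^ 5 := Nat.le_self_pow (by norm_num) _
  have hzμ : z ^ 5 ≤ z ^ 5 * μ := Nat.le_mul_of_pos_right _ hμ1
  rw [mul_assoc]
  refine Trip.stepVar A (x := n) (N' := 39900 * (z ^ 5 * μ)) (by simp [graphInput])
    (H.small (by omega)) (by simp) (by simp; omega) ?_
  refine Trip.stepVar A (x := k) (N' := 39800 * (z ^ 5 * μ)) (by simp [graphInput])
    (by omega) (by simp) (by simp; omega) ?_
  set σ : State := (State.upd (State.upd (fun _ _ => 0) vN 0 n) vK 0 k) with hσ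
  have hn : σ vN 0 = n := by rw [hσ, State.upd_ne _ _ _ (by decide), State.upd_same]
  have hk : σ vK 0 = k := State.upd_same _ _ _ _
  have h0 : ∀ j, j ≠ vN → j ≠ vK → ∀ x, σ j x = 0 := fun j h1 h2 x => by
    rw [hσ, State.upd_ne _ _ _ h2, State.upd_ne _ _ _ h1]
  clear_value σ
  refine (Trip.of_branch A (N := 39700 * (z ^ 5 * μ)) (by simp) (fun hk0 => ?_)
    fun hk0 => ?_).mono (by simp; omega) fun _ h => h
  swap
  · simp [hk] at hk0
    refine Trip.lastVar A (x := n) (by simp [hn]) (H.small (by omega)) (by simp)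
      (by simp; omega) ?_
    rw [State.upd_same, hk0, pathCount_zero]
  refine (Trip.of_branch A (N := 39600 * (z ^ 5 * μ)) (by simp) (fun hkn => ?_)
    fun hkn => ?_).mono (by simp; omega) fun _ h => h
  swap
  · simp [hn, hk] at hkn
    refine Trip.lastVar A (x := 0) (by simp) (H.small (by omega)) (by simp)
      (by simp; omega) ?_
    rw [State.upd_same, pathCount_of_le G (by omega)]
  simp [hk] at hk0
  simp [hn, hk] at hkn
  have hkn : k < n := by omega
  set b := (k + 1) / 2 with hb
  set a := k + 1 - b with ha
  have hz2 : (n + 1) ^ 2 ≤ z ^ 5 :=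
    (Nat.pow_le_pow_left (by omega) 2).trans (Nat.pow_le_pow_right (by omega) (by norm_num))
  refine Trip.seq_of (N₂ := 39000 * (z ^ 5 * μ))
    (trip_halves A hk hkB (h0 vB (by decide) (by decide) 0)) ?_ (by omega)
  rintro σ₁ ⟨f1, hb1, ha1⟩
  refine Trip.seq_of (N₂ := 37000 * (z ^ 5 * μ)) (trip_pascal H (by rw [f1 vN (by decide), hn])
    (fun x => by rw [f1 vT (by decide), h0 vT (by decide) (by decide)])) ?_ (by omega)
  rintro σ₂ ⟨f2, hT⟩
  have f2' : Frame [vI, vJ, vT, vA, vB] σ σ₂ := (f1.weaken (by decide)).trans f2 (by decide)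
  -- All other registers still hold the initial zeros, which serve as the empty set `X`, its size
  -- and parity, and the two totals.
  have hz2' : ∀ j, j ∉ [vI, vJ, vT, vA, vB, vN, vK] → ∀ x, σ₂ j x = 0 := by
    intro j hj x
    simp only [List.mem_cons, List.not_mem_nil, or_false, not_or] at hj
    rw [f2' j (by simp [hj]), h0 j hj.2.2.2.2.2.1 hj.2.2.2.2.2.2]
  have I : MainInv n (adjOf G) a b ∅ σ₂ := by
    have hn2 : σ₂ vN 0 = n := by rw [f2' vN (by decide), hn]
    have hset : ∀ j < n, σ₂ vX j = if j ∈ (∅ : Finset ℕ) then 1 else 0 := fun j _ => by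
      rw [hz2' vX (by decide)]; simp
    refine ⟨⟨hn2, by rw [f2 vA (by decide), ha1], hset, hT⟩,
      ⟨hn2, by rw [f2 vB (by decide), hb1], hset, hT⟩,
      ⟨hset, by rw [hz2' vCntX (by decide)]; simp, by rw [hz2' vParX (by decide)]; simp⟩,
      fun j _ => hz2' vEmpty (by decide) j, by simp [PathSum.mem_family], ?_, ?_⟩
    · rw [hz2' vTotPos (by decide), remaining_empty, zero_add, joinedPos]
    · rw [hz2' vTotNeg (by decide), remaining_empty, zero_add, joinedNeg]
  refine (trip_mainLoop H (by omega) (by omega) I).mono ?_ fun τ hτ => ?_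
  · have hsum := sum_card_family_le (b := b) hkn (show a ≤ k / 2 + 1 by omega)
    have hμ2 : 3 ^ (k / 2) * n.choose (k / 2) ≤ μ := le_max_right _ _
    exact total_le (by omega) hμ1 (hsum.trans (Nat.mul_le_mul_left _ hμ2))
  · rw [hτ, pathCount_eq G (show a + b = k + 1 by omega) (by omega) (by omega)]

end graph

end PathSum

end

open PathSum RAM in
theorem count_paths {n : ℕ} (G : SimpleGraph (Fin n)) (k : ℕ) :
    ∃ (t s : ℕ) (M : Mem), Exec (graphInput G k) program 0 t s M ∧ M 0 = pathCount G k ∧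
      t ≤ 40000 * 873 ^ 2 * (n + k + 2) ^ 9 * max 1 (3 ^ (k / 2) * n.choose (k / 2)) ∧
      s ≤ 128 * 1000 * (n + k + 2) ^ 4 := by
  have hz : 1 ≤ (n + k + 2) ^ 2 := Nat.one_le_pow _ _ (by omega)
  have h0 : Enc ((n + k + 2) ^ 2) (9 * (n + k + 2) ^ 2) 0 (fun _ _ => 0) :=
    ⟨⟨fun _ _ => rfl, fun _ => by simp⟩, fun _ _ => rfl, fun _ _ => by simp⟩
  obtain ⟨M, σ, hM, hσ, t, s, he, ht, hs⟩ := trip_program G k 0 h0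
  refine ⟨t, s, M, he, ?_, ht.trans ?_, hs.trans ?_⟩
  · rw [← hσ]
    simpa using hM.2.1 0 0
  · generalize max 1 (3 ^ (k / 2) * n.choose (k / 2)) = μ
    generalize n + k + 2 = z at hz
    -- Each instruction costs at most `(96 * B + 9)^2` with `B = 9 * z^2`; here `873 = 96 * 9 + 9`,
    -- and the square contributes `z^4`.
    calc 40000 * z ^ 5 * μ * (96 * (9 * z ^ 2) + 9) ^ 2
        ≤ 40000 * z ^ 5 * μ * (873 * z ^ 2) ^ 2 :=
          Nat.mul_le_mul_left _ (Nat.pow_le_pow_left (by omega) 2)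
      _ = _ := by ring
  · generalize n + k + 2 = z at hz
    -- Here `1000 = 128 + 96 * 9 + 8`.
    calc 128 * z ^ 2 * (128 * z ^ 2 + (96 * (9 * z ^ 2) + 8))
        ≤ 128 * z ^ 2 * (1000 * z ^ 2) := Nat.mul_le_mul_left _ (by omega)
      _ = _ := by ring

theorem theorem3 :
    ∃ (P : RAM.Prog) (p q : MvPolynomial (Fin 2) ℕ),
      ∀ (n k : ℕ) (G : SimpleGraph (Fin n)),
        ∃ (t s : ℕ) (M : RAM.Mem),
          RAM.Exec (graphInput G k) P 0 t s M ∧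
          M 0 = pathCount G k ∧
          t ≤ MvPolynomial.eval ![n, k] p * max 1 (3 ^ (k / 2) * n.choose (k / 2)) ∧
          s ≤ MvPolynomial.eval ![n, k] q := by
  refine ⟨PathSum.program,
    MvPolynomial.C (40000 * 873 ^ 2) *
      (MvPolynomial.X 0 + MvPolynomial.X 1 + MvPolynomial.C 2) ^ 9,
    MvPolynomial.C (128 * 1000) *
      (MvPolynomial.X 0 + MvPolynomial.X 1 + MvPolynomial.C 2) ^ 4, fun n k G => ?_⟩
  simp only [map_mul, map_add, map_pow, MvPolynomial.eval_C, MvPolynomial.eval_X,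
    Matrix.cons_val_zero, Matrix.cons_val_one]
  exact count_paths G k
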